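/- A \emph{unital $C^*$-category} is a category whose morphism spaces are complex Banach spaces, with bilinear composition satisfying $\|g \circ f\| \le \|g\|\,\|f\|$, together with an antilinear involutive contravariant functor $*$ which is the identity on objects, such that $\|f^* \circ f\| = \|f\|^2$ and $f^* \circ f$ is positive in the $C^*$-algebra $\mathrm{End}(X)$ for every morphism $f: X \to Y$. A small unital $C^*$-category is \emph{finitely additive} if it is subobject complete (every $p = p^2 = p^* \in \mathrm{End}(X)$ is of the form $p = i \circ i^*$ with $i: U \to X$ and $i^* \circ i = \mathrm{id}_U$) and has all finite direct sums (including the empty one), with isometric inclusions whose range projections are pairwise orthogonal and add up to the identity. Let $C^*\mathrm{lin}$ be the $2$-category whose objects are the finitely additive $C^*$-categories, whose $1$-morphisms are the unital linear $*$-functors, and whose $2$-morphisms are the natural transformations, that is, the natural families of morphisms that are uniformly bounded in norm. For $\mathbf V, \mathbf W \in C^*\mathrm{lin}$, the category $C^*\mathrm{lin}(\mathbf V, \mathbf W)$ of $1$-morphisms from $\mathbf V$ to $\mathbf W$ and their $2$-morphisms, with pointwise linear structure and involution and with the supremum norm, is again a finitely additive $C^*$-category. For $\mathbf U, \mathbf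 V \in C^*\mathrm{lin}$ let $\mathbf U \boxdot \mathbf V$ be the $*$-category with objects the pairs $(U,V)$ of objects of $\mathbf U$ and $\mathbf V$ and with morphism spaces the algebraic tensor products $\mathbf U(U,U') \otimes \mathbf V(V,V')$ over $\mathbb C$. Let $\mathbf U \boxdot_{\max} \mathbf V$ be its completion with respect to the norm $\|t\|_{\max} = \sup_\pi \|\pi(t)\|$, where $\pi$ ranges over all unital linear $*$-functors from $\mathbf U \boxdot \mathbf V$ to the category of Hilbert spaces and bounded linear operators. Let $\mathbf U \boxtimes_{\max} \mathbf V$ be the subobject completion of $\mathbf U \boxdot_{\max} \mathbf V$: its objects are the pairs $(X,p)$ of an object $X$ and a projection $p \in \mathrm{End}(X)$, and its morphisms $(X,p) \to (Y,q)$ are the morphisms $h: X \to Y$ with $h \circ p = h = q \circ h$. This is a finitely additive $C^*$-category, pseudofunctorial in $\mathbf U$ and $\mathbf V$. \textbf{Proposition.} For all finitely additive $C^*$-categories $\mathbf U, \mathbf V, \mathbf W$ there is an equivalence of $C^*$-categories $$ C^*\mathrm{lin}(\mathbf U \boxtimes_{\max} \mathbf V, \mathbf W) \simeq C^*\mathrm{lin}(\mathbf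 U, C^*\mathrm{lin}(\mathbf V, \mathbf W)), $$ pseudonatural in all variables. More precisely, there is a pseudonatural transformation between the two sides, viewed as pseudofunctors $$ (C^*\mathrm{lin})^{\mathrm{op}} \times (C^*\mathrm{lin})^{\mathrm{op}} \times C^*\mathrm{lin} \to C^*\mathrm{lin} $$ in $(\mathbf U, \mathbf V, \mathbf W)$ (where $\mathrm{op}$ reverses the $1$-morphisms only), each of whose components is an equivalence in $C^*\mathrm{lin}$. In this sense $C^*\mathrm{lin}(\mathbf V, \mathbf W)$ is an internal Hom in $C^*\mathrm{lin}$ with respect to $\boxtimes_{\max}$. -/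

import Mathlib

/- The `2`-category of finitely additive `C*`-categories, its internal homs and the maximal tensor
product. -/

universe u

noncomputable section

namespace CStarCat

open CategoryTheory

universe v

/-- The structure of a unital `C*`-category except for positivity of `f* ∘ f`: a category enriched
in complex Banach spaces and contractive bilinear composition maps, together with an antilinear
involutive contravariant endofunctor `adj` which is the identity on objects, satisfying the
`C*`-identity. Composition is written in diagrammatic order, so `f* ∘ f` is `f ≫ adj f`. -/
class PreCStarCategory (C : Type u) extends Category.{v} C where
  [homNormed : ∀ X Y : C, NormedAddCommGroup (X ⟶ Y)]
  [homSpace : ∀ X Y : C, NormedSpace ℂ (X ⟶ Y)]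
  [homComplete : ∀ X Y : C, CompleteSpace (X ⟶ Y)]
  add_comp : ∀ {X Y Z : C} (f f' : X ⟶ Y) (g : Y ⟶ Z), (f + f') ≫ g = f ≫ g + f' ≫ g
  comp_add : ∀ {X Y Z : C} (f : X ⟶ Y) (g g' : Y ⟶ Z), f ≫ (g + g') = f ≫ g + f ≫ g'
  smul_comp : ∀ {X Y Z : C} (c : ℂ) (f : X ⟶ Y) (g : Y ⟶ Z), (c • f) ≫ g = c • (f ≫ g)
  comp_smul : ∀ {X Y Z : C} (c : ℂ) (f : X ⟶ Y) (g : Y ⟶ Z), f ≫ (c • g) = c • (f ≫ g)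
  norm_comp_le : ∀ {X Y Z : C} (f : X ⟶ Y) (g : Y ⟶ Z), ‖f ≫ g‖ ≤ ‖f‖ * ‖g‖
  /-- The involution `f ↦ f*`. -/
  adj : ∀ {X Y : C}, (X ⟶ Y) → (Y ⟶ X)
  adj_adj : ∀ {X Y : C} (f : X ⟶ Y), adj (adj f) = f
  adj_comp : ∀ {X Y Z : C} (f : X ⟶ Y) (g : Y ⟶ Z), adj (f ≫ g) = adj g ≫ adj f
  adj_add : ∀ {X Y : C} (f g : X ⟶ Y), adj (f + g) = adj f + adj g
  adj_smul : ∀ {X Y : C} (c : ℂ) (f : X ⟶ Y), adj (c • f) = star c • adj f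
  norm_comp_adj : ∀ {X Y : C} (f : X ⟶ Y), ‖f ≫ adj f‖ = ‖f‖ ^ 2

attribute [reducible, instance] PreCStarCategory.homNormed PreCStarCategory.homSpace
attribute [instance] PreCStarCategory.homComplete

open PreCStarCategory

attribute [simp] adj_adj adj_comp adj_add adj_smul add_comp comp_add smul_comp comp_smul

section Pre

variable {C : Type u} [PreCStarCategory.{u, v} C] {X Y Z : C}

@[simp] lemma adj_id (X : C) : adj (𝟙 X) = 𝟙 X := by
  calc adj (𝟙 X) = adj (𝟙 X) ≫ adj (adj (𝟙 X)) := by rw [adj_adj, Category.comp_id]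
    _ = 𝟙 X := by rw [← adj_comp, Category.comp_id, adj_adj]

/-- The adjoint as an additive map. -/
def adjHom (X Y : C) : (X ⟶ Y) →+ (Y ⟶ X) := AddMonoidHom.mk' adj adj_add

/-- Composition as a bilinear map. -/
def compL (X Y Z : C) : (X ⟶ Y) →ₗ[ℂ] (Y ⟶ Z) →ₗ[ℂ] (X ⟶ Z) :=
  LinearMap.mk₂ ℂ (fun f g => f ≫ g) add_comp smul_comp comp_add comp_smul

lemma compL_apply (f : X ⟶ Y) (g : Y ⟶ Z) : compL X Y Z f g = f ≫ g := rfl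

@[simp] lemma adj_zero : adj (0 : X ⟶ Y) = 0 := (adjHom X Y).map_zero
@[simp] lemma adj_neg (f : X ⟶ Y) : adj (-f) = -adj f := (adjHom X Y).map_neg f
@[simp] lemma adj_sub (f g : X ⟶ Y) : adj (f - g) = adj f - adj g := (adjHom X Y).map_sub f g
lemma adj_sum {ι : Type*} (s : Finset ι) (f : ι → (X ⟶ Y)) :
    adj (∑ i ∈ s, f i) = ∑ i ∈ s, adj (f i) := map_sum (adjHom X Y) f s
@[simp] lemma zero_comp (g : Y ⟶ Z) : (0 : X ⟶ Y) ≫ g = 0 :=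
  (compL X Y Z).map_zero₂ g
@[simp] lemma comp_zero (f : X ⟶ Y) : f ≫ (0 : Y ⟶ Z) = 0 := (compL X Y Z f).map_zero
@[simp] lemma neg_comp (f : X ⟶ Y) (g : Y ⟶ Z) : (-f) ≫ g = -(f ≫ g) := (compL X Y Z).map_neg₂ f g
@[simp] lemma comp_neg (f : X ⟶ Y) (g : Y ⟶ Z) : f ≫ (-g) = -(f ≫ g) := (compL X Y Z f).map_neg g
@[simp] lemma sub_comp (f f' : X ⟶ Y) (g : Y ⟶ Z) : (f - f') ≫ g = f ≫ g - f' ≫ g :=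
  (compL X Y Z).map_sub₂ f f' g
@[simp] lemma comp_sub (f : X ⟶ Y) (g g' : Y ⟶ Z) : f ≫ (g - g') = f ≫ g - f ≫ g' :=
  (compL X Y Z f).map_sub g g'
lemma sum_comp {ι : Type*} (s : Finset ι) (f : ι → (X ⟶ Y)) (g : Y ⟶ Z) :
    (∑ i ∈ s, f i) ≫ g = ∑ i ∈ s, f i ≫ g := map_sum ((compL X Y Z).flip g) f s
lemma comp_sum {ι : Type*} (s : Finset ι) (f : X ⟶ Y) (g : ι → (Y ⟶ Z)) :
    f ≫ (∑ i ∈ s, g i) = ∑ i ∈ s, f ≫ g i := map_sum (compL X Y Z f) g s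

lemma norm_adj (f : X ⟶ Y) : ‖adj f‖ = ‖f‖ := by
  have key : ∀ {X Y : C} (f : X ⟶ Y), ‖f‖ ≤ ‖adj f‖ := by
    intro X Y f
    by_cases h : ‖f‖ = 0
    · rw [h]; positivity
    · have h1 : ‖f‖ ^ 2 ≤ ‖f‖ * ‖adj f‖ := by
        rw [← norm_comp_adj]; exact norm_comp_le _ _
      have h2 : 0 < ‖f‖ := lt_of_le_of_ne (norm_nonneg _) (Ne.symm h)
      nlinarith
  refine le_antisymm ?_ (key f)
  simpa using key (adj f)

lemma norm_id_le (X : C) : ‖𝟙 X‖ ≤ 1 := by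
  have h : ‖𝟙 X‖ = ‖𝟙 X‖ ^ 2 := by rw [← norm_comp_adj]; simp
  nlinarith [norm_nonneg (𝟙 X)]

lemma continuous_comp_left (f : X ⟶ Y) : Continuous fun g : Y ⟶ Z => f ≫ g :=
  ((compL X Y Z f).mkContinuous ‖f‖ (norm_comp_le f)).continuous

lemma continuous_comp_right (g : Y ⟶ Z) : Continuous fun f : X ⟶ Y => f ≫ g :=
  (((compL X Y Z).flip g).mkContinuous ‖g‖
    (fun f => (norm_comp_le f g).trans_eq (mul_comm _ _))).continuous

lemma continuous_adj : Continuous fun f : X ⟶ Y => adj f :=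
  AddMonoidHomClass.continuous_of_bound (adjHom X Y) 1
    (fun f => ((norm_adj f).trans (one_mul _).symm).le)

/-- The ring of endomorphisms of an object; its product is `f * g = g ≫ f`. -/
@[reducible] def endNormedRing (X : C) : NormedRing (End X) :=
  { (inferInstance : Monoid (End X)), homNormed X X with
    left_distrib := fun a b c => add_comp (C := C) b c a
    right_distrib := fun a b c => comp_add (C := C) c a b
    zero_mul := fun a => comp_zero (C := C) a
    mul_zero := fun a => zero_comp (C := C) a
    norm_mul_le := fun a b => (norm_comp_le (C := C) b a).trans_eq (_root_.mul_comm _ _) }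

/-- The `C*`-algebra of endomorphisms of an object. -/
@[reducible] def endCStarAlgebra (X : C) : CStarAlgebra (End X) :=
  letI := endNormedRing X
  letI : StarRing (End X) :=
    { star := fun f => adj (C := C) f
      star_involutive := fun f => adj_adj (C := C) f
      star_mul := fun a b => adj_comp (C := C) b a
      star_add := fun a b => adj_add (C := C) a b }
  letI : Module ℂ (End X) := (homSpace X X).toModule
  letI : Algebra ℂ (End X) :=
    Algebra.ofModule (fun r a b => comp_smul (C := C) r b a) (fun r a b => smul_comp (C := C) r b a)
  letI : NormedAlgebra ℂ (End X) := { norm_smul_le := (homSpace X X).norm_smul_le }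
  { toCompleteSpace := homComplete X X
    norm_mul_self_le := fun a => ((_root_.pow_two _).symm.trans (norm_comp_adj (C := C) a).symm).le
    star_smul := fun r a => adj_smul (C := C) r a }

/-- Positivity of the `a = f* ∘ f` can be read off from norms. -/
lemma norm_sub_le_of_pos {X : C} (g : X ⟶ X) {t : ℝ} (ht : ‖g ≫ adj g‖ ≤ t) :
    ‖(t : ℂ) • 𝟙 X - g ≫ adj g‖ ≤ t := by
  let := endCStarAlgebra X
  let : PartialOrder (End X) := CStarAlgebra.spectralOrder _
  let : StarOrderedRing (End X) := CStarAlgebra.spectralOrderedRing _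
  have ht0 : 0 ≤ t := (norm_nonneg _).trans ht
  let G : End X := g
  have hsa : IsSelfAdjoint (star G * G) := IsSelfAdjoint.star_mul_self G
  have hpos : (0 : End X) ≤ star G * G := star_mul_self_nonneg G
  have h1 : SpectrumRestricts (star G * G) ContinuousMap.realToNNReal :=
    SpectrumRestricts.nnreal_of_nonneg hpos
  have h2 := (SpectrumRestricts.nnreal_iff_nnnorm (t := ⟨t, ht0⟩) hsa ht).1 h1
  have h3 : algebraMap ℝ (End X) t = ((t : ℂ) • 𝟙 X : X ⟶ X) := by
    rw [Algebra.algebraMap_eq_smul_one]; rfl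
  have h4 : ‖algebraMap ℝ (End X) t - star G * G‖ ≤ t := h2
  rw [h3] at h4
  exact h4

lemma exists_of_norm_sub_le {X : C} (a : X ⟶ X) (ha : adj a = a)
    (h : ‖(‖a‖ : ℂ) • 𝟙 X - a‖ ≤ ‖a‖) : ∃ g : X ⟶ X, a = g ≫ adj g := by
  let := endCStarAlgebra X
  let : PartialOrder (End X) := CStarAlgebra.spectralOrder _
  let : StarOrderedRing (End X) := CStarAlgebra.spectralOrderedRing _
  let A : End X := a
  have hsa : IsSelfAdjoint A := ha
  have h3 : algebraMap ℝ (End X) ‖a‖ = ((‖a‖ : ℂ) • 𝟙 X : X ⟶ X) := by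
    rw [Algebra.algebraMap_eq_smul_one]; rfl
  have h4 : ‖algebraMap ℝ (End X) ‖a‖ - A‖ ≤ ‖a‖ := by rw [h3]; exact h
  have h2 := (SpectrumRestricts.nnreal_iff_nnnorm (t := ‖A‖₊) hsa le_rfl).2 h4
  have hpos : 0 ≤ A := nonneg_iff_isSelfAdjoint_and_quasispectrumRestricts.2 ⟨hsa, h2⟩
  obtain ⟨g, hg⟩ := CStarAlgebra.nonneg_iff_eq_star_mul_self.1 hpos
  exact ⟨g, hg⟩

end Pre
/-- A unital `C*`-category: moreover `f* ∘ f` is a positive element of the `C*`-algebra of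
endomorphisms of `X` (that is, of the form `g* ∘ g` in that algebra) for every `f : X ⟶ Y`. -/
class UnitalCStarCategory (C : Type u) extends PreCStarCategory.{u, v} C where
  pos : ∀ {X Y : C} (f : X ⟶ Y), ∃ g : X ⟶ X, f ≫ adj f = g ≫ adj g

lemma norm_smul_id_sub_le {C : Type u} [UnitalCStarCategory.{u, v} C] {X Y : C} (f : X ⟶ Y)
    {t : ℝ} (ht : ‖f‖ ^ 2 ≤ t) : ‖(t : ℂ) • 𝟙 X - f ≫ adj f‖ ≤ t := by
  rw [← norm_comp_adj] at ht
  obtain ⟨g, hg⟩ := UnitalCStarCategory.pos f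
  rw [hg] at ht ⊢
  exact norm_sub_le_of_pos g ht

/-- A finitely additive `C*`-category (for a category which is already small and unital): every
projection splits, and all finite direct sums exist. As the category is unital, multiplier
morphisms are just morphisms. -/
class IsFinitelyAdditive (C : Type u) [UnitalCStarCategory.{u, v} C] : Prop where
  exists_split : ∀ (X : C) (p : X ⟶ X), p ≫ p = p → adj p = p →
    ∃ (U : C) (i : U ⟶ X), i ≫ adj i = 𝟙 U ∧ adj i ≫ i = p
  exists_directSum : ∀ (n : ℕ) (X : Fin n → C), ∃ (S : C) (i : ∀ k, X k ⟶ S),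
    (∀ k, i k ≫ adj (i k) = 𝟙 (X k)) ∧ (∀ k l, k ≠ l → i k ≫ adj (i l) = 0) ∧
      ∑ k, adj (i k) ≫ i k = 𝟙 S

universe u₁ v₁ u₂ v₂ u₃ v₃ u₄ v₄

/-- A unital linear `*`-functor between unital `C*`-categories. -/
structure StarFunctor (C : Type u₁) [UnitalCStarCategory.{u₁, v₁} C] (D : Type u₂)
    [UnitalCStarCategory.{u₂, v₂} D] extends C ⥤ D where
  map_add : ∀ {X Y : C} (f g : X ⟶ Y), map (f + g) = map f + map g
  map_smul : ∀ {X Y : C} (c : ℂ) (f : X ⟶ Y), map (c • f) = c • map f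
  map_adj : ∀ {X Y : C} (f : X ⟶ Y), map (adj f) = adj (map f)

namespace StarFunctor

variable {C : Type u₁} [UnitalCStarCategory.{u₁, v₁} C] {D : Type u₂}
  [UnitalCStarCategory.{u₂, v₂} D] {E : Type u₃} [UnitalCStarCategory.{u₃, v₃} E]

attribute [simp] map_add map_smul map_adj

/-- The identity functor. -/
def id (C : Type u₁) [UnitalCStarCategory.{u₁, v₁} C] : StarFunctor C C where
  toFunctor := 𝟭 C
  map_add _ _ := rfl
  map_smul _ _ := rfl
  map_adj _ := rfl

/-- Composition of functors. -/
def comp (F : StarFunctor C D) (G : StarFunctor D E) : StarFunctor C E where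
  toFunctor := F.toFunctor ⋙ G.toFunctor
  map_add _ _ := by simp
  map_smul _ _ := by simp
  map_adj _ := by simp

/-- The linear maps on morphism spaces. -/
def mapL (F : StarFunctor C D) (X Y : C) : (X ⟶ Y) →ₗ[ℂ] (F.obj X ⟶ F.obj Y) where
  toFun := F.map
  map_add' := F.map_add
  map_smul' := F.map_smul

@[simp] lemma map_zero (F : StarFunctor C D) {X Y : C} : F.map (0 : X ⟶ Y) = 0 :=
  (F.mapL X Y).map_zero

lemma map_sub (F : StarFunctor C D) {X Y : C} (f g : X ⟶ Y) : F.map (f - g) = F.map f - F.map g :=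
  (F.mapL X Y).map_sub f g

lemma map_sum (F : StarFunctor C D) {X Y : C} {ι : Type*} (s : Finset ι) (f : ι → (X ⟶ Y)) :
    F.map (∑ i ∈ s, f i) = ∑ i ∈ s, F.map (f i) := _root_.map_sum (F.mapL X Y) f s

lemma norm_map_le (F : StarFunctor C D) {X Y : C} (f : X ⟶ Y) : ‖F.map f‖ ≤ ‖f‖ := by
  let := endCStarAlgebra X
  let := endCStarAlgebra (F.obj X)
  let φ : End X →⋆ₙₐ[ℂ] End (F.obj X) :=
    { toFun := fun a => F.map a
      map_smul' := fun c a => F.map_smul c a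
      map_zero' := F.map_zero
      map_add' := fun a b => F.map_add a b
      map_mul' := fun a b => F.map_comp b a
      map_star' := fun a => F.map_adj a }
  have h : ‖F.map (f ≫ adj f)‖ ≤ ‖f ≫ adj f‖ :=
    NonUnitalStarAlgHom.norm_apply_le φ (show End X from f ≫ adj f)
  rw [F.map_comp, F.map_adj, norm_comp_adj, norm_comp_adj] at h
  exact (sq_le_sq₀ (norm_nonneg _) (norm_nonneg _)).1 h

end StarFunctor

namespace StarFunctor

variable {C : Type u₁} [UnitalCStarCategory.{u₁, v₁} C] {D : Type u₂}
  [UnitalCStarCategory.{u₂, v₂} D] {E : Type u₃} [UnitalCStarCategory.{u₃, v₃} E]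

/-- The space of natural transformations from `F` to `G`: the uniformly bounded families of
morphisms `F X ⟶ G X` which are natural, with the supremum norm. -/
def natTrans (F G : StarFunctor C D) :
    Submodule ℂ (lp (fun X : C => (F.obj X ⟶ G.obj X)) ⊤) where
  carrier := {τ | ∀ ⦃X Y : C⦄ (f : X ⟶ Y), F.map f ≫ τ Y = τ X ≫ G.map f}
  add_mem' {σ τ} hσ hτ X Y f := by
    change F.map f ≫ (σ Y + τ Y) = (σ X + τ X) ≫ G.map f
    simp [hσ f, hτ f]
  zero_mem' X Y f := by
    change F.map f ≫ (0 : F.obj Y ⟶ G.obj Y) = (0 : F.obj X ⟶ G.obj X) ≫ G.map f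
    simp
  smul_mem' c {τ} hτ X Y f := by
    change F.map f ≫ (c • τ Y) = (c • τ X) ≫ G.map f
    simp [hτ f]

/-- The natural transformation given by a uniformly bounded natural family. -/
def mkNat' {F G : StarFunctor C D} (τ : ∀ X, F.obj X ⟶ G.obj X) (K : ℝ) (hK : ∀ X, ‖τ X‖ ≤ K)
    (hτ : ∀ {X Y : C} (f : X ⟶ Y), F.map f ≫ τ Y = τ X ≫ G.map f) : natTrans F G :=
  ⟨⟨τ, memℓp_infty ⟨K, by rintro _ ⟨X, rfl⟩; exact hK X⟩⟩, fun _ _ f => hτ f⟩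

/-- The category of unital linear `*`-functors and their natural transformations, with
the vertical composition. -/
instance : Category (StarFunctor C D) where
  Hom F G := natTrans F G
  id F := mkNat' (fun X => 𝟙 (F.obj X)) 1 (fun X => norm_id_le _) (fun f => by simp)
  comp {F G H} σ τ := mkNat' (fun X => σ.1 X ≫ τ.1 X) (‖σ‖ * ‖τ‖)
    (fun X => (norm_comp_le _ _).trans
      (mul_le_mul (lp.norm_apply_le_norm (by simp) σ.1 X) (lp.norm_apply_le_norm (by simp) τ.1 X)
        (norm_nonneg _) (norm_nonneg _)))
    (fun f => by rw [← Category.assoc, σ.2, Category.assoc, τ.2, Category.assoc])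
  id_comp _ := Subtype.ext (lp.ext (funext fun _ => Category.id_comp _))
  comp_id _ := Subtype.ext (lp.ext (funext fun _ => Category.comp_id _))
  assoc _ _ _ := Subtype.ext (lp.ext (funext fun _ => Category.assoc _ _ _))

section
variable {F G H : StarFunctor C D}

instance : NormedAddCommGroup (F ⟶ G) := inferInstanceAs (NormedAddCommGroup (natTrans F G))
instance : NormedSpace ℂ (F ⟶ G) := inferInstanceAs (NormedSpace ℂ (natTrans F G))

/-- The component at `X` of a natural transformation. -/
def app (τ : F ⟶ G) (X : C) : F.obj X ⟶ G.obj X := Subtype.val (p := (· ∈ natTrans F G)) τ X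

/-- The natural transformation given by a uniformly bounded natural family. -/
def mkNat (τ : ∀ X, F.obj X ⟶ G.obj X) (K : ℝ) (hK : ∀ X, ‖τ X‖ ≤ K)
    (hτ : ∀ {X Y : C} (f : X ⟶ Y), F.map f ≫ τ Y = τ X ≫ G.map f) : F ⟶ G :=
  mkNat' τ K hK hτ

@[simp] lemma app_mkNat (τ : ∀ X, F.obj X ⟶ G.obj X) (K : ℝ) (hK : ∀ X, ‖τ X‖ ≤ K)
    (hτ : ∀ {X Y : C} (f : X ⟶ Y), F.map f ≫ τ Y = τ X ≫ G.map f) (X : C) :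
    app (mkNat τ K hK hτ) X = τ X := rfl

@[simp] lemma app_id (F : StarFunctor C D) (X : C) : app (𝟙 F) X = 𝟙 (F.obj X) := rfl
@[simp] lemma app_comp (σ : F ⟶ G) (τ : G ⟶ H) (X : C) :
    app (σ ≫ τ) X = app σ X ≫ app τ X := rfl

lemma nat_ext {σ τ : F ⟶ G} (h : ∀ X, app σ X = app τ X) : σ = τ :=
  Subtype.ext (lp.ext (funext h))

lemma naturality (τ : F ⟶ G) {X Y : C} (f : X ⟶ Y) :
    F.map f ≫ app τ Y = app τ X ≫ G.map f :=
  Subtype.property (p := (· ∈ natTrans F G)) τ f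

lemma norm_app_le' (τ : F ⟶ G) (X : C) : ‖app τ X‖ ≤ ‖τ‖ :=
  lp.norm_apply_le_norm (by simp) (Subtype.val (p := (· ∈ natTrans F G)) τ) X

lemma norm_nat_le' (τ : F ⟶ G) {K : ℝ} (hK : 0 ≤ K) (h : ∀ X, ‖app τ X‖ ≤ K) : ‖τ‖ ≤ K :=
  lp.norm_le_of_forall_le (f := Subtype.val (p := (· ∈ natTrans F G)) τ) hK h

lemma isClosed_natTrans (F G : StarFunctor C D) :
    IsClosed (natTrans F G : Set (lp (fun X : C => (F.obj X ⟶ G.obj X)) ⊤)) := by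
  have key : ∀ X, Continuous fun τ : lp (fun X : C => (F.obj X ⟶ G.obj X)) ⊤ => τ X :=
    fun X => (lp.evalCLM ℂ (fun X : C => (F.obj X ⟶ G.obj X)) ⊤ X).continuous
  have h : (natTrans F G : Set (lp (fun X : C => (F.obj X ⟶ G.obj X)) ⊤)) =
      ⋂ (X : C), ⋂ (Y : C), ⋂ (f : X ⟶ Y), {τ | F.map f ≫ τ Y = τ X ≫ G.map f} := by
    ext τ
    simp only [Set.mem_iInter]
    rfl
  rw [h]
  refine isClosed_iInter fun X => isClosed_iInter fun Y => isClosed_iInter fun f =>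
    isClosed_eq ?_ ?_
  · exact (continuous_comp_left (F.map f)).comp (key Y)
  · exact (continuous_comp_right (G.map f)).comp (key X)

instance : CompleteSpace (F ⟶ G) := (isClosed_natTrans F G).completeSpace_coe

/-- The adjoint of a natural transformation is taken pointwise. -/
def adjNat (τ : F ⟶ G) : G ⟶ F :=
  mkNat (fun X => adj (app τ X)) ‖τ‖ (fun X => (norm_adj _).trans_le (norm_app_le' τ X))
    (fun f => by
      have h := congrArg adj (naturality τ (adj f))
      simpa using h.symm)

end

instance instPre : PreCStarCategory (StarFunctor C D) where
  homNormed F G := inferInstance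
  homSpace F G := inferInstance
  homComplete F G := inferInstance
  add_comp _ _ _ := nat_ext fun _ => add_comp _ _ _
  comp_add _ _ _ := nat_ext fun _ => comp_add _ _ _
  smul_comp _ _ _ := nat_ext fun _ => smul_comp _ _ _
  comp_smul _ _ _ := nat_ext fun _ => comp_smul _ _ _
  norm_comp_le σ τ := norm_nat_le' _ (mul_nonneg (norm_nonneg _) (norm_nonneg _)) fun X =>
    (norm_comp_le _ _).trans
      (mul_le_mul (norm_app_le' σ X) (norm_app_le' τ X) (norm_nonneg _) (norm_nonneg _))
  adj τ := adjNat τ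
  adj_adj _ := nat_ext fun _ => adj_adj _
  adj_comp _ _ := nat_ext fun _ => adj_comp _ _
  adj_add _ _ := nat_ext fun _ => adj_add _ _
  adj_smul _ _ := nat_ext fun _ => adj_smul _ _
  norm_comp_adj {F G} τ := by
    refine le_antisymm (norm_nat_le' _ (sq_nonneg _) fun X => ?_) ?_
    · exact (norm_comp_adj (app τ X)).trans_le
        (pow_le_pow_left₀ (norm_nonneg _) (norm_app_le' τ X) 2)
    · refine (Real.le_sqrt (norm_nonneg _) (norm_nonneg _)).1 ?_
      refine norm_nat_le' τ (Real.sqrt_nonneg _) fun X => Real.le_sqrt_of_sq_le ?_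
      rw [← norm_comp_adj]
      exact norm_app_le' (τ ≫ adjNat τ) X

section
variable {F G : StarFunctor C D}
@[simp] lemma app_adj (σ : F ⟶ G) (X : C) : app (adj σ) X = adj (app σ X) := rfl
@[simp] lemma app_add (σ τ : F ⟶ G) (X : C) : app (σ + τ) X = app σ X + app τ X := rfl
@[simp] lemma app_sub (σ τ : F ⟶ G) (X : C) : app (σ - τ) X = app σ X - app τ X := rfl
@[simp] lemma app_smul (c : ℂ) (τ : F ⟶ G) (X : C) : app (c • τ) X = c • app τ X := rfl
@[simp] lemma app_zero (X : C) : app (0 : F ⟶ G) X = 0 := rfl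
lemma app_sum {ι : Type*} (s : Finset ι) (τ : ι → (F ⟶ G)) (X : C) :
    app (∑ i ∈ s, τ i) X = ∑ i ∈ s, app (τ i) X :=
  _root_.map_sum (AddMonoidHom.mk' (fun τ : F ⟶ G => app τ X) fun _ _ => rfl) τ s
lemma norm_app_le (τ : F ⟶ G) (X : C) : ‖app τ X‖ ≤ ‖τ‖ := norm_app_le' τ X
lemma norm_nat_le (τ : F ⟶ G) {K : ℝ} (hK : 0 ≤ K) (h : ∀ X, ‖app τ X‖ ≤ K) : ‖τ‖ ≤ K :=
  norm_nat_le' τ hK h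
end

/-- The `C*`-category of unital linear `*`-functors and their natural transformations. -/
instance instCStar : UnitalCStarCategory (StarFunctor C D) where
  pos {F G} τ := by
    refine exists_of_norm_sub_le (X := F) _ (by simp) ?_
    refine norm_nat_le (F := F) (G := F) _ (norm_nonneg _) fun X => ?_
    refine norm_smul_id_sub_le (app τ X) ?_
    rw [norm_comp_adj]
    exact pow_le_pow_left₀ (norm_nonneg _) (norm_app_le τ X) 2

lemma exists_splitting [IsFinitelyAdditive D] (F : StarFunctor C D) (p : F ⟶ F) (hp : p ≫ p = p)
    (hp' : adj p = p) : ∃ (G : StarFunctor C D) (i : G ⟶ F), i ≫ adj i = 𝟙 G ∧ adj i ≫ i = p := by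
  choose U i h1 h2 using fun X => IsFinitelyAdditive.exists_split (F.obj X) (app p X)
    (congrArg (app · X) hp) (congrArg (app · X) hp')
  have hi : ∀ X, i X ≫ app p X = i X := fun X => by
    rw [← h2, ← Category.assoc, h1, Category.id_comp]
  have key : ∀ {X Y : C} (f : X ⟶ Y), i X ≫ F.map f ≫ adj (i Y) ≫ i Y = i X ≫ F.map f := by
    intro X Y f
    rw [h2, naturality, ← Category.assoc, hi]
  let G : StarFunctor C D :=
    { obj := U
      map := fun {X Y} f => i X ≫ F.map f ≫ adj (i Y)
      map_id := fun X => by simp [h1]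
      map_comp := fun {X Y Z} f g => by
        have := congrArg (· ≫ F.map g ≫ adj (i Z)) (key f)
        simp only [Category.assoc] at this
        simp [this]
      map_add := fun f g => by simp
      map_smul := fun f g => by simp
      map_adj := fun f => by simp }
  refine ⟨G, mkNat (F := G) (G := F) i 1 (fun X => ?_) (fun {X Y} f => ?_), nat_ext h1, nat_ext h2⟩
  · have h : ‖i X‖ ^ 2 ≤ 1 := by rw [← norm_comp_adj, h1]; exact norm_id_le _
    nlinarith [norm_nonneg (i X)]
  · simpa [G] using key f

lemma exists_sum [IsFinitelyAdditive D] (n : ℕ) (F : Fin n → StarFunctor C D) :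
    ∃ (S : StarFunctor C D) (i : ∀ k, F k ⟶ S),
    (∀ k, i k ≫ adj (i k) = 𝟙 (F k)) ∧ (∀ k l, k ≠ l → i k ≫ adj (i l) = 0) ∧
      ∑ k, adj (i k) ≫ i k = 𝟙 S := by
  choose S i h1 h2 h3 using fun X => IsFinitelyAdditive.exists_directSum n (fun k => (F k).obj X)
  have key : ∀ {X Y : C} (f : X ⟶ Y) (k : Fin n),
      i X k ≫ ∑ l, adj (i X l) ≫ (F l).map f ≫ i Y l = (F k).map f ≫ i Y k := by
    intro X Y f k
    rw [comp_sum, Finset.sum_eq_single k]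
    · rw [← Category.assoc, h1, Category.id_comp]
    · intro l _ hl
      rw [← Category.assoc, h2 X k l hl.symm, zero_comp]
    · simp
  let G : StarFunctor C D :=
    { obj := S
      map := fun {X Y} f => ∑ k, adj (i X k) ≫ (F k).map f ≫ i Y k
      map_id := fun X => by simp [h3]
      map_comp := fun {X Y Z} f g => by
        rw [sum_comp]
        refine Finset.sum_congr rfl fun k _ => ?_
        rw [Category.assoc, Category.assoc, key g k, Functor.map_comp, Category.assoc]
      map_add := fun f g => by simp [Finset.sum_add_distrib]
      map_smul := fun f g => by simp [Finset.smul_sum]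
      map_adj := fun f => by simp [adj_sum] }
  refine ⟨G, fun k => mkNat (F := F k) (G := G) (fun X => i X k) 1 (fun X => ?_)
    (fun {X Y} f => (key f k).symm), fun k => nat_ext fun X => h1 X k,
    fun k l hkl => nat_ext fun X => h2 X k l hkl, nat_ext fun X => ?_⟩
  · have h : ‖i X k‖ ^ 2 ≤ 1 := by rw [← norm_comp_adj, h1]; exact norm_id_le _
    nlinarith [norm_nonneg (i X k)]
  · rw [app_sum]
    exact h3 X

instance instAdditive [IsFinitelyAdditive D] : IsFinitelyAdditive (StarFunctor C D) where
  exists_split := exists_splitting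
  exists_directSum := exists_sum

/-- Whiskering on both sides, on objects and morphisms: `K ↦ F ⋙ K ⋙ H`. -/
def whisker {C' : Type u₃} [UnitalCStarCategory.{u₃, v₃} C'] {D' : Type u₄}
    [UnitalCStarCategory.{u₄, v₄} D'] (F : StarFunctor C' C) (H : StarFunctor D D') :
    StarFunctor (StarFunctor C D) (StarFunctor C' D') where
  obj K := (F.comp K).comp H
  map {K L} τ := mkNat (F := (F.comp K).comp H) (G := (F.comp L).comp H)
    (fun X => H.map (app τ (F.obj X))) ‖τ‖
    (fun X => (norm_map_le H _).trans (norm_app_le τ _))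
    (fun f => by simp [comp, ← Functor.map_comp, naturality])
  map_id K := nat_ext fun X => by simp [comp]
  map_comp σ τ := nat_ext fun X => H.map_comp _ _
  map_add σ τ := nat_ext fun X => H.map_add _ _
  map_smul c τ := nat_ext fun X => H.map_smul _ _
  map_adj τ := nat_ext fun X => H.map_adj _

section
variable {C' : Type u₃} [UnitalCStarCategory.{u₃, v₃} C'] {D' : Type u₄}
    [UnitalCStarCategory.{u₄, v₄} D']

@[simp] lemma app_whisker_map (F : StarFunctor C' C) (H : StarFunctor D D')
    {K L : StarFunctor C D} (τ : K ⟶ L) (X : C') :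
    app ((whisker F H).map τ) X = H.map (app τ (F.obj X)) := rfl

/-- Horizontal composition on both sides: the component at `K` of the transformation induced by
`α : F ⟶ F'` and `γ : H ⟶ H'` is `γ * K * α`. -/
def whisker₂ {F F' : StarFunctor C' C} {H H' : StarFunctor D D'} (α : F ⟶ F') (γ : H ⟶ H') :
    whisker (C := C) (D := D) F H ⟶ whisker F' H' :=
  mkNat (fun K => mkNat (F := (whisker F H).obj K) (G := (whisker F' H').obj K)
      (fun X => H.map (K.map (app α X)) ≫ app γ (K.obj (F'.obj X))) (‖α‖ * ‖γ‖)
      (fun X => (norm_comp_le _ _).trans (mul_le_mul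
        ((norm_map_le H _).trans ((norm_map_le K _).trans (norm_app_le α X)))
        (norm_app_le γ _) (norm_nonneg _) (norm_nonneg _)))
      (fun {X Y} f => by
        change H.map (K.map (F.map f)) ≫ H.map (K.map (app α Y)) ≫ app γ (K.obj (F'.obj Y)) =
          (H.map (K.map (app α X)) ≫ app γ (K.obj (F'.obj X))) ≫ H'.map (K.map (F'.map f))
        rw [Category.assoc, ← naturality γ, ← Category.assoc, ← Category.assoc,
          ← Functor.map_comp, ← Functor.map_comp, ← Functor.map_comp, ← Functor.map_comp,
          naturality α]))
    (‖α‖ * ‖γ‖)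
    (fun K => norm_nat_le _ (mul_nonneg (norm_nonneg _) (norm_nonneg _)) fun X =>
      (norm_comp_le _ _).trans (mul_le_mul
        ((norm_map_le H _).trans ((norm_map_le K _).trans (norm_app_le α X)))
        (norm_app_le γ _) (norm_nonneg _) (norm_nonneg _)))
    (fun {K L} τ => nat_ext fun X => by
      change H.map (app τ (F.obj X)) ≫ H.map (L.map (app α X)) ≫ app γ (L.obj (F'.obj X)) =
        (H.map (K.map (app α X)) ≫ app γ (K.obj (F'.obj X))) ≫ H'.map (app τ (F'.obj X))
      rw [Category.assoc, ← naturality γ, ← Category.assoc, ← Category.assoc,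
          ← Functor.map_comp, ← Functor.map_comp, naturality τ])

@[simp] lemma app_app_whisker₂ {F F' : StarFunctor C' C} {H H' : StarFunctor D D'}
    (α : F ⟶ F') (γ : H ⟶ H') (K : StarFunctor C D) (X : C') :
    app (app (whisker₂ α γ) K) X = H.map (K.map (app α X)) ≫ app γ (K.obj (F'.obj X)) := rfl

end

/-- Whiskering of a natural transformation by a functor on the left. -/
def whiskerL (F : StarFunctor C D) {G H : StarFunctor D E} (τ : G ⟶ H) : F.comp G ⟶ F.comp H :=
  mkNat (F := F.comp G) (G := F.comp H) (fun X => app τ (F.obj X)) ‖τ‖ (fun _ => norm_app_le τ _)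
    (fun f => naturality τ (F.map f))

/-- Whiskering of a natural transformation by a functor on the right. -/
def whiskerR {F G : StarFunctor C D} (τ : F ⟶ G) (H : StarFunctor D E) : F.comp H ⟶ G.comp H :=
  mkNat (F := F.comp H) (G := G.comp H) (fun X => H.map (app τ X)) ‖τ‖
    (fun _ => (norm_map_le H _).trans (norm_app_le τ _))
    (fun f => by simp [comp, ← Functor.map_comp, naturality])

/-- An isomorphism of functors from mutually inverse bounded natural families. -/
@[simps]
def mkIso {F G : StarFunctor C D} (σ : F ⟶ G) (τ : G ⟶ F)
    (h₁ : ∀ X, app σ X ≫ app τ X = 𝟙 _) (h₂ : ∀ X, app τ X ≫ app σ X = 𝟙 _) : F ≅ G where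
  hom := σ
  inv := τ
  hom_inv_id := nat_ext h₁
  inv_hom_id := nat_ext h₂

end StarFunctor

/-- Finitely additive `C*`-categories. -/
structure CStarLin : Type (u + 1) where
  /-- The set of objects. -/
  carrier : Type u
  [cstar : UnitalCStarCategory.{u, u} carrier]
  [additive : IsFinitelyAdditive carrier]

attribute [instance] CStarLin.cstar CStarLin.additive

namespace CStarLin

open StarFunctor

lemma id_comp_id {C : Type u} [Category.{v} C] {X Y : C} (f : X ⟶ Y) : 𝟙 X ≫ f ≫ 𝟙 Y = f := by
  simp

/-- The `2`-category of finitely additive `C*`-categories, unital linear `*`-functors and natural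
transformations. -/
instance : Bicategory CStarLin.{u} where
  Hom C D := StarFunctor C.carrier D.carrier
  id C := StarFunctor.id C.carrier
  comp F G := F.comp G
  homCategory C D := inferInstance
  whiskerLeft F _ _ τ := whiskerL F τ
  whiskerRight τ H := whiskerR τ H
  associator F G H := Iso.refl ((F.comp G).comp H)
  leftUnitor F := Iso.refl F
  rightUnitor F := Iso.refl F
  whiskerLeft_id F G := nat_ext fun X => rfl
  whiskerLeft_comp F _ _ _ σ τ := nat_ext fun X => rfl
  id_whiskerLeft τ := nat_ext fun X => (id_comp_id _).symm
  comp_whiskerLeft F G _ _ τ := nat_ext fun X => (id_comp_id _).symm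
  id_whiskerRight F G := nat_ext fun X => G.map_id _
  comp_whiskerRight σ τ F := nat_ext fun X => F.map_comp _ _
  whiskerRight_id τ := nat_ext fun X => (id_comp_id _).symm
  whiskerRight_comp τ F G := nat_ext fun X => (id_comp_id _).symm
  whisker_assoc F _ _ τ G := nat_ext fun X => (id_comp_id _).symm
  whisker_exchange {C D E F G H K} σ τ := nat_ext fun X => (naturality τ (app σ X)).symm
  pentagon {A B C D E} F G H K := nat_ext fun X => by
    change K.map (𝟙 _) ≫ 𝟙 _ ≫ 𝟙 _ = 𝟙 _ ≫ 𝟙 _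
    rw [CategoryTheory.Functor.map_id]
    simp
  triangle {A B C} F G := nat_ext fun X => by
    change 𝟙 _ ≫ 𝟙 _ = G.map (𝟙 _)
    rw [CategoryTheory.Functor.map_id]
    simp

/-- The internal hom. -/
def ihom (C D : CStarLin.{u}) : CStarLin.{u} := ⟨StarFunctor C.carrier D.carrier⟩

end CStarLin

section Max

open TensorProduct UniformSpace

/-- The objects of the maximal tensor product of two `C*`-categories: pairs of objects. -/
@[ext] structure MaxTensor (U V : Type u) where
  /-- The first component. -/
  fst : U
  /-- The second component. -/
  snd : V

variable {U V : Type u} [UnitalCStarCategory.{u, u} U] [UnitalCStarCategory.{u, u} V]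

/-- The morphism spaces of the algebraic tensor product. -/
def AlgTensor (X Y : MaxTensor U V) : Type u := (X.fst ⟶ Y.fst) ⊗[ℂ] (X.snd ⟶ Y.snd)

namespace AlgTensor

variable {X Y Z : MaxTensor U V}

instance : AddCommGroup (AlgTensor X Y) :=
  inferInstanceAs (AddCommGroup ((X.fst ⟶ Y.fst) ⊗[ℂ] (X.snd ⟶ Y.snd)))
instance : Module ℂ (AlgTensor X Y) :=
  inferInstanceAs (Module ℂ ((X.fst ⟶ Y.fst) ⊗[ℂ] (X.snd ⟶ Y.snd)))

/-- Elementary tensors. -/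
def tmul (f : X.fst ⟶ Y.fst) (g : X.snd ⟶ Y.snd) : AlgTensor X Y := f ⊗ₜ[ℂ] g

/-- The elementary tensors as a bilinear map. -/
def tmulL (X Y : MaxTensor U V) : (X.fst ⟶ Y.fst) →ₗ[ℂ] (X.snd ⟶ Y.snd) →ₗ[ℂ] AlgTensor X Y :=
  TensorProduct.mk ℂ _ _

/-- Identity morphisms in the algebraic tensor product. -/
def id (X : MaxTensor U V) : AlgTensor X X := tmul (𝟙 X.fst) (𝟙 X.snd)

/-- Composition in the algebraic tensor product, `(f ⊗ g, f' ⊗ g') ↦ (f ≫ f') ⊗ (g ≫ g')`. -/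
def comp (X Y Z : MaxTensor U V) : AlgTensor X Y →ₗ[ℂ] AlgTensor Y Z →ₗ[ℂ] AlgTensor X Z :=
  TensorProduct.map₂ (compL X.fst Y.fst Z.fst) (compL X.snd Y.snd Z.snd)

/-- The adjoint as an antilinear map. -/
def adjL {C : Type u} [PreCStarCategory.{u, u} C] (X Y : C) : (X ⟶ Y) →ₛₗ[starRingEnd ℂ] (Y ⟶ X) where
  toFun := PreCStarCategory.adj
  map_add' := adj_add
  map_smul' := adj_smul

/-- The involution of the algebraic tensor product, `f ⊗ g ↦ f* ⊗ g*`. -/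
def adj (X Y : MaxTensor U V) : AlgTensor X Y →ₛₗ[starRingEnd ℂ] AlgTensor Y X :=
  TensorProduct.map (adjL X.fst Y.fst) (adjL X.snd Y.snd)

lemma comp_tmul (f : X.fst ⟶ Y.fst) (g : X.snd ⟶ Y.snd) (f' : Y.fst ⟶ Z.fst) (g' : Y.snd ⟶ Z.snd) :
    comp X Y Z (tmul f g) (tmul f' g') = tmul (f ≫ f') (g ≫ g') := rfl

lemma adj_tmul (f : X.fst ⟶ Y.fst) (g : X.snd ⟶ Y.snd) :
    adj X Y (tmul f g) = tmul (PreCStarCategory.adj f) (PreCStarCategory.adj g) := rfl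

lemma induction {p : AlgTensor X Y → Prop} (h0 : p 0) (ht : ∀ f g, p (tmul f g))
    (ha : ∀ s t, p s → p t → p (s + t)) (t : AlgTensor X Y) : p t :=
  TensorProduct.induction_on t h0 ht ha

lemma id_comp (t : AlgTensor X Y) : comp X X Y (id X) t = t := by
  induction t using induction with
  | h0 => simp
  | ht f g => simp [id, comp_tmul]
  | ha s t hs ht => rw [map_add, hs, ht]

lemma comp_id (t : AlgTensor X Y) : comp X Y Y t (id Y) = t := by
  induction t using induction with
  | h0 => simp
  | ht f g => simp [id, comp_tmul]
  | ha s t hs ht => rw [LinearMap.map_add₂, hs, ht]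

lemma comp_assoc {W : MaxTensor U V} (r : AlgTensor W X) (s : AlgTensor X Y) (t : AlgTensor Y Z) :
    comp W Y Z (comp W X Y r s) t = comp W X Z r (comp X Y Z s t) := by
  induction t using induction with
  | h0 => simp
  | ha t t' h h' => simp only [map_add, h, h']
  | ht f g =>
    induction s using induction with
    | h0 => simp
    | ha t t' h h' => simp only [map_add, LinearMap.add_apply, h, h']
    | ht f g =>
      induction r using induction with
      | h0 => simp
      | ha t t' h h' => simp only [map_add, LinearMap.add_apply, h, h']
      | ht f g => simp [comp_tmul]

lemma adj_adj (t : AlgTensor X Y) : adj Y X (adj X Y t) = t := by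
  induction t using induction with
  | h0 => simp
  | ht f g => simp [adj_tmul]
  | ha s t hs ht => rw [map_add, map_add, hs, ht]

lemma adj_comp (s : AlgTensor X Y) (t : AlgTensor Y Z) :
    adj X Z (comp X Y Z s t) = comp Z Y X (adj Y Z t) (adj X Y s) := by
  induction t using induction with
  | h0 => simp
  | ha t t' h h' => simp only [map_add, LinearMap.add_apply, h, h']
  | ht f g =>
    induction s using induction with
    | h0 => simp
    | ha t t' h h' => simp only [map_add, LinearMap.add_apply, h, h']
    | ht f g => simp [comp_tmul, adj_tmul]

end AlgTensor

/-- A unital linear `*`-functor from the algebraic tensor product of `U` and `V` to the category of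
Hilbert spaces and bounded linear operators. -/
structure TensorRep (U V : Type u) [UnitalCStarCategory.{u, u} U]
    [UnitalCStarCategory.{u, u} V] where
  /-- The Hilbert space attached to an object. -/
  space : MaxTensor U V → Type u
  [normed : ∀ X, NormedAddCommGroup (space X)]
  [inner : ∀ X, InnerProductSpace ℂ (space X)]
  [complete : ∀ X, CompleteSpace (space X)]
  /-- The action on morphisms. -/
  map : ∀ {X Y : MaxTensor U V}, AlgTensor X Y →ₗ[ℂ] (space X →L[ℂ] space Y)
  map_id : ∀ X : MaxTensor U V, map (AlgTensor.id X) = ContinuousLinearMap.id ℂ (space X)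
  map_comp : ∀ {X Y Z : MaxTensor U V} (s : AlgTensor X Y) (t : AlgTensor Y Z),
    map (AlgTensor.comp X Y Z s t) = (map t).comp (map s)
  map_adj : ∀ {X Y : MaxTensor U V} (s : AlgTensor X Y),
    map (AlgTensor.adj X Y s) = ContinuousLinearMap.adjoint (map s)

attribute [instance] TensorRep.normed TensorRep.inner TensorRep.complete

namespace AlgTensor

variable {X Y Z : MaxTensor U V}

lemma norm_rep_le {C : Type u} [UnitalCStarCategory.{u, u} C] (H : C → Type u)
    [∀ X, NormedAddCommGroup (H X)] [∀ X, InnerProductSpace ℂ (H X)] [∀ X, CompleteSpace (H X)]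
    (ρ : ∀ {X Y : C}, (X ⟶ Y) →ₗ[ℂ] (H X →L[ℂ] H Y))
    (hcomp : ∀ {X Y Z : C} (f : X ⟶ Y) (g : Y ⟶ Z), ρ (f ≫ g) = (ρ g).comp (ρ f))
    (hadj : ∀ {X Y : C} (f : X ⟶ Y),
      ρ (PreCStarCategory.adj f) = ContinuousLinearMap.adjoint (ρ f))
    {X Y : C} (f : X ⟶ Y) : ‖ρ f‖ ≤ ‖f‖ := by
  let := endCStarAlgebra X
  let φ : End X →⋆ₙₐ[ℂ] (H X →L[ℂ] H X) :=
    { toFun := fun a => ρ (show X ⟶ X from a)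
      map_smul' := fun c a => (ρ (X := X) (Y := X)).map_smul c a
      map_zero' := (ρ (X := X) (Y := X)).map_zero
      map_add' := fun a b => (ρ (X := X) (Y := X)).map_add a b
      map_mul' := fun a b => hcomp (X := X) b a
      map_star' := fun a => hadj (X := X) (Y := X) a }
  have h : ‖ρ (f ≫ PreCStarCategory.adj f)‖ ≤ ‖f ≫ PreCStarCategory.adj f‖ :=
    NonUnitalStarAlgHom.norm_apply_le φ (show End X from f ≫ PreCStarCategory.adj f)
  rw [hcomp, hadj, norm_comp_adj, ContinuousLinearMap.norm_adjoint_comp_self, ← pow_two] at h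
  exact (sq_le_sq₀ (norm_nonneg _) (norm_nonneg _)).1 h

lemma norm_map_tmul_le (π : TensorRep U V) (f : X.fst ⟶ Y.fst) (g : X.snd ⟶ Y.snd) :
    ‖π.map (tmul f g)‖ ≤ ‖f‖ * ‖g‖ := by
  have h1 : ‖π.map (X := X) (Y := ⟨Y.fst, X.snd⟩) (tmul f (𝟙 X.snd))‖ ≤ ‖f‖ :=
    norm_rep_le (fun A : U => π.space ⟨A, X.snd⟩)
      (fun {A B} => π.map.comp ((tmulL ⟨A, X.snd⟩ ⟨B, X.snd⟩).flip (𝟙 X.snd)))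
      (fun {A B C} a b => by
        have := π.map_comp (X := ⟨A, X.snd⟩) (Y := ⟨B, X.snd⟩) (Z := ⟨C, X.snd⟩)
          (tmul a (𝟙 X.snd)) (tmul b (𝟙 X.snd))
        rw [comp_tmul, Category.comp_id] at this
        exact this)
      (fun {A B} a => by
        have := π.map_adj (X := ⟨A, X.snd⟩) (Y := ⟨B, X.snd⟩) (tmul a (𝟙 X.snd))
        rw [adj_tmul, adj_id] at this
        exact this) f
  have h2 : ‖π.map (X := ⟨Y.fst, X.snd⟩) (Y := Y) (tmul (𝟙 Y.fst) g)‖ ≤ ‖g‖ :=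
    norm_rep_le (fun A : V => π.space ⟨Y.fst, A⟩)
      (fun {A B} => π.map.comp (tmulL ⟨Y.fst, A⟩ ⟨Y.fst, B⟩ (𝟙 Y.fst)))
      (fun {A B C} a b => by
        have := π.map_comp (X := ⟨Y.fst, A⟩) (Y := ⟨Y.fst, B⟩) (Z := ⟨Y.fst, C⟩)
          (tmul (𝟙 Y.fst) a) (tmul (𝟙 Y.fst) b)
        rw [comp_tmul, Category.comp_id] at this
        exact this)
      (fun {A B} a => by
        have := π.map_adj (X := ⟨Y.fst, A⟩) (Y := ⟨Y.fst, B⟩) (tmul (𝟙 Y.fst) a)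
        rw [adj_tmul, adj_id] at this
        exact this) g
  have h3 := π.map_comp (X := X) (Y := ⟨Y.fst, X.snd⟩) (Z := Y) (tmul f (𝟙 X.snd))
    (tmul (𝟙 Y.fst) g)
  rw [comp_tmul, Category.comp_id, Category.id_comp] at h3
  rw [h3, mul_comm]
  exact (ContinuousLinearMap.opNorm_comp_le _ _).trans
    (mul_le_mul h2 h1 (norm_nonneg _) (norm_nonneg _))

lemma exists_bound (t : AlgTensor X Y) : ∃ K, ∀ π : TensorRep U V, ‖π.map t‖ ≤ K := by
  induction t using induction with
  | h0 => exact ⟨0, fun π => by simp⟩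
  | ht f g => exact ⟨_, fun π => norm_map_tmul_le π f g⟩
  | ha s t hs ht =>
    obtain ⟨K, hK⟩ := hs
    obtain ⟨L, hL⟩ := ht
    exact ⟨K + L, fun π => by
      rw [map_add]; exact (norm_add_le _ _).trans (add_le_add (hK π) (hL π))⟩

/-- The maximal norm `‖t‖ = sup ‖π(t)‖`, over all representations `π` of the algebraic tensor
product on Hilbert spaces. -/
def maxNorm (t : AlgTensor X Y) : ℝ := ⨆ π : TensorRep U V, ‖π.map t‖

lemma le_maxNorm (t : AlgTensor X Y) (π : TensorRep U V) : ‖π.map t‖ ≤ maxNorm t := by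
  obtain ⟨K, hK⟩ := exists_bound t
  exact le_ciSup (f := fun π : TensorRep U V => ‖π.map t‖) ⟨K, by rintro _ ⟨π, rfl⟩; exact hK π⟩ π

lemma maxNorm_le (t : AlgTensor X Y) {K : ℝ} (hK : 0 ≤ K) (h : ∀ π : TensorRep U V, ‖π.map t‖ ≤ K) :
    maxNorm t ≤ K := Real.iSup_le h hK

lemma maxNorm_nonneg (t : AlgTensor X Y) : 0 ≤ maxNorm t := Real.iSup_nonneg fun _ => norm_nonneg _

instance : SeminormedAddCommGroup (AlgTensor X Y) :=
  AddGroupSeminorm.toSeminormedAddCommGroup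
    { toFun := maxNorm
      map_zero' := le_antisymm (maxNorm_le _ le_rfl fun π => by simp) (maxNorm_nonneg _)
      add_le' := fun s t => maxNorm_le _ (add_nonneg (maxNorm_nonneg _) (maxNorm_nonneg _))
        fun π => by
          rw [map_add]
          exact (norm_add_le _ _).trans (add_le_add (le_maxNorm s π) (le_maxNorm t π))
      neg' := fun s => by simp [maxNorm] }

lemma norm_def (t : AlgTensor X Y) : ‖t‖ = maxNorm t := rfl

instance : NormedSpace ℂ (AlgTensor X Y) where
  norm_smul_le c t := maxNorm_le _ (mul_nonneg (norm_nonneg _) (maxNorm_nonneg _)) fun π => by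
    rw [map_smul, norm_smul]
    exact mul_le_mul_of_nonneg_left (le_maxNorm t π) (norm_nonneg _)

lemma norm_tmul_le (f : X.fst ⟶ Y.fst) (g : X.snd ⟶ Y.snd) : ‖tmul f g‖ ≤ ‖f‖ * ‖g‖ :=
  maxNorm_le _ (mul_nonneg (norm_nonneg _) (norm_nonneg _)) fun π => norm_map_tmul_le π f g

lemma norm_comp_le (s : AlgTensor X Y) (t : AlgTensor Y Z) : ‖comp X Y Z s t‖ ≤ ‖s‖ * ‖t‖ :=
  maxNorm_le _ (mul_nonneg (maxNorm_nonneg _) (maxNorm_nonneg _)) fun π => by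
    rw [π.map_comp, mul_comm]
    exact (ContinuousLinearMap.opNorm_comp_le _ _).trans
      (mul_le_mul (le_maxNorm t π) (le_maxNorm s π) (norm_nonneg _) (maxNorm_nonneg _))

lemma norm_adj_le (s : AlgTensor X Y) : ‖adj X Y s‖ ≤ 1 * ‖s‖ := by
  rw [one_mul]
  refine maxNorm_le _ (maxNorm_nonneg _) fun π => ?_
  rw [π.map_adj, LinearIsometryEquiv.norm_map]
  exact le_maxNorm s π

lemma norm_comp_adj (s : AlgTensor X Y) : ‖comp X Y X s (adj X Y s)‖ = ‖s‖ ^ 2 := by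
  have h : ∀ π : TensorRep U V, ‖π.map (comp X Y X s (adj X Y s))‖ = ‖π.map s‖ ^ 2 := fun π => by
    rw [π.map_comp, π.map_adj, ContinuousLinearMap.norm_adjoint_comp_self, pow_two]
  refine le_antisymm (maxNorm_le _ (sq_nonneg _) fun π => ?_) ?_
  · rw [h]
    exact pow_le_pow_left₀ (norm_nonneg _) (le_maxNorm s π) 2
  · refine (Real.le_sqrt (norm_nonneg _) (norm_nonneg _)).1 ?_
    refine maxNorm_le _ (Real.sqrt_nonneg _) fun π => Real.le_sqrt_of_sq_le ?_
    rw [← h]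
    exact le_maxNorm _ π

lemma norm_smul_id_sub_le (s : AlgTensor X Y) :
    ‖((‖s‖ ^ 2 : ℝ) : ℂ) • id X - comp X Y X s (adj X Y s)‖ ≤ ‖s‖ ^ 2 := by
  refine maxNorm_le _ (sq_nonneg _) fun π => ?_
  rw [map_sub, map_smul, π.map_id, π.map_comp, π.map_adj]
  have hle : ‖π.map s‖ ^ 2 ≤ ‖s‖ ^ 2 := pow_le_pow_left₀ (norm_nonneg _) (le_maxNorm s π) 2
  have hpos : (0 : π.space X →L[ℂ] π.space X) ≤
      (ContinuousLinearMap.adjoint (π.map s)).comp (π.map s) := by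
    rw [ContinuousLinearMap.nonneg_iff_isPositive]
    exact ContinuousLinearMap.isPositive_adjoint_comp_self _
  have hn : ‖(ContinuousLinearMap.adjoint (π.map s)).comp (π.map s)‖ ≤ ‖s‖ ^ 2 := by
    rw [ContinuousLinearMap.norm_adjoint_comp_self, ← pow_two]; exact hle
  have h2 := (SpectrumRestricts.nnreal_iff_nnnorm (t := ⟨‖s‖ ^ 2, sq_nonneg _⟩)
    (IsSelfAdjoint.of_nonneg hpos) hn).1 (SpectrumRestricts.nnreal_of_nonneg hpos)
  have h4 : ‖algebraMap ℝ (π.space X →L[ℂ] π.space X) (‖s‖ ^ 2) -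
    (ContinuousLinearMap.adjoint (π.map s)).comp (π.map s)‖ ≤ ‖s‖ ^ 2 := h2
  rw [Algebra.algebraMap_eq_smul_one] at h4
  exact h4

/-- Composition as a bounded bilinear map. -/
def compCLM (X Y Z : MaxTensor U V) : AlgTensor X Y →L[ℂ] AlgTensor Y Z →L[ℂ] AlgTensor X Z :=
  (comp X Y Z).mkContinuous₂ 1 fun s t => by rw [one_mul]; exact norm_comp_le s t

/-- The involution as a bounded antilinear map. -/
def adjCLM (X Y : MaxTensor U V) : AlgTensor X Y →SL[starRingEnd ℂ] AlgTensor Y X :=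
  (adj X Y).mkContinuous 1 norm_adj_le

end AlgTensor

/-- The morphism spaces of the maximal tensor product: the completion of the algebraic tensor
product with respect to the maximal norm. -/
def MaxHom (X Y : MaxTensor U V) : Type u := Completion (AlgTensor X Y)

namespace MaxHom

variable {X Y Z : MaxTensor U V}

instance : NormedAddCommGroup (MaxHom X Y) :=
  inferInstanceAs (NormedAddCommGroup (Completion (AlgTensor X Y)))
instance : NormedSpace ℂ (MaxHom X Y) :=
  inferInstanceAs (NormedSpace ℂ (Completion (AlgTensor X Y)))
instance : CompleteSpace (MaxHom X Y) :=
  inferInstanceAs (CompleteSpace (Completion (AlgTensor X Y)))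

/-- The canonical map from the algebraic tensor product. -/
def of (X Y : MaxTensor U V) : AlgTensor X Y →L[ℂ] MaxHom X Y := Completion.toComplL

lemma norm_of (t : AlgTensor X Y) : ‖of X Y t‖ = ‖t‖ := Completion.norm_coe t

lemma denseRange_of (X Y : MaxTensor U V) : DenseRange (of X Y) := Completion.denseRange_coe

lemma isUniformInducing_of (X Y : MaxTensor U V) : IsUniformInducing (of X Y) :=
  Completion.isUniformInducing_coe _

lemma induction {p : MaxHom X Y → Prop} (hp : IsClosed {x | p x}) (h : ∀ t, p (of X Y t))
    (x : MaxHom X Y) : p x := Completion.induction_on x hp h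

/-- The extension of a bounded linear map on the algebraic tensor product. -/
def lift {E : Type*} [NormedAddCommGroup E] [NormedSpace ℂ E] [CompleteSpace E]
    (f : AlgTensor X Y →L[ℂ] E) : MaxHom X Y →L[ℂ] E := f.extend (of X Y)

@[simp] lemma lift_of {E : Type*} [NormedAddCommGroup E] [NormedSpace ℂ E] [CompleteSpace E]
    (f : AlgTensor X Y →L[ℂ] E) (t : AlgTensor X Y) : lift f (of X Y t) = f t :=
  ContinuousLinearMap.extend_eq f (denseRange_of X Y) (isUniformInducing_of X Y) t

lemma norm_lift_le {E : Type*} [NormedAddCommGroup E] [NormedSpace ℂ E] [CompleteSpace E]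
    (f : AlgTensor X Y →L[ℂ] E) (K : ℝ) (h : ∀ t, ‖f t‖ ≤ K * ‖t‖) (x : MaxHom X Y) :
    ‖lift f x‖ ≤ K * ‖x‖ := by
  induction x using induction with
  | hp => exact isClosed_le (lift f).continuous.norm (continuous_const.mul continuous_norm)
  | h t => rw [lift_of, norm_of]; exact h t

lemma clm_ext {E : Type*} [NormedAddCommGroup E] [NormedSpace ℂ E]
    {f g : MaxHom X Y →L[ℂ] E} (h : ∀ t, f (of X Y t) = g (of X Y t)) : f = g := by
  ext x
  induction x using induction with
  | hp => exact isClosed_eq f.continuous g.continuous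
  | h t => exact h t

/-- Composition in the maximal tensor product with a fixed algebraic tensor. -/
def compRight (X Y Z : MaxTensor U V) : AlgTensor X Y →L[ℂ] MaxHom Y Z →L[ℂ] MaxHom X Z :=
  LinearMap.mkContinuous
    { toFun := fun s => lift ((of X Z).comp (AlgTensor.compCLM X Y Z s))
      map_add' := fun s t => clm_ext fun r => by simp
      map_smul' := fun c t =>
        clm_ext fun r => by simp } 1
    (fun s => by
      rw [one_mul]
      refine ContinuousLinearMap.opNorm_le_bound _ (norm_nonneg _) fun x => ?_
      exact norm_lift_le ((of X Z).comp (AlgTensor.compCLM X Y Z s)) ‖s‖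
        (fun t => (norm_of (AlgTensor.compCLM X Y Z s t)).trans_le
          (AlgTensor.norm_comp_le s t)) x)

/-- Composition in the maximal tensor product, extending the algebraic composition. -/
def comp (X Y Z : MaxTensor U V) : MaxHom X Y →L[ℂ] MaxHom Y Z →L[ℂ] MaxHom X Z :=
  lift (compRight X Y Z)

/-- The involution of the maximal tensor product, extending the algebraic involution. -/
def adj (X Y : MaxTensor U V) : MaxHom X Y →SL[starRingEnd ℂ] MaxHom Y X :=
  (AlgTensor.adjCLM X Y).completion

@[simp] lemma comp_of (s : AlgTensor X Y) (t : AlgTensor Y Z) :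
    comp X Y Z (of X Y s) (of Y Z t) = of X Z (AlgTensor.comp X Y Z s t) := by
  rw [comp, lift_of]
  exact lift_of ((of X Z).comp (AlgTensor.compCLM X Y Z s)) t

@[simp] lemma adj_of (s : AlgTensor X Y) : adj X Y (of X Y s) = of Y X (AlgTensor.adj X Y s) :=
  ContinuousLinearMap.completion_apply_coe _ _

/-- The identity morphisms. -/
def id (X : MaxTensor U V) : MaxHom X X := of X X (AlgTensor.id X)

lemma id_comp (x : MaxHom X Y) : comp X X Y (id X) x = x := by
  induction x using induction with
  | hp => exact isClosed_eq (by fun_prop) (by fun_prop)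
  | h t => simp [id, AlgTensor.id_comp]

lemma comp_id (x : MaxHom X Y) : comp X Y Y x (id Y) = x := by
  induction x using induction with
  | hp => exact isClosed_eq (by fun_prop) (by fun_prop)
  | h t => simp [id, AlgTensor.comp_id]

lemma comp_assoc {W : MaxTensor U V} (x : MaxHom W X) (y : MaxHom X Y) (z : MaxHom Y Z) :
    comp W Y Z (comp W X Y x y) z = comp W X Z x (comp X Y Z y z) := by
  induction x using induction with
  | hp => exact isClosed_eq (by fun_prop) (by fun_prop)
  | h r =>
    induction y using induction with
    | hp => exact isClosed_eq (by fun_prop) (by fun_prop)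
    | h s =>
      induction z using induction with
      | hp => exact isClosed_eq (by fun_prop) (by fun_prop)
      | h t => simp [AlgTensor.comp_assoc]

lemma adj_adj (x : MaxHom X Y) : adj Y X (adj X Y x) = x := by
  induction x using induction with
  | hp => exact isClosed_eq (by fun_prop) (by fun_prop)
  | h t => simp [AlgTensor.adj_adj]

lemma adj_comp (x : MaxHom X Y) (y : MaxHom Y Z) :
    adj X Z (comp X Y Z x y) = comp Z Y X (adj Y Z y) (adj X Y x) := by
  induction x using induction with
  | hp => exact isClosed_eq (by fun_prop) (by fun_prop)
  | h s =>
    induction y using induction with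
    | hp => exact isClosed_eq (by fun_prop) (by fun_prop)
    | h t => simp [AlgTensor.adj_comp]

lemma norm_comp_le (x : MaxHom X Y) (y : MaxHom Y Z) : ‖comp X Y Z x y‖ ≤ ‖x‖ * ‖y‖ := by
  induction x using induction with
  | hp => exact isClosed_le (by fun_prop) (by fun_prop)
  | h s =>
    induction y using induction with
    | hp => exact isClosed_le (by fun_prop) (by fun_prop)
    | h t => simpa [norm_of] using AlgTensor.norm_comp_le s t

lemma norm_comp_adj (x : MaxHom X Y) : ‖comp X Y X x (adj X Y x)‖ = ‖x‖ ^ 2 := by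
  induction x using induction with
  | hp => exact isClosed_eq (by fun_prop) (by fun_prop)
  | h s => simpa [norm_of] using AlgTensor.norm_comp_adj s

lemma norm_smul_id_sub_le (x : MaxHom X Y) :
    ‖((‖x‖ ^ 2 : ℝ) : ℂ) • id X - comp X Y X x (adj X Y x)‖ ≤ ‖x‖ ^ 2 := by
  induction x using induction with
  | hp => exact isClosed_le (by fun_prop) (by fun_prop)
  | h s =>
    have := AlgTensor.norm_smul_id_sub_le s
    rw [← norm_of, map_sub, map_smul] at this
    rw [adj_of, comp_of, norm_of]
    exact this

end MaxHom

/-- The maximal tensor product of two unital `C*`-categories. -/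
instance : PreCStarCategory (MaxTensor U V) where
  Hom X Y := MaxHom X Y
  id X := MaxHom.id X
  comp {X Y Z} x y := MaxHom.comp X Y Z x y
  id_comp x := MaxHom.id_comp x
  comp_id x := MaxHom.comp_id x
  assoc x y z := MaxHom.comp_assoc x y z
  homNormed X Y := (inferInstance : NormedAddCommGroup (MaxHom X Y))
  homSpace X Y := (inferInstance : NormedSpace ℂ (MaxHom X Y))
  homComplete X Y := (inferInstance : CompleteSpace (MaxHom X Y))
  add_comp {X Y Z} x x' y := (MaxHom.comp X Y Z).map_add₂ x x' y
  comp_add {X Y Z} x y y' := (MaxHom.comp X Y Z x).map_add y y'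
  smul_comp {X Y Z} c x y := (MaxHom.comp X Y Z).map_smul₂ c x y
  comp_smul {X Y Z} c x y := (MaxHom.comp X Y Z x).map_smul c y
  norm_comp_le x y := MaxHom.norm_comp_le x y
  adj {X Y} x := MaxHom.adj X Y x
  adj_adj x := MaxHom.adj_adj x
  adj_comp x y := MaxHom.adj_comp x y
  adj_add {X Y} x y := (MaxHom.adj X Y).map_add x y
  adj_smul {X Y} c x := (MaxHom.adj X Y).map_smulₛₗ c x
  norm_comp_adj x := MaxHom.norm_comp_adj x

/-- The maximal tensor product of two unital `C*`-categories. -/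
instance : UnitalCStarCategory (MaxTensor U V) where
  pos {X Y} x := by
    refine exists_of_norm_sub_le (X := X) _ (by simp) ?_
    rw [PreCStarCategory.norm_comp_adj]
    exact MaxHom.norm_smul_id_sub_le x

namespace MaxTensor

/-- The canonical bilinear functor to the maximal tensor product, on morphisms. -/
def tmul {X Y : MaxTensor U V} (f : X.fst ⟶ Y.fst) (g : X.snd ⟶ Y.snd) : X ⟶ Y :=
  MaxHom.of X Y (AlgTensor.tmul f g)

section
variable {X Y Z : MaxTensor U V}

lemma tmul_comp (f : X.fst ⟶ Y.fst) (g : X.snd ⟶ Y.snd) (f' : Y.fst ⟶ Z.fst)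
    (g' : Y.snd ⟶ Z.snd) : tmul f g ≫ tmul f' g' = tmul (f ≫ f') (g ≫ g') :=
  MaxHom.comp_of (AlgTensor.tmul f g) (AlgTensor.tmul f' g')

lemma tmul_id (X : MaxTensor U V) : tmul (𝟙 X.fst) (𝟙 X.snd) = 𝟙 X := rfl

lemma adj_tmul (f : X.fst ⟶ Y.fst) (g : X.snd ⟶ Y.snd) :
    adj (tmul f g) = tmul (X := Y) (Y := X) (adj f) (adj g) :=
  MaxHom.adj_of (AlgTensor.tmul f g)

lemma norm_tmul_le (f : X.fst ⟶ Y.fst) (g : X.snd ⟶ Y.snd) : ‖tmul f g‖ ≤ ‖f‖ * ‖g‖ :=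
  (MaxHom.norm_of (AlgTensor.tmul f g)).trans_le (AlgTensor.norm_tmul_le f g)

/-- The elementary tensors as a bilinear map. -/
def tmulL (X Y : MaxTensor U V) : (X.fst ⟶ Y.fst) →ₗ[ℂ] (X.snd ⟶ Y.snd) →ₗ[ℂ] (X ⟶ Y) :=
  (AlgTensor.tmulL X Y).compr₂ (MaxHom.of X Y).toLinearMap

lemma tmul_sum {ι : Type*} (s : Finset ι) (f : X.fst ⟶ Y.fst) (g : ι → (X.snd ⟶ Y.snd)) :
    tmul f (∑ i ∈ s, g i) = ∑ i ∈ s, tmul f (g i) := map_sum (tmulL X Y f) g s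

lemma sum_tmul {ι : Type*} (s : Finset ι) (f : ι → (X.fst ⟶ Y.fst)) (g : X.snd ⟶ Y.snd) :
    tmul (∑ i ∈ s, f i) g = ∑ i ∈ s, tmul (f i) g := map_sum ((tmulL X Y).flip g) f s

lemma tmul_zero (f : X.fst ⟶ Y.fst) : tmul f (0 : X.snd ⟶ Y.snd) = 0 := (tmulL X Y f).map_zero
lemma zero_tmul (g : X.snd ⟶ Y.snd) : tmul (0 : X.fst ⟶ Y.fst) g = 0 := (tmulL X Y).map_zero₂ g

/-- To prove a closed additive property of morphisms, check it on elementary tensors. -/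
lemma hom_induction {p : (X ⟶ Y) → Prop} (hp : IsClosed {x | p x}) (h0 : p 0)
    (ha : ∀ x y, p x → p y → p (x + y)) (ht : ∀ f g, p (tmul f g)) (x : X ⟶ Y) : p x :=
  MaxHom.induction hp (fun t => AlgTensor.induction (p := fun t => p (MaxHom.of X Y t))
    (by rw [map_zero]; exact h0) ht (fun s t hs ht => by rw [map_add]; exact ha _ _ hs ht) t) x

/-- Continuous linear maps agreeing on elementary tensors are equal. -/
lemma hom_ext {E : Type*} [NormedAddCommGroup E] [NormedSpace ℂ E]
    {f g : (X ⟶ Y) →L[ℂ] E} (h : ∀ a b, f (tmul a b) = g (tmul a b)) (x : X ⟶ Y) : f x = g x :=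
  hom_induction (p := fun x => f x = g x) (isClosed_eq f.continuous g.continuous) (by simp)
    (fun x y hx hy => by rw [map_add, map_add, hx, hy]) h x

end

section Map

variable {U' V' : Type u} [UnitalCStarCategory.{u, u} U'] [UnitalCStarCategory.{u, u} V']

/-- The action of `F ⊗ G` on objects. -/
@[reducible] def mapObj (F : StarFunctor U U') (G : StarFunctor V V') (X : MaxTensor U V) : MaxTensor U' V' :=
  ⟨F.obj X.fst, G.obj X.snd⟩

/-- The action of `F ⊗ G` on algebraic tensors. -/
def mapAlg (F : StarFunctor U U') (G : StarFunctor V V') (X Y : MaxTensor U V) :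
    AlgTensor X Y →ₗ[ℂ] AlgTensor (mapObj F G X) (mapObj F G Y) :=
  TensorProduct.map (F.mapL X.fst Y.fst) (G.mapL X.snd Y.snd)

lemma mapAlg_tmul (F : StarFunctor U U') (G : StarFunctor V V') {X Y : MaxTensor U V}
    (f : X.fst ⟶ Y.fst) (g : X.snd ⟶ Y.snd) :
    mapAlg F G X Y (AlgTensor.tmul f g) = AlgTensor.tmul (X := mapObj F G X) (Y := mapObj F G Y)
      (F.map f) (G.map g) := rfl

lemma mapAlg_comp (F : StarFunctor U U') (G : StarFunctor V V') {X Y Z : MaxTensor U V}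
    (s : AlgTensor X Y) (t : AlgTensor Y Z) : mapAlg F G X Z (AlgTensor.comp X Y Z s t) =
      AlgTensor.comp _ _ _ (mapAlg F G X Y s) (mapAlg F G Y Z t) := by
  induction t using AlgTensor.induction with
  | h0 => simp
  | ha t t' h h' => simp only [map_add, h, h']
  | ht f g =>
    induction s using AlgTensor.induction with
    | h0 => simp
    | ha t t' h h' => simp only [map_add, LinearMap.add_apply, h, h']
    | ht f g => exact congrArg₂ AlgTensor.tmul (F.map_comp _ _) (G.map_comp _ _)

lemma mapAlg_adj (F : StarFunctor U U') (G : StarFunctor V V') {X Y : MaxTensor U V}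
    (s : AlgTensor X Y) : mapAlg F G Y X (AlgTensor.adj X Y s) =
      AlgTensor.adj _ _ (mapAlg F G X Y s) := by
  induction s using AlgTensor.induction with
  | h0 => simp
  | ha t t' h h' => simp only [map_add, h, h']
  | ht f g => exact congrArg₂ AlgTensor.tmul (F.map_adj _) (G.map_adj _)

lemma norm_mapAlg_le (F : StarFunctor U U') (G : StarFunctor V V') {X Y : MaxTensor U V}
    (s : AlgTensor X Y) : ‖mapAlg F G X Y s‖ ≤ 1 * ‖s‖ := by
  rw [one_mul]
  refine AlgTensor.maxNorm_le _ (AlgTensor.maxNorm_nonneg _) fun π => ?_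
  let ρ : TensorRep U V :=
    { space := fun X => π.space (mapObj F G X)
      map := fun {X Y} => π.map.comp (mapAlg F G X Y)
      map_id := fun X => by
        rw [← π.map_id (mapObj F G X)]
        exact congrArg π.map (congrArg₂ AlgTensor.tmul (F.map_id _) (G.map_id _))
      map_comp := fun {X Y Z} s t => by
        change π.map (mapAlg F G X Z _) = _
        rw [mapAlg_comp]
        exact π.map_comp _ _
      map_adj := fun {X Y} s => by
        change π.map (mapAlg F G Y X _) = _
        rw [mapAlg_adj]
        exact π.map_adj _ }
  exact AlgTensor.le_maxNorm s ρ

/-- The bounded linear action of `F ⊗ G` on morphisms. -/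
def mapHom (F : StarFunctor U U') (G : StarFunctor V V') (X Y : MaxTensor U V) :
    (X ⟶ Y) →L[ℂ] (mapObj F G X ⟶ mapObj F G Y) :=
  MaxHom.lift ((MaxHom.of _ _).comp ((mapAlg F G X Y).mkContinuous 1 (norm_mapAlg_le F G)))

lemma mapHom_tmul (F : StarFunctor U U') (G : StarFunctor V V') {X Y : MaxTensor U V}
    (f : X.fst ⟶ Y.fst) (g : X.snd ⟶ Y.snd) :
    mapHom F G X Y (tmul f g) = tmul (X := mapObj F G X) (Y := mapObj F G Y) (F.map f) (G.map g) :=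
  MaxHom.lift_of _ _

lemma mapHom_comp (F : StarFunctor U U') (G : StarFunctor V V') {X Y Z : MaxTensor U V}
    (x : X ⟶ Y) (y : Y ⟶ Z) : mapHom F G X Z (x ≫ y) = mapHom F G X Y x ≫ mapHom F G Y Z y := by
  induction x using hom_induction with
  | hp =>
    exact isClosed_eq ((mapHom F G X Z).continuous.comp (continuous_comp_right y))
      ((continuous_comp_right _).comp (mapHom F G X Y).continuous)
  | h0 => simp
  | ha x x' h h' => simp only [PreCStarCategory.add_comp, map_add, h, h']
  | ht f g =>
    induction y using hom_induction with
    | hp =>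
      exact isClosed_eq ((mapHom F G X Z).continuous.comp (continuous_comp_left _))
        ((continuous_comp_left _).comp (mapHom F G Y Z).continuous)
    | h0 => simp
    | ha x x' h h' => simp only [PreCStarCategory.comp_add, map_add, h, h']
    | ht f' g' =>
      rw [tmul_comp, mapHom_tmul, mapHom_tmul, mapHom_tmul, tmul_comp]
      exact congrArg₂ tmul (F.map_comp _ _) (G.map_comp _ _)

lemma mapHom_adj (F : StarFunctor U U') (G : StarFunctor V V') {X Y : MaxTensor U V}
    (x : X ⟶ Y) : mapHom F G Y X (adj x) = adj (mapHom F G X Y x) := by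
  induction x using hom_induction with
  | hp =>
    exact isClosed_eq ((mapHom F G Y X).continuous.comp continuous_adj)
      (continuous_adj.comp (mapHom F G X Y).continuous)
  | h0 => simp
  | ha x x' h h' => simp only [PreCStarCategory.adj_add, map_add, h, h']
  | ht f g =>
    rw [adj_tmul, mapHom_tmul, mapHom_tmul, adj_tmul]
    exact congrArg₂ tmul (F.map_adj _) (G.map_adj _)

/-- The functor `F ⊗ G` between maximal tensor products. -/
def map (F : StarFunctor U U') (G : StarFunctor V V') :
    StarFunctor (MaxTensor U V) (MaxTensor U' V') where
  obj := mapObj F G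
  map {X Y} x := mapHom F G X Y x
  map_id X := by
    rw [← tmul_id, mapHom_tmul]
    exact congrArg₂ tmul (F.map_id _) (G.map_id _)
  map_comp {X Y Z} x y := mapHom_comp F G x y
  map_add {X Y} x y := (mapHom F G X Y).map_add x y
  map_smul {X Y} c x := (mapHom F G X Y).map_smul c x
  map_adj {X Y} x := mapHom_adj F G x

lemma mapHom_naturality {F F' : StarFunctor U U'} {G G' : StarFunctor V V'} (α : F ⟶ F')
    (β : G ⟶ G') {X Y : MaxTensor U V} (x : X ⟶ Y) :
    mapHom F G X Y x ≫ tmul (X := mapObj F G Y) (Y := mapObj F' G' Y)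
        (StarFunctor.app α Y.fst) (StarFunctor.app β Y.snd) =
      tmul (X := mapObj F G X) (Y := mapObj F' G' X)
        (StarFunctor.app α X.fst) (StarFunctor.app β X.snd) ≫ mapHom F' G' X Y x := by
  induction x using hom_induction with
  | hp =>
    exact isClosed_eq ((continuous_comp_right _).comp (mapHom F G X Y).continuous)
      ((continuous_comp_left _).comp (mapHom F' G' X Y).continuous)
  | h0 => simp
  | ha x x' h h' => simp only [map_add, PreCStarCategory.add_comp, PreCStarCategory.comp_add, h, h']
  | ht f g =>
    rw [mapHom_tmul, mapHom_tmul, tmul_comp, tmul_comp]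
    exact congrArg₂ tmul (StarFunctor.naturality α f) (StarFunctor.naturality β g)

/-- The transformation `α ⊗ β`. -/
def map₂ {F F' : StarFunctor U U'} {G G' : StarFunctor V V'} (α : F ⟶ F') (β : G ⟶ G') :
    map F G ⟶ map F' G' :=
  StarFunctor.mkNat (F := map F G) (G := map F' G')
    (fun X => tmul (X := mapObj F G X) (Y := mapObj F' G' X)
      (StarFunctor.app α X.fst) (StarFunctor.app β X.snd))
    (‖α‖ * ‖β‖)
    (fun _ => (norm_tmul_le _ _).trans (mul_le_mul (StarFunctor.norm_app_le α _)
      (StarFunctor.norm_app_le β _) (norm_nonneg _) (norm_nonneg _)))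
    (mapHom_naturality α β)

lemma map_id_id_map {X Y : MaxTensor U V} (x : X ⟶ Y) :
    (map (StarFunctor.id U) (StarFunctor.id V)).map x = x :=
  hom_ext (f := mapHom (StarFunctor.id U) (StarFunctor.id V) X Y)
    (g := ContinuousLinearMap.id ℂ _) (fun _ _ => mapHom_tmul _ _ _ _) x

lemma map_comp_map {U'' V'' : Type u} [UnitalCStarCategory.{u, u} U'']
    [UnitalCStarCategory.{u, u} V''] (F : StarFunctor U U') (G : StarFunctor V V')
    (F' : StarFunctor U' U'') (G' : StarFunctor V' V'') {X Y : MaxTensor U V} (x : X ⟶ Y) :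
    (map (F.comp F') (G.comp G')).map x = (map F' G').map ((map F G).map x) :=
  hom_ext (f := mapHom (F.comp F') (G.comp G') X Y)
    (g := (mapHom F' G' (mapObj F G X) (mapObj F G Y)).comp (mapHom F G X Y))
    (fun a b => by
      refine (mapHom_tmul _ _ _ _).trans
        (Eq.trans ?_ (congrArg (mapHom F' G' _ _) (mapHom_tmul F G a b)).symm)
      exact (mapHom_tmul F' G' (X := mapObj F G X) (Y := mapObj F G Y) _ _).symm) x

/-- The canonical isomorphism `id ⊗ id ≅ id`. -/
def mapId (U V : Type u) [UnitalCStarCategory.{u, u} U] [UnitalCStarCategory.{u, u} V] :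
    map (StarFunctor.id U) (StarFunctor.id V) ≅ StarFunctor.id (MaxTensor U V) :=
  StarFunctor.mkIso
    (StarFunctor.mkNat (F := map (StarFunctor.id U) (StarFunctor.id V))
      (G := StarFunctor.id (MaxTensor U V)) (fun X => 𝟙 X) 1 (fun _ => norm_id_le _)
      (fun f => (Category.comp_id _).trans ((map_id_id_map f).trans (Category.id_comp _).symm)))
    (StarFunctor.mkNat (F := StarFunctor.id (MaxTensor U V))
      (G := map (StarFunctor.id U) (StarFunctor.id V)) (fun X => 𝟙 X) 1 (fun _ => norm_id_le _)
      (fun f => (Category.comp_id _).trans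
        ((map_id_id_map f).symm.trans (Category.id_comp _).symm)))
    (fun _ => Category.id_comp _) (fun _ => Category.id_comp _)

/-- The canonical isomorphism `(F' ∘ F) ⊗ (G' ∘ G) ≅ (F' ⊗ G') ∘ (F ⊗ G)`. -/
def mapComp {U'' V'' : Type u} [UnitalCStarCategory.{u, u} U'']
    [UnitalCStarCategory.{u, u} V''] (F : StarFunctor U U') (F' : StarFunctor U' U'')
    (G : StarFunctor V V') (G' : StarFunctor V' V'') :
    map (F.comp F') (G.comp G') ≅ (map F G).comp (map F' G') :=
  StarFunctor.mkIso
    (StarFunctor.mkNat (F := map (F.comp F') (G.comp G')) (G := (map F G).comp (map F' G'))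
      (fun X => 𝟙 ((map F' G').obj ((map F G).obj X))) 1 (fun _ => norm_id_le _)
      (fun f => (Category.comp_id _).trans
        ((map_comp_map F G F' G' f).trans (Category.id_comp _).symm)))
    (StarFunctor.mkNat (F := (map F G).comp (map F' G')) (G := map (F.comp F') (G.comp G'))
      (fun X => 𝟙 ((map F' G').obj ((map F G).obj X))) 1 (fun _ => norm_id_le _)
      (fun f => (Category.comp_id _).trans
        ((map_comp_map F G F' G' f).symm.trans (Category.id_comp _).symm)))
    (fun _ => Category.id_comp _) (fun _ => Category.id_comp _)

end Map

end MaxTensor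
end Max

/-- The subobject completion of a `C*`-category: objects are pairs of an object and a projection. -/
structure SubobjectCompletion (C : Type u) [UnitalCStarCategory.{u, v} C] where
  /-- The underlying object. -/
  obj : C
  /-- The projection. -/
  proj : obj ⟶ obj
  idem : proj ≫ proj = proj
  selfAdj : adj proj = proj

namespace SubobjectCompletion

attribute [simp] idem selfAdj

variable {C : Type u} [UnitalCStarCategory.{u, v} C]

/-- Morphisms `(X, p) ⟶ (Y, q)` are the morphisms `h : X ⟶ Y` with `h ∘ p = h = q ∘ h`. -/
def homs (X Y : SubobjectCompletion C) : Submodule ℂ (X.obj ⟶ Y.obj) where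
  carrier := {h | X.proj ≫ h = h ∧ h ≫ Y.proj = h}
  add_mem' h h' := ⟨by rw [comp_add, h.1, h'.1], by rw [add_comp, h.2, h'.2]⟩
  zero_mem' := ⟨comp_zero _, zero_comp _⟩
  smul_mem' c _ h := ⟨by rw [comp_smul, h.1], by rw [smul_comp, h.2]⟩

lemma isClosed_homs (X Y : SubobjectCompletion C) : IsClosed (homs X Y : Set (X.obj ⟶ Y.obj)) :=
  (isClosed_eq (continuous_comp_left _) continuous_id).inter
    (isClosed_eq (continuous_comp_right _) continuous_id)

instance : Category (SubobjectCompletion C) where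
  Hom X Y := homs X Y
  id X := ⟨X.proj, X.idem, X.idem⟩
  comp f g := ⟨f.1 ≫ g.1, by rw [← Category.assoc, f.2.1], by rw [Category.assoc, g.2.2]⟩
  id_comp f := Subtype.ext f.2.1
  comp_id f := Subtype.ext f.2.2
  assoc f g h := Subtype.ext (Category.assoc _ _ _)

section
variable {X Y Z : SubobjectCompletion C}

/-- The underlying morphism. -/
def val (f : X ⟶ Y) : X.obj ⟶ Y.obj := Subtype.val (p := (· ∈ homs X Y)) f

/-- Constructor for morphisms. -/
def mkHom (f : X.obj ⟶ Y.obj) (h₁ : X.proj ≫ f = f) (h₂ : f ≫ Y.proj = f) : X ⟶ Y :=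
  (⟨f, h₁, h₂⟩ : homs X Y)

@[simp] lemma val_mkHom (f : X.obj ⟶ Y.obj) (h₁ : X.proj ≫ f = f) (h₂ : f ≫ Y.proj = f) :
    val (mkHom f h₁ h₂) = f := rfl
@[simp] lemma val_id (X : SubobjectCompletion C) : val (𝟙 X) = X.proj := rfl
@[simp] lemma val_comp (f : X ⟶ Y) (g : Y ⟶ Z) : val (f ≫ g) = val f ≫ val g := rfl
@[simp] lemma proj_val (f : X ⟶ Y) : X.proj ≫ val f = val f :=
  (Subtype.property (p := (· ∈ homs X Y)) f).1
@[simp] lemma val_proj (f : X ⟶ Y) : val f ≫ Y.proj = val f :=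
  (Subtype.property (p := (· ∈ homs X Y)) f).2
@[ext] lemma hom_ext {f g : X ⟶ Y} (h : val f = val g) : f = g := Subtype.ext h

instance : NormedAddCommGroup (X ⟶ Y) := inferInstanceAs (NormedAddCommGroup (homs X Y))
instance : NormedSpace ℂ (X ⟶ Y) := inferInstanceAs (NormedSpace ℂ (homs X Y))
instance : CompleteSpace (X ⟶ Y) := (isClosed_homs X Y).completeSpace_coe
end

/-- The subobject completion is a `C*`-category. -/
instance : PreCStarCategory (SubobjectCompletion C) where
  homNormed X Y := inferInstance
  homSpace X Y := inferInstance
  homComplete X Y := inferInstance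
  add_comp _ _ _ := hom_ext (add_comp _ _ _)
  comp_add _ _ _ := hom_ext (comp_add _ _ _)
  smul_comp _ _ _ := hom_ext (smul_comp _ _ _)
  comp_smul _ _ _ := hom_ext (comp_smul _ _ _)
  norm_comp_le f g := norm_comp_le (val f) (val g)
  adj {X Y} f := mkHom (adj (val f))
    (by rw [← Y.selfAdj, ← adj_comp, val_proj]) (by rw [← X.selfAdj, ← adj_comp, proj_val])
  adj_adj _ := hom_ext (adj_adj _)
  adj_comp _ _ := hom_ext (adj_comp _ _)
  adj_add _ _ := hom_ext (adj_add _ _)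
  adj_smul _ _ := hom_ext (adj_smul _ _)
  norm_comp_adj f := norm_comp_adj (val f)

section
variable {X Y Z : SubobjectCompletion C}
@[simp] lemma val_adj (f : X ⟶ Y) : val (adj f) = adj (val f) := rfl
@[simp] lemma val_add (f g : X ⟶ Y) : val (f + g) = val f + val g := rfl
@[simp] lemma val_sub (f g : X ⟶ Y) : val (f - g) = val f - val g := rfl
@[simp] lemma val_smul (c : ℂ) (f : X ⟶ Y) : val (c • f) = c • val f := rfl
@[simp] lemma val_zero : val (0 : X ⟶ Y) = 0 := rfl
lemma val_sum {ι : Type*} (s : Finset ι) (f : ι → (X ⟶ Y)) :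
    val (∑ i ∈ s, f i) = ∑ i ∈ s, val (f i) :=
  map_sum (AddMonoidHom.mk' (fun f : X ⟶ Y => val f) fun _ _ => rfl) f s
lemma norm_val (f : X ⟶ Y) : ‖val f‖ = ‖f‖ := rfl
lemma norm_proj_le (X : SubobjectCompletion C) : ‖X.proj‖ ≤ 1 := norm_id_le X
end

/-- The subobject completion is a `C*`-category. -/
instance : UnitalCStarCategory (SubobjectCompletion C) where
  pos {X Y} f := by
    refine exists_of_norm_sub_le (X := X) _ (by simp) ?_
    have h := norm_smul_id_sub_le (val f) (t := ‖f ≫ adj f‖) (norm_comp_adj f).ge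
    have h2 : val ((‖f ≫ adj f‖ : ℂ) • 𝟙 X - f ≫ adj f) =
        X.proj ≫ ((‖f ≫ adj f‖ : ℂ) • 𝟙 X.obj - val f ≫ adj (val f)) := by
      rw [val_sub, comp_sub, val_smul, comp_smul, Category.comp_id, val_id, val_comp, val_adj,
        ← Category.assoc, proj_val]
    rw [← norm_val, h2]
    refine (norm_comp_le _ _).trans ?_
    exact (mul_le_mul (norm_proj_le X) h (norm_nonneg _) zero_le_one).trans_eq (one_mul _)

lemma exists_split (X : SubobjectCompletion C) (p : X ⟶ X) (hp : p ≫ p = p) (hp' : adj p = p) :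
    ∃ (U : SubobjectCompletion C) (i : U ⟶ X), i ≫ adj i = 𝟙 U ∧ adj i ≫ i = p := by
  have h1 : val p ≫ val p = val p := congrArg val hp
  have h2 : adj (val p) = val p := congrArg val hp'
  refine ⟨⟨X.obj, val p, h1, h2⟩, mkHom (X := ⟨X.obj, val p, h1, h2⟩) (Y := X)
    (val (X := X) (Y := X) p) h1 (val_proj p),
    hom_ext ?_, hom_ext ?_⟩
  · simp only [val_comp, val_adj, val_mkHom, val_id, h1, h2]
  · simp only [val_comp, val_adj, val_mkHom, h1, h2]

section
universe u' v' u'' v''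
variable {D : Type u'} [UnitalCStarCategory.{u', v'} D] {E : Type u''}
  [UnitalCStarCategory.{u'', v''} E]

/-- The action of a functor on subobject completions. -/
def map (F : StarFunctor C D) : StarFunctor (SubobjectCompletion C) (SubobjectCompletion D) where
  obj X := ⟨F.obj X.obj, F.map X.proj, by rw [← F.map_comp, X.idem], by rw [← F.map_adj, X.selfAdj]⟩
  map {X Y} f := mkHom (F.map (val f))
    ((F.map_comp X.proj (val f)).symm.trans (congrArg F.map (proj_val f)))
    ((F.map_comp (val f) Y.proj).symm.trans (congrArg F.map (val_proj f)))
  map_id X := rfl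
  map_comp f g := hom_ext (F.map_comp _ _)
  map_add f g := hom_ext (F.map_add _ _)
  map_smul c f := hom_ext (F.map_smul _ _)
  map_adj f := hom_ext (F.map_adj _)

/-- The action of a natural transformation on subobject completions. -/
def map₂ {F G : StarFunctor C D} (τ : F ⟶ G) : map F ⟶ map G :=
  StarFunctor.mkNat (F := map F) (G := map G)
    (fun X => mkHom (X := (map F).obj X) (Y := (map G).obj X) (F.map X.proj ≫ StarFunctor.app τ X.obj)
      (by
        change F.map X.proj ≫ F.map X.proj ≫ StarFunctor.app τ X.obj = _
        rw [← Category.assoc, ← F.map_comp, X.idem]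
        rfl)
      (by
        change (F.map X.proj ≫ StarFunctor.app τ X.obj) ≫ G.map X.proj = _
        rw [Category.assoc, ← StarFunctor.naturality, ← Category.assoc, ← F.map_comp, X.idem]
        rfl))
    ‖τ‖ (fun X => (norm_comp_le _ _).trans
      ((mul_le_mul (norm_proj_le ((map F).obj X)) (StarFunctor.norm_app_le τ _)
        (norm_nonneg _) zero_le_one).trans_eq (one_mul _)))
    (fun {X Y} f => hom_ext (by
      change F.map (val f) ≫ F.map Y.proj ≫ StarFunctor.app τ Y.obj =
        (F.map X.proj ≫ StarFunctor.app τ X.obj) ≫ G.map (val f)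
      rw [Category.assoc, ← StarFunctor.naturality, ← Category.assoc, ← Category.assoc,
        ← F.map_comp, ← F.map_comp, val_proj, proj_val]))

end

end SubobjectCompletion

namespace SubobjectCompletion

lemma exists_directSum {C : Type u} [UnitalCStarCategory.{u, v} C] {n : ℕ}
    (Z : Fin n → SubobjectCompletion C) (S : C) (e : ∀ k, (Z k).obj ⟶ S)
    (h1 : ∀ k, e k ≫ adj (e k) = 𝟙 _) (h2 : ∀ k l, k ≠ l → e k ≫ adj (e l) = 0) :
    ∃ (T : SubobjectCompletion C) (i : ∀ k, Z k ⟶ T),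
    (∀ k, i k ≫ adj (i k) = 𝟙 (Z k)) ∧ (∀ k l, k ≠ l → i k ≫ adj (i l) = 0) ∧
      ∑ k, adj (i k) ≫ i k = 𝟙 T := by
  let P : S ⟶ S := ∑ k, adj (e k) ≫ (Z k).proj ≫ e k
  have key : ∀ k, e k ≫ P = (Z k).proj ≫ e k := fun k => by
    rw [comp_sum, Finset.sum_eq_single k]
    · rw [← Category.assoc, h1, Category.id_comp]
    · intro l _ hl
      rw [← Category.assoc, h2 k l hl.symm, zero_comp]
    · simp
  have hP : P ≫ P = P := by
    change (∑ k, adj (e k) ≫ (Z k).proj ≫ e k) ≫ P = _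
    rw [sum_comp]
    refine Finset.sum_congr rfl fun k _ => ?_
    rw [Category.assoc, Category.assoc, key, ← Category.assoc (Z k).proj, idem]
  have hP' : adj P = P := by simp [P, adj_sum]
  refine ⟨⟨S, P, hP, hP'⟩, fun k => mkHom (X := Z k) (Y := ⟨S, P, hP, hP'⟩) ((Z k).proj ≫ e k)
    ?_ ?_, fun k => hom_ext ?_, fun k l hkl => hom_ext ?_, hom_ext ?_⟩
  · rw [← Category.assoc, idem]
  · rw [Category.assoc]
    change (Z k).proj ≫ e k ≫ P = _
    rw [key, ← Category.assoc, idem]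
  · simp only [val_comp, val_adj, val_mkHom, val_id, PreCStarCategory.adj_comp, selfAdj,
      Category.assoc]
    rw [← Category.assoc (e k), h1, Category.id_comp, idem]
  · simp only [val_comp, val_adj, val_mkHom, PreCStarCategory.adj_comp, selfAdj,
      Category.assoc, val_zero]
    rw [← Category.assoc (e k), h2 k l hkl, zero_comp, comp_zero]
  · rw [val_sum, val_id]
    refine Finset.sum_congr rfl fun k _ => ?_
    simp only [val_comp, val_adj, val_mkHom, PreCStarCategory.adj_comp, selfAdj, Category.assoc]
    rw [← Category.assoc (Z k).proj, idem]

section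
variable {C D E : Type u} [UnitalCStarCategory.{u, u} C] [UnitalCStarCategory.{u, u} D]
  [UnitalCStarCategory.{u, u} E]

lemma map₂_id (F : StarFunctor C D) : map₂ (𝟙 F) = 𝟙 (map F) :=
  StarFunctor.nat_ext fun _ => hom_ext (Category.comp_id _)

lemma map₂_comp {F G H : StarFunctor C D} (σ : F ⟶ G) (τ : G ⟶ H) :
    map₂ (σ ≫ τ) = map₂ σ ≫ map₂ τ :=
  StarFunctor.nat_ext fun X => hom_ext (by
    change F.map X.proj ≫ StarFunctor.app σ X.obj ≫ StarFunctor.app τ X.obj =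
      (F.map X.proj ≫ StarFunctor.app σ X.obj) ≫ G.map X.proj ≫ StarFunctor.app τ X.obj
    rw [Category.assoc, ← Category.assoc (StarFunctor.app σ X.obj), ← StarFunctor.naturality,
      Category.assoc, ← Category.assoc (F.map X.proj) (F.map X.proj), ← F.map_comp, idem])

/-- The action of a natural isomorphism on subobject completions. -/
@[simps] def mapIso {F G : StarFunctor C D} (τ : F ≅ G) : map F ≅ map G where
  hom := map₂ τ.hom
  inv := map₂ τ.inv
  hom_inv_id := by rw [← map₂_comp, τ.hom_inv_id, map₂_id]
  inv_hom_id := by rw [← map₂_comp, τ.inv_hom_id, map₂_id]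

end

end SubobjectCompletion

instance {U V : Type u} [UnitalCStarCategory.{u, u} U] [UnitalCStarCategory.{u, u} V]
    [IsFinitelyAdditive U] [IsFinitelyAdditive V] :
    IsFinitelyAdditive (SubobjectCompletion (MaxTensor U V)) where
  exists_split := SubobjectCompletion.exists_split
  exists_directSum n Z := by
    obtain ⟨S, i, hi, hi', -⟩ :=
      IsFinitelyAdditive.exists_directSum n (fun k => (Z k).obj.fst)
    obtain ⟨T, j, hj, -, -⟩ :=
      IsFinitelyAdditive.exists_directSum n (fun k => (Z k).obj.snd)
    refine SubobjectCompletion.exists_directSum Z ⟨S, T⟩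
      (fun k => MaxTensor.tmul (Y := ⟨S, T⟩) (i k) (j k)) (fun k => ?_) (fun k l hkl => ?_)
    · rw [MaxTensor.adj_tmul, MaxTensor.tmul_comp, hi, hj]
      rfl
    · rw [MaxTensor.adj_tmul, MaxTensor.tmul_comp, hi' k l hkl, MaxTensor.zero_tmul]

namespace CStarLin

/-- The maximal tensor product of finitely additive `C*`-categories: the subobject completion of
the maximal tensor product of the underlying `C*`-categories. -/
def tensor (U V : CStarLin.{u}) : CStarLin.{u} :=
  ⟨SubobjectCompletion (MaxTensor U.carrier V.carrier)⟩

variable {U U' U'' V V' V'' W W' W'' : CStarLin.{u}}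

/-- The functor `F ⊠ G`. -/
def tensorMap (F : U ⟶ U') (G : V ⟶ V') : tensor U V ⟶ tensor U' V' :=
  SubobjectCompletion.map (MaxTensor.map F G)

/-- The transformation `α ⊠ β`. -/
def tensorMap₂ {F F' : U ⟶ U'} {G G' : V ⟶ V'} (α : F ⟶ F') (β : G ⟶ G') :
    tensorMap F G ⟶ tensorMap F' G' :=
  SubobjectCompletion.map₂ (MaxTensor.map₂ α β)

/-- The canonical isomorphism `id ⊠ id ≅ id`. -/
def tensorId (U V : CStarLin.{u}) : tensorMap (𝟙 U) (𝟙 V) ≅ 𝟙 (tensor U V) :=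
  SubobjectCompletion.mapIso (MaxTensor.mapId U.carrier V.carrier)

/-- The canonical isomorphism `(F' ∘ F) ⊠ (G' ∘ G) ≅ (F' ⊠ G') ∘ (F ⊠ G)`. -/
def tensorComp (F : U ⟶ U') (F' : U' ⟶ U'') (G : V ⟶ V') (G' : V' ⟶ V'') :
    tensorMap (F ≫ F') (G ≫ G') ≅ tensorMap F G ≫ tensorMap F' G' :=
  SubobjectCompletion.mapIso (MaxTensor.mapComp F F' G G')

end CStarLin

namespace MaxTensor

section
variable {U V U' V' U'' V'' : Type u} [UnitalCStarCategory.{u, u} U] [UnitalCStarCategory.{u, u} V]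
  [UnitalCStarCategory.{u, u} U'] [UnitalCStarCategory.{u, u} V']
  [UnitalCStarCategory.{u, u} U''] [UnitalCStarCategory.{u, u} V'']

lemma app_map₂ {F F' : StarFunctor U U'} {G G' : StarFunctor V V'} (α : F ⟶ F') (β : G ⟶ G')
    (X : MaxTensor U V) : StarFunctor.app (map₂ α β) X =
      tmul (X := mapObj F G X) (Y := mapObj F' G' X)
        (StarFunctor.app α X.fst) (StarFunctor.app β X.snd) := rfl

lemma map₂_id (F : StarFunctor U U') (G : StarFunctor V V') : map₂ (𝟙 F) (𝟙 G) = 𝟙 (map F G) :=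
  StarFunctor.nat_ext fun _ => tmul_id _

lemma map₂_comp {F F' F'' : StarFunctor U U'} {G G' G'' : StarFunctor V V'} (α : F ⟶ F')
    (α' : F' ⟶ F'') (β : G ⟶ G') (β' : G' ⟶ G'') :
    map₂ (α ≫ α') (β ≫ β') = map₂ α β ≫ map₂ α' β' :=
  StarFunctor.nat_ext fun X =>
    (tmul_comp (X := mapObj F G X) (Y := mapObj F' G' X) (Z := mapObj F'' G'' X)
      (StarFunctor.app α X.fst) (StarFunctor.app β X.snd) (StarFunctor.app α' X.fst)
      (StarFunctor.app β' X.snd)).symm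

lemma map₂_whiskerL (F : StarFunctor U U') {G G' : StarFunctor U' U''} (F' : StarFunctor V V')
    {H H' : StarFunctor V' V''} (α : G ⟶ G') (β : H ⟶ H') :
    map₂ (StarFunctor.whiskerL F α) (StarFunctor.whiskerL F' β) =
      (mapComp F G F' H).hom ≫ StarFunctor.whiskerL (map F F') (map₂ α β) ≫
        (mapComp F G' F' H').inv :=
  StarFunctor.nat_ext fun _ => (Category.id_comp _).trans (Category.comp_id _) |>.symm

lemma map₂_whiskerR {F G : StarFunctor U U'} {F' G' : StarFunctor V V'} (α : F ⟶ G) (β : F' ⟶ G')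
    (H : StarFunctor U' U'') (H' : StarFunctor V' V'') :
    map₂ (StarFunctor.whiskerR α H) (StarFunctor.whiskerR β H') =
      (mapComp F H F' H').hom ≫ StarFunctor.whiskerR (map₂ α β) (map H H') ≫
        (mapComp G H G' H').inv :=
  StarFunctor.nat_ext fun X => ((Category.id_comp _).trans ((Category.comp_id _).trans
    (mapHom_tmul H H' (X := mapObj F F' X) (Y := mapObj G G' X) _ _))).symm

lemma tmul_id' {X : MaxTensor U V} {a : X.fst ⟶ X.fst} {b : X.snd ⟶ X.snd} (ha : a = 𝟙 _)
    (hb : b = 𝟙 _) : tmul (X := X) (Y := X) a b = 𝟙 X := by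
  subst ha hb
  exact tmul_id X

variable {U₃ V₃ : Type u} [UnitalCStarCategory.{u, u} U₃] [UnitalCStarCategory.{u, u} V₃]

lemma id_coherence {C : Type u₁} [UnitalCStarCategory.{u₁, v₁} C] {D : Type u₂}
    [UnitalCStarCategory.{u₂, v₂} D] (K : StarFunctor C D) (Y : C) :
    𝟙 (K.obj Y) = 𝟙 (K.obj Y) ≫ K.map (𝟙 Y) ≫ 𝟙 (K.obj Y) ≫ 𝟙 (K.obj Y) := by
  rw [K.map_id]
  simp

lemma id_coherence' {C : Type u₁} [UnitalCStarCategory.{u₁, v₁} C] {D : Type u₂}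
    [UnitalCStarCategory.{u₂, v₂} D] (K : StarFunctor C D) (Y : C) :
    𝟙 (K.obj Y) = 𝟙 (K.obj Y) ≫ K.map (𝟙 Y) := by
  rw [K.map_id]
  simp

lemma mapComp_assoc (F : StarFunctor U U') (G : StarFunctor U' U'') (H : StarFunctor U'' U₃)
    (F' : StarFunctor V V') (G' : StarFunctor V' V'') (H' : StarFunctor V'' V₃) :
    𝟙 (map ((F.comp G).comp H) ((F'.comp G').comp H')) =
      (mapComp (F.comp G) H (F'.comp G') H').hom ≫
        StarFunctor.whiskerR (mapComp F G F' G').hom (map H H') ≫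
          StarFunctor.whiskerL (map F F') (mapComp G H G' H').inv ≫
            (mapComp F (G.comp H) F' (G'.comp H')).inv :=
  StarFunctor.nat_ext fun X => id_coherence (map H H') ((map (F.comp G) (F'.comp G')).obj X)

lemma mapComp_left_unit (F : StarFunctor U U') (F' : StarFunctor V V') :
    𝟙 (map F F') = (mapComp (StarFunctor.id U) F (StarFunctor.id V) F').hom ≫
      StarFunctor.whiskerR (mapId U V).hom (map F F') :=
  StarFunctor.nat_ext fun X => id_coherence' (map F F') X

lemma mapComp_right_unit (F : StarFunctor U U') (F' : StarFunctor V V') :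
    𝟙 (map F F') = (mapComp F (StarFunctor.id U') F' (StarFunctor.id V')).hom ≫
      StarFunctor.whiskerL (map F F') (mapId U' V').hom :=
  StarFunctor.nat_ext fun X => (Category.id_comp (𝟙 ((map F F').obj X))).symm

end

end MaxTensor

namespace SubobjectCompletion

section
variable {C D E : Type u} [UnitalCStarCategory.{u, u} C] [UnitalCStarCategory.{u, u} D]
  [UnitalCStarCategory.{u, u} E]

lemma map₂_whiskerL (F : StarFunctor C D) {G H : StarFunctor D E} (τ : G ⟶ H) :
    map₂ (StarFunctor.whiskerL F τ) = StarFunctor.whiskerL (map F) (map₂ τ) := rfl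

lemma map₂_whiskerR {F G : StarFunctor C D} (τ : F ⟶ G) (H : StarFunctor D E) :
    map₂ (StarFunctor.whiskerR τ H) = StarFunctor.whiskerR (map₂ τ) (map H) :=
  StarFunctor.nat_ext fun X => hom_ext (H.map_comp (F.map X.proj) (StarFunctor.app τ X.obj)).symm

end
end SubobjectCompletion

namespace CStarLin

open Bicategory

variable {U U' U'' U₃ V V' V'' V₃ : CStarLin.{u}}

lemma tensorMap₂_id (F : U ⟶ U') (G : V ⟶ V') :
    tensorMap₂ (𝟙 F) (𝟙 G) = 𝟙 (tensorMap F G) :=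
  (congrArg SubobjectCompletion.map₂ (MaxTensor.map₂_id F G)).trans (SubobjectCompletion.map₂_id _)

lemma tensorMap₂_comp {F F' F'' : U ⟶ U'} {G G' G'' : V ⟶ V'} (α : F ⟶ F')
    (α' : F' ⟶ F'') (β : G ⟶ G') (β' : G' ⟶ G'') :
    tensorMap₂ (α ≫ α') (β ≫ β') = tensorMap₂ α β ≫ tensorMap₂ α' β' :=
  (congrArg SubobjectCompletion.map₂ (MaxTensor.map₂_comp α α' β β')).trans
    (SubobjectCompletion.map₂_comp _ _)

lemma tensorMap₂_whiskerLeft (F : U ⟶ U') {G G' : U' ⟶ U''} (F' : V ⟶ V') {H H' : V' ⟶ V''}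
    (α : G ⟶ G') (β : H ⟶ H') :
    tensorMap₂ (F ◁ α) (F' ◁ β) = (tensorComp F G F' H).hom ≫ tensorMap F F' ◁ tensorMap₂ α β ≫
      (tensorComp F G' F' H').inv :=
  (congrArg SubobjectCompletion.map₂ (MaxTensor.map₂_whiskerL F F' α β)).trans
    ((SubobjectCompletion.map₂_comp _ _).trans (congrArg _ (SubobjectCompletion.map₂_comp _ _)))

lemma tensorMap₂_whiskerRight {F G : U ⟶ U'} {F' G' : V ⟶ V'} (α : F ⟶ G) (β : F' ⟶ G')
    (H : U' ⟶ U'') (H' : V' ⟶ V'') :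
    tensorMap₂ (α ▷ H) (β ▷ H') = (tensorComp F H F' H').hom ≫ tensorMap₂ α β ▷ tensorMap H H' ≫
      (tensorComp G H G' H').inv := by
  refine (congrArg SubobjectCompletion.map₂ (MaxTensor.map₂_whiskerR α β H H')).trans
    ((SubobjectCompletion.map₂_comp _ _).trans (congrArg _ ((SubobjectCompletion.map₂_comp _ _).trans
      (congrArg (· ≫ _) (SubobjectCompletion.map₂_whiskerR _ _)))))

lemma tensorComp_assoc (F : U ⟶ U') (G : U' ⟶ U'') (H : U'' ⟶ U₃)
    (F' : V ⟶ V') (G' : V' ⟶ V'') (H' : V'' ⟶ V₃) :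
    tensorMap₂ (α_ F G H).hom (α_ F' G' H').hom = (tensorComp (F ≫ G) H (F' ≫ G') H').hom ≫
      (tensorComp F G F' G').hom ▷ tensorMap H H' ≫
        (α_ (tensorMap F F') (tensorMap G G') (tensorMap H H')).hom ≫
          tensorMap F F' ◁ (tensorComp G H G' H').inv ≫
            (tensorComp F (G ≫ H) F' (G' ≫ H')).inv := by
  have h := congrArg SubobjectCompletion.map₂ (MaxTensor.mapComp_assoc F G H F' G' H')
  have h1 := SubobjectCompletion.map₂_id (MaxTensor.map ((F ≫ G) ≫ H) ((F' ≫ G') ≫ H'))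
  have h2 := tensorMap₂_id ((F ≫ G) ≫ H) ((F' ≫ G') ≫ H')
  refine (h2.trans h1.symm).trans (h.trans ?_)
  refine (SubobjectCompletion.map₂_comp _ _).trans (congrArg _ ?_)
  refine (SubobjectCompletion.map₂_comp _ _).trans ?_
  refine congrArg₂ (· ≫ ·) (SubobjectCompletion.map₂_whiskerR _ _) ?_
  exact (SubobjectCompletion.map₂_comp _ _).trans (Category.id_comp _).symm

lemma tensorComp_left_unit (F : U ⟶ U') (F' : V ⟶ V') :
    tensorMap₂ (λ_ F).hom (λ_ F').hom = (tensorComp (𝟙 U) F (𝟙 V) F').hom ≫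
      (tensorId U V).hom ▷ tensorMap F F' ≫ (λ_ (tensorMap F F')).hom := by
  have h := congrArg SubobjectCompletion.map₂ (MaxTensor.mapComp_left_unit F F')
  have h1 := SubobjectCompletion.map₂_id (MaxTensor.map F F')
  have h2 := tensorMap₂_id F F'
  refine (h2.trans h1.symm).trans (h.trans ?_)
  refine (SubobjectCompletion.map₂_comp _ _).trans (congrArg _ ?_)
  exact (SubobjectCompletion.map₂_whiskerR _ _).trans (Category.comp_id _).symm

lemma tensorComp_right_unit (F : U ⟶ U') (F' : V ⟶ V') :
    tensorMap₂ (ρ_ F).hom (ρ_ F').hom = (tensorComp F (𝟙 U') F' (𝟙 V')).hom ≫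
      tensorMap F F' ◁ (tensorId U' V').hom ≫ (ρ_ (tensorMap F F')).hom := by
  have h := congrArg SubobjectCompletion.map₂ (MaxTensor.mapComp_right_unit F F')
  have h1 := SubobjectCompletion.map₂_id (MaxTensor.map F F')
  have h2 := tensorMap₂_id F F'
  refine (h2.trans h1.symm).trans (h.trans ?_)
  exact (SubobjectCompletion.map₂_comp _ _).trans (congrArg _ (Category.comp_id _).symm)

end CStarLin

namespace CStarLin

open Bicategory Opposite Bicategory.Opposite

section
variable {C C' C'' C₃ D D' D'' D₃ : CStarLin.{u}}

/-- The functor `C*lin(F, H)`, given on objects by `K ↦ H ∘ K ∘ F`. -/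
def ihomMap (F : C' ⟶ C) (H : D ⟶ D') : ihom C D ⟶ ihom C' D' := StarFunctor.whisker F H

/-- The transformation `C*lin(α, γ)`, whose component at `K` is the horizontal composition
`γ * K * α`. -/
def ihomMap₂ {F F' : C' ⟶ C} {H H' : D ⟶ D'} (α : F ⟶ F') (γ : H ⟶ H') :
    ihomMap F H ⟶ ihomMap F' H' := StarFunctor.whisker₂ α γ

lemma ihomMap₂_id (F : C' ⟶ C) (H : D ⟶ D') : ihomMap₂ (𝟙 F) (𝟙 H) = 𝟙 (ihomMap F H) :=
  StarFunctor.nat_ext fun K => StarFunctor.nat_ext fun X => by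
    change H.map (K.map (𝟙 (F.obj X))) ≫ 𝟙 (H.obj (K.obj (F.obj X))) = 𝟙 (H.obj (K.obj (F.obj X)))
    rw [K.map_id, H.map_id, Category.comp_id]

lemma ihomMap₂_comp {F F' F'' : C' ⟶ C} {H H' H'' : D ⟶ D'} (α : F ⟶ F') (α' : F' ⟶ F'')
    (γ : H ⟶ H') (γ' : H' ⟶ H'') :
    ihomMap₂ (α ≫ α') (γ ≫ γ') = ihomMap₂ α γ ≫ ihomMap₂ α' γ' :=
  StarFunctor.nat_ext fun K => StarFunctor.nat_ext fun X => by
    change H.map (K.map (StarFunctor.app α X ≫ StarFunctor.app α' X)) ≫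
        StarFunctor.app γ (K.obj (F''.obj X)) ≫ StarFunctor.app γ' (K.obj (F''.obj X)) =
      (H.map (K.map (StarFunctor.app α X)) ≫ StarFunctor.app γ (K.obj (F'.obj X))) ≫
        H'.map (K.map (StarFunctor.app α' X)) ≫ StarFunctor.app γ' (K.obj (F''.obj X))
    rw [K.map_comp, H.map_comp, Category.assoc, Category.assoc,
      ← Category.assoc (StarFunctor.app γ (K.obj (F'.obj X))), ← StarFunctor.naturality,
      Category.assoc]

/-- The isomorphism `C*lin(F, H) ≅ C*lin(F', H')` induced by isomorphisms `F ≅ F'`, `H ≅ H'`. -/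
@[simps] def ihomMapIso {F F' : C' ⟶ C} {H H' : D ⟶ D'} (α : F ≅ F') (γ : H ≅ H') :
    ihomMap F H ≅ ihomMap F' H' where
  hom := ihomMap₂ α.hom γ.hom
  inv := ihomMap₂ α.inv γ.inv
  hom_inv_id := by rw [← ihomMap₂_comp, α.hom_inv_id, γ.hom_inv_id, ihomMap₂_id]
  inv_hom_id := by rw [← ihomMap₂_comp, α.inv_hom_id, γ.inv_hom_id, ihomMap₂_id]

/-- `C*lin(id, id) ≅ id`, with identity components. -/
def ihomId (C D : CStarLin.{u}) : ihomMap (𝟙 C) (𝟙 D) ≅ 𝟙 (ihom C D) :=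
  StarFunctor.mkIso
    (StarFunctor.mkNat (F := ihomMap (𝟙 C) (𝟙 D)) (G := 𝟙 (ihom C D)) (fun K => 𝟙 K) 1
      (fun _ => norm_id_le _) (fun _ => (Category.comp_id _).trans (Category.id_comp _).symm))
    (StarFunctor.mkNat (F := 𝟙 (ihom C D)) (G := ihomMap (𝟙 C) (𝟙 D)) (fun K => 𝟙 K) 1
      (fun _ => norm_id_le _) (fun _ => (Category.comp_id _).trans (Category.id_comp _).symm))
    (fun _ => Category.id_comp _) (fun _ => Category.id_comp _)

/-- `C*lin(F ∘ F', H' ∘ H) ≅ C*lin(F', H') ∘ C*lin(F, H)`, with identity components. -/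
def ihomComp (F : C' ⟶ C) (F' : C'' ⟶ C') (H : D ⟶ D') (H' : D' ⟶ D'') :
    ihomMap (F' ≫ F) (H ≫ H') ≅ ihomMap F H ≫ ihomMap F' H' := Iso.refl _

end

end CStarLin

namespace CStarLin

open Bicategory Opposite Bicategory.Opposite

section
variable {C C' C'' C₃ D D' D'' D₃ : CStarLin.{u}}

lemma ihomMap₂_left (F : C' ⟶ C) {G G' : C'' ⟶ C'} (α : G ⟶ G') (H : D ⟶ D') {K K' : D' ⟶ D''}
    (γ : K ⟶ K') : ihomMap₂ (α ▷ F) (H ◁ γ) =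
      (ihomComp F G H K).hom ≫ ihomMap F H ◁ ihomMap₂ α γ ≫ (ihomComp F G' H K').inv :=
  (id_comp_id _).symm

lemma ihomMap₂_right (F : C'' ⟶ C') {G G' : C' ⟶ C} (α : G ⟶ G') (H : D' ⟶ D'') {K K' : D ⟶ D'}
    (γ : K ⟶ K') : ihomMap₂ (F ◁ α) (γ ▷ H) =
      (ihomComp G F K H).hom ≫ ihomMap₂ α γ ▷ ihomMap F H ≫ (ihomComp G' F K' H).inv := by
  refine Eq.trans ?_ (id_comp_id _).symm
  exact StarFunctor.nat_ext fun L => StarFunctor.nat_ext fun X =>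
    (H.map_comp (K.map (L.map (StarFunctor.app α (F.obj X))))
      (StarFunctor.app γ (L.obj (G'.obj (F.obj X))))).symm
end

end CStarLin

section

open Bicategory

/-- The pseudofunctor into a product of bicategories with given components. -/
@[simps] def pairing {A : Type u₁} [Bicategory.{v₁, v} A] {B : Type u₂} [Bicategory.{v₂, u} B]
    {C : Type u₃} [Bicategory.{v₃, u₄} C] (F : A ⥤ᵖ B) (G : A ⥤ᵖ C) : A ⥤ᵖ B × C where
  obj X := (F.obj X, G.obj X)
  map f := (F.map f, G.map f)
  map₂ η := (F.map₂ η, G.map₂ η)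
  map₂_id f := Prod.ext (F.map₂_id f) (G.map₂_id f)
  map₂_comp η θ := Prod.ext (F.map₂_comp η θ) (G.map₂_comp η θ)
  mapId X := Iso.prod (F.mapId X) (G.mapId X)
  mapComp f g := Iso.prod (F.mapComp f g) (G.mapComp f g)
  map₂_whisker_left f _ _ η := Prod.ext (F.map₂_whisker_left f η) (G.map₂_whisker_left f η)
  map₂_whisker_right η h := Prod.ext (F.map₂_whisker_right η h) (G.map₂_whisker_right η h)
  map₂_associator f g h := Prod.ext (F.map₂_associator f g h) (G.map₂_associator f g h)
  map₂_left_unitor f := Prod.ext (F.map₂_left_unitor f) (G.map₂_left_unitor f)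
  map₂_right_unitor f := Prod.ext (F.map₂_right_unitor f) (G.map₂_right_unitor f)

end

namespace CStarLin

open Bicategory Opposite Bicategory.Opposite

lemma tensorComp_assoc_inv {U U' U'' U₃ V V' V'' V₃ : CStarLin.{u}} (F : U ⟶ U') (G : U' ⟶ U'')
    (H : U'' ⟶ U₃) (F' : V ⟶ V') (G' : V' ⟶ V'') (H' : V'' ⟶ V₃) :
    tensorMap₂ (α_ F G H).inv (α_ F' G' H').inv = (tensorComp F (G ≫ H) F' (G' ≫ H')).hom ≫
      tensorMap F F' ◁ (tensorComp G H G' H').hom ≫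
        (α_ (tensorMap F F') (tensorMap G G') (tensorMap H H')).inv ≫
          (tensorComp F G F' G').inv ▷ tensorMap H H' ≫
            (tensorComp (F ≫ G) H (F' ≫ G') H').inv := by
  have h := tensorMap₂_comp (α_ F G H).hom (α_ F G H).inv (α_ F' G' H').hom (α_ F' G' H').inv
  rw [Iso.hom_inv_id, Iso.hom_inv_id, tensorMap₂_id, tensorComp_assoc] at h
  simp only [Category.assoc] at h
  rw [← Iso.inv_comp_eq, Category.comp_id] at h
  rw [h]
  simp

lemma ihom_coherence' {C C' D D' : CStarLin.{u}} (T : ihom C D ⟶ ihom C' D')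
    (K : (ihom C D).carrier) : 𝟙 (T.obj K) = 𝟙 (T.obj K) ≫ T.map (𝟙 K) ≫ 𝟙 (T.obj K) := by
  rw [T.map_id]
  simp

lemma ihom_coherence {C C' D D' : CStarLin.{u}} (T : ihom C D ⟶ ihom C' D')
    (K : (ihom C D).carrier) : 𝟙 (T.obj K) =
      𝟙 (T.obj K) ≫ T.map (𝟙 K) ≫ 𝟙 (T.obj K) ≫ 𝟙 (T.obj K) ≫ 𝟙 (T.obj K) := by
  rw [T.map_id]
  simp

/-- The pseudofunctor `(C, D) ↦ C*lin(C, D)`. -/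
def ihomFunctor : CStarLin.{u}ᵒᵖ × CStarLin.{u} ⥤ᵖ CStarLin.{u} where
  obj X := ihom X.1.unop X.2
  map f := ihomMap f.1.unop f.2
  map₂ η := ihomMap₂ η.1.unop2 η.2
  map₂_id f := ihomMap₂_id f.1.unop f.2
  map₂_comp η θ := ihomMap₂_comp η.1.unop2 θ.1.unop2 η.2 θ.2
  mapId X := ihomId X.1.unop X.2
  mapComp f g := ihomComp f.1.unop g.1.unop f.2 g.2
  map₂_whisker_left f _ _ η := ihomMap₂_left f.1.unop η.1.unop2 f.2 η.2
  map₂_whisker_right η h := ihomMap₂_right h.1.unop η.1.unop2 h.2 η.2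
  map₂_associator f g h := (ihomMap₂_id _ _).trans (StarFunctor.nat_ext fun K =>
    ihom_coherence (ihomMap h.1.unop h.2) ((ihomMap g.1.unop g.2).obj ((ihomMap f.1.unop f.2).obj K)))
  map₂_left_unitor f := (ihomMap₂_id _ _).trans (StarFunctor.nat_ext fun K =>
    ihom_coherence' (ihomMap f.1.unop f.2) K)
  map₂_right_unitor f := (ihomMap₂_id _ _).trans (StarFunctor.nat_ext fun K =>
    (id_comp_id (𝟙 ((ihomMap f.1.unop f.2).obj K))).symm)

/-- The tensor product as a pseudofunctor on opposite bicategories. -/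
def tensorOp : CStarLin.{u}ᵒᵖ × CStarLin.{u}ᵒᵖ ⥤ᵖ CStarLin.{u}ᵒᵖ where
  obj X := op (tensor X.1.unop X.2.unop)
  map f := (tensorMap f.1.unop f.2.unop).op
  map₂ η := op2 (tensorMap₂ η.1.unop2 η.2.unop2)
  map₂_id f := congrArg op2 (tensorMap₂_id f.1.unop f.2.unop)
  map₂_comp η θ := congrArg op2 (tensorMap₂_comp η.1.unop2 θ.1.unop2 η.2.unop2 θ.2.unop2)
  mapId X := (tensorId X.1.unop X.2.unop).op2
  mapComp f g := (tensorComp g.1.unop f.1.unop g.2.unop f.2.unop).op2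
  map₂_whisker_left f _ _ η := congrArg op2
    (tensorMap₂_whiskerRight η.1.unop2 η.2.unop2 f.1.unop f.2.unop)
  map₂_whisker_right η h := congrArg op2
    (tensorMap₂_whiskerLeft h.1.unop h.2.unop η.1.unop2 η.2.unop2)
  map₂_associator f g h := congrArg op2 (tensorComp_assoc_inv h.1.unop g.1.unop f.1.unop
    h.2.unop g.2.unop f.2.unop)
  map₂_left_unitor f := congrArg op2 (tensorComp_right_unit f.1.unop f.2.unop)
  map₂_right_unitor f := congrArg op2 (tensorComp_left_unit f.1.unop f.2.unop)

/-- The pseudofunctor `(U, V, W) ↦ C*lin(U ⊠ V, W)`. -/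
def homTensor : CStarLin.{u}ᵒᵖ × CStarLin.{u}ᵒᵖ × CStarLin.{u} ⥤ᵖ CStarLin.{u} :=
  (pairing ((pairing (CategoryTheory.Bicategory.Prod.fst _ _).toPseudofunctor
    ((CategoryTheory.Bicategory.Prod.snd _ _).toPseudofunctor.comp (CategoryTheory.Bicategory.Prod.fst _ _).toPseudofunctor)).comp tensorOp)
    ((CategoryTheory.Bicategory.Prod.snd _ _).toPseudofunctor.comp (CategoryTheory.Bicategory.Prod.snd _ _).toPseudofunctor)).comp ihomFunctor

/-- The pseudofunctor `(U, V, W) ↦ C*lin(U, C*lin(V, W))`. -/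
def homHom : CStarLin.{u}ᵒᵖ × CStarLin.{u}ᵒᵖ × CStarLin.{u} ⥤ᵖ CStarLin.{u} :=
  (pairing (CategoryTheory.Bicategory.Prod.fst _ _).toPseudofunctor
    ((CategoryTheory.Bicategory.Prod.snd _ _).toPseudofunctor.comp ihomFunctor)).comp ihomFunctor

lemma homTensor_obj (U V W : CStarLin.{u}) :
    homTensor.obj (op U, op V, W) = ihom (tensor U V) W := rfl

lemma homTensor_map {U V W U' V' W' : CStarLin.{u}} (f : U' ⟶ U) (g : V' ⟶ V) (h : W ⟶ W') :
    homTensor.map (X := (op U, op V, W)) (Y := (op U', op V', W')) (f.op, g.op, h) =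
      ihomMap (tensorMap f g) h := rfl

lemma homHom_obj (U V W : CStarLin.{u}) :
    homHom.obj (op U, op V, W) = ihom U (ihom V W) := rfl

lemma homHom_map {U V W U' V' W' : CStarLin.{u}} (f : U' ⟶ U) (g : V' ⟶ V) (h : W ⟶ W') :
    homHom.map (X := (op U, op V, W)) (Y := (op U', op V', W')) (f.op, g.op, h) =
      ihomMap f (ihomMap g h) := rfl

end CStarLin

end CStarCat

end

/-! The equivalence is currying, carried out in two layers. Since `W` splits projections,
restriction along the inclusion of a `C*`-category `C` into its subobject completion is an
equivalence on functors to `W` (`SubobjectCompletion.isUnitaryEquivalence_of`): a functor extends by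
splitting the images of the projections, and a transformation is determined by its components at the
objects `(X, 1)`, because `(X, p)` is a subobject of `(X, 1)`. This removes the completion from `⊠`.
On the maximal tensor product itself a functor `K` is sent to `A ↦ K(A, -)`. The factorisation of `f
⊗ g` into `f ⊗ 1` followed by `1 ⊗ g`, together with density of the algebraic tensors, shows that
naturality in pairs is the same as naturality in each variable
(`MaxTensor.isUnitaryEquivalence_curry`).

The analytic point is essential surjectivity. A functor `H : U → C*lin(V, W)` defines a `*`-functor
on the algebraic tensor product, which must be bounded for the maximal norm in order to extend. That
norm is a supremum over Hilbert space representations, so `W` must have enough of these.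
`exists_rep_norm_le` provides them: for `a : X ⟶ Y` take a positive functional on the endomorphisms
of `X` attaining the norm of `a* ∘ a`, and apply the Gelfand-Naimark-Segal construction with the
completion of the morphisms `X ⟶ Y` as the space at `Y`. The class of the identity has norm at most
one, and `a` sends it to a vector of norm `‖a‖`. Precomposing such a representation of `W` with the
functor given by `H` yields one of the representations in the supremum (`norm_uncurryAlg_le`).

All isomorphisms are chosen unitary. Unitarity makes the inverse functor preserve `*`, and it bounds
every comparison family by one, as transformations require.

For pseudonaturality, `F ⊠ G` sends the pair `(A, B)` to `(F A, G B)` with the projection `F 1 ⊗ G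
1` in place of `1`. The tautological unitary `tensorMapOf` between these two objects, transported by
`K` and `H`, gives the components of `curryNat`. The axioms of a strong transformation then reduce
to `tensorMapOf_id`, `tensorMapOf_comp` and `tensorMapOf_naturality₂`. -/

noncomputable section

namespace CStarCat

open CategoryTheory PreCStarCategory

universe v u₁ v₁ u₂ v₂ u₃ v₃

/-! ### States attaining the norm of a positive element -/

section States

open ComplexConjugate ComplexOrder

/-- For a positive element `a` of a unital `C*`-algebra there is a hermitian positive functional of
value at most one at the unit which attains the norm of `a`. -/
lemma exists_state {A : Type*} [CStarAlgebra A] [PartialOrder A] [StarOrderedRing A] (a : A)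
    (ha : 0 ≤ a) : ∃ φ : A →ₗ[ℂ] ℂ, (∀ b, φ (star b) = conj (φ b)) ∧ (∀ b, 0 ≤ b → 0 ≤ φ b) ∧
      φ 1 ≤ 1 ∧ φ a = ‖a‖ := by
  -- The algebra may be zero, as for the endomorphisms of a zero object; hence only `φ 1 ≤ 1` is
  -- asked, and the zero functional serves here.
  by_cases h0 : a = 0
  · exact ⟨0, by simp, by simp, by simp, by simp [h0]⟩
  have : Nontrivial A := ⟨a, 0, h0⟩
  -- Hahn-Banach is applied to `‖a‖ + a` rather than to `a`, so that a single functional is forced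
  -- to be extremal at `1` and at `a` simultaneously.
  obtain ⟨g, hg, hg'⟩ := exists_dual_vector'' ℂ (algebraMap ℝ A ‖a‖ + a)
  have hn : ‖algebraMap ℝ A ‖a‖ + a‖ = ‖a‖ + ‖a‖ := by
    refine le_antisymm ((norm_add_le _ _).trans_eq (by simp)) ?_
    -- For positive `a` the norm lies in the spectrum, so `2‖a‖` lies in the spectrum of the shifted
    -- element.
    have h1 : (‖a‖ + ‖a‖) ∈ spectrum ℝ (algebraMap ℝ A ‖a‖ + a) := by
      rw [spectrum.add_mem_add_iff]
      exact CStarAlgebra.norm_mem_spectrum_of_nonneg ha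
    have := spectrum.norm_le_norm_of_mem h1
    rwa [Real.norm_of_nonneg (by positivity)] at this
  have hle : ∀ b, ‖g b‖ ≤ ‖b‖ := fun b => (g.le_of_opNorm_le hg b).trans_eq (one_mul _)
  have hre : ∀ b, (g b).re ≤ ‖b‖ := fun b => (Complex.re_le_norm _).trans (hle b)
  have hpos : 0 < ‖a‖ := norm_pos_iff.2 h0
  have hs : ∀ t : ℝ, g (algebraMap ℝ A t) = t * g 1 := fun t => by
    rw [Algebra.algebraMap_eq_smul_one, ← Complex.coe_smul, map_smul, smul_eq_mul]
  -- The two summands are at most `‖a‖` each and add up to `2‖a‖`, so both bounds are attained.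
  have h2 : (‖a‖ : ℝ) * (g 1).re + (g a).re = ‖a‖ + ‖a‖ := by
    have := congrArg Complex.re hg'
    rw [hn, map_add, hs] at this
    simpa using this
  have h3 : (g 1).re ≤ 1 := by simpa using hre 1
  have h4 := hre a
  have h5 : (g a).re = ‖a‖ := le_antisymm h4 (by nlinarith)
  have h6 : (g 1).re = 1 := by
    refine le_antisymm h3 ?_
    have : ‖a‖ * 1 ≤ ‖a‖ * (g 1).re := by linarith
    exact le_of_mul_le_mul_left this hpos
  -- The hermitian part of `g`; on self-adjoint elements it is the real part of `g`, so the values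
  -- found above persist.
  let φ : A →ₗ[ℂ] ℂ :=
    { toFun := fun b => (1 / 2 : ℂ) * (g b + conj (g (star b)))
      map_add' := fun b c => by simp only [star_add, map_add]; ring
      map_smul' := fun c b => by
        simp only [star_smul, map_smul, smul_eq_mul, map_mul, RCLike.star_def, Complex.conj_conj,
          RingHom.id_apply]; ring }
  have hφ : ∀ b, φ b = (1 / 2 : ℂ) * (g b + conj (g (star b))) := fun _ => rfl
  have hsa : ∀ b, star b = b → φ b = ((g b).re : ℂ) := fun b hb => by
    rw [hφ, hb, Complex.add_conj]; simp
  refine ⟨φ, fun b => ?_, fun b hb => ?_, ?_, ?_⟩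
  · rw [hφ, hφ, star_star, map_mul, map_add, Complex.conj_conj, add_comm (g (star b)),
      map_div₀, map_one, Complex.conj_ofNat]
  · rw [hsa b (IsSelfAdjoint.of_nonneg hb)]
    -- Positivity of `b` gives that `‖b‖ - b` has norm at most `‖b‖`. As `g` is contractive with `Re
    -- g 1 = 1`, it follows that `‖b‖ - Re g b ≤ ‖b‖`.
    have h7 := (SpectrumRestricts.nnreal_iff_nnnorm (t := ‖b‖₊)
      (IsSelfAdjoint.of_nonneg hb) le_rfl).1 (SpectrumRestricts.nnreal_of_nonneg hb)
    have h8 := (hre _).trans h7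
    have h9 := hs ‖b‖
    simp only [coe_nnnorm, map_sub, Complex.sub_re, h9] at h8
    simp [h6] at h8
    exact_mod_cast h8
  · rw [hsa 1 (star_one A), h6]; simp
  · rw [hsa a (IsSelfAdjoint.of_nonneg ha), h5]

end States

/-! ### Passing operators and adjoints to completions -/

section Completion

open UniformSpace InnerProductSpace

section
variable {E F G : Type*} [SeminormedAddCommGroup E] [NormedSpace ℂ E] [SeminormedAddCommGroup F]
  [NormedSpace ℂ F] [SeminormedAddCommGroup G] [NormedSpace ℂ G]

lemma completion_ext {f g : Completion E →L[ℂ] Completion F}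
    (h : ∀ x : E, f (x : Completion E) = g (x : Completion E)) : f = g := by
  ext x
  induction x using Completion.induction_on with
  | hp => exact isClosed_eq (by fun_prop) (by fun_prop)
  | ih x => exact h x

lemma completion_add (f g : E →L[ℂ] F) : (f + g).completion = f.completion + g.completion :=
  completion_ext fun x => by simp [Completion.coe_add]

lemma completion_smul (c : ℂ) (f : E →L[ℂ] F) : (c • f).completion = c • f.completion :=
  completion_ext fun x => by simp [Completion.coe_smul]

lemma completion_id : (ContinuousLinearMap.id ℂ E).completion =
    ContinuousLinearMap.id ℂ (Completion E) :=
  completion_ext fun x => by simp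

lemma completion_comp (f : E →L[ℂ] F) (g : F →L[ℂ] G) :
    (g.comp f).completion = g.completion.comp f.completion :=
  completion_ext fun x => by simp

end

/-- The spaces `E` and `F` are only semi-inner product spaces, where an adjoint need not exist. Here
`g` supplies it, and the adjunction identity extends from the dense images by continuity. -/
lemma completion_eq_adjoint {E F : Type*} [SeminormedAddCommGroup E] [InnerProductSpace ℂ E]
    [SeminormedAddCommGroup F] [InnerProductSpace ℂ F] {f : E →L[ℂ] F} {g : F →L[ℂ] E}
    (h : ∀ x y, ⟪g x, y⟫_ℂ = ⟪x, f y⟫_ℂ) :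
    g.completion = ContinuousLinearMap.adjoint f.completion := by
  rw [ContinuousLinearMap.eq_adjoint_iff]
  intro x y
  induction x, y using Completion.induction_on₂ with
  | hp => exact isClosed_eq (by fun_prop) (by fun_prop)
  | ih x y => simp [h]

end Completion

/-! ### The Gelfand-Naimark-Segal construction for `C*`-categories -/

/-- A unital linear `*`-functor from a `C*`-category to Hilbert spaces and bounded linear
operators. -/
structure HilbertRep (C : Type u) [UnitalCStarCategory.{u, v} C] where
  /-- The Hilbert space attached to an object. -/
  space : C → Type v
  [normed : ∀ X, NormedAddCommGroup (space X)]
  [inner : ∀ X, InnerProductSpace ℂ (space X)]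
  [complete : ∀ X, CompleteSpace (space X)]
  /-- The action on morphisms. -/
  map : ∀ {X Y : C}, (X ⟶ Y) →ₗ[ℂ] (space X →L[ℂ] space Y)
  map_id : ∀ X : C, map (𝟙 X) = ContinuousLinearMap.id ℂ (space X)
  map_comp : ∀ {X Y Z : C} (s : X ⟶ Y) (t : Y ⟶ Z), map (s ≫ t) = (map t).comp (map s)
  map_adj : ∀ {X Y : C} (s : X ⟶ Y), map (adj s) = ContinuousLinearMap.adjoint (map s)

attribute [instance] HilbertRep.normed HilbertRep.inner HilbertRep.complete

section Representations

open ComplexConjugate ComplexOrder InnerProductSpace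

/-- A positive hermitian functional on the endomorphisms of an object. -/
structure PosFunctional {C : Type u} [UnitalCStarCategory.{u, v} C] (X : C) where
  /-- The functional. -/
  toFun : (X ⟶ X) →ₗ[ℂ] ℂ
  map_adj : ∀ g : X ⟶ X, toFun (adj g) = conj (toFun g)
  nonneg_end : ∀ g : X ⟶ X, 0 ≤ toFun (g ≫ adj g)

namespace PosFunctional

variable {C : Type u} [UnitalCStarCategory.{u, v} C] {X : C}

/-- This rests on the positivity axiom of a `C*`-category: it replaces `f` by an endomorphism of
`X`, where positivity of the functional applies. -/
lemma nonneg (φ : PosFunctional X) {Y : C} (f : X ⟶ Y) : 0 ≤ φ.toFun (f ≫ adj f) := by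
  obtain ⟨g, hg⟩ := UnitalCStarCategory.pos f
  rw [hg]
  exact φ.nonneg_end g

/-- The element `‖h‖² - h* ∘ h` is positive, hence of the form `k* ∘ k`, and `φ` is nonnegative on
the square of `f ≫ k`. This makes postcomposition with `h` bounded on the semi-inner product spaces
below. -/
lemma comp_le (φ : PosFunctional X) {Y Z : C} (f : X ⟶ Y) (h : Y ⟶ Z) :
    φ.toFun ((f ≫ h) ≫ adj (f ≫ h)) ≤ (‖h‖ ^ 2 : ℝ) * φ.toFun (f ≫ adj f) := by
  obtain ⟨k, hk⟩ : ∃ k : Y ⟶ Y, ((‖h‖ ^ 2 : ℝ) : ℂ) • 𝟙 Y - h ≫ adj h = k ≫ adj k := by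
    let := endCStarAlgebra Y
    let : PartialOrder (End Y) := CStarAlgebra.spectralOrder _
    let : StarOrderedRing (End Y) := CStarAlgebra.spectralOrderedRing _
    obtain ⟨g, hg⟩ := UnitalCStarCategory.pos h
    have hn : ‖g ≫ adj g‖ = ‖h‖ ^ 2 := by rw [← hg, norm_comp_adj]
    let G : End Y := g
    -- The order estimate lives in one algebra, so `h` is first replaced by the endomorphism `g`
    -- with the same square.
    have h1 : star G * G ≤ algebraMap ℝ (End Y) ‖star G * G‖ :=
      (IsSelfAdjoint.star_mul_self G).le_algebraMap_norm_self
    obtain ⟨k, hk⟩ := CStarAlgebra.nonneg_iff_eq_star_mul_self.1 (sub_nonneg.2 h1)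
    refine ⟨k, ?_⟩
    rw [hg, ← hn]
    refine Eq.trans ?_ hk
    rw [Algebra.algebraMap_eq_smul_one]
    rfl
  have h2 := φ.nonneg (f ≫ k)
  have h3 : (f ≫ k) ≫ adj (f ≫ k) =
      ((‖h‖ ^ 2 : ℝ) : ℂ) • (f ≫ adj f) - (f ≫ h) ≫ adj (f ≫ h) := by
    have : (f ≫ k) ≫ adj (f ≫ k) = f ≫ (k ≫ adj k) ≫ adj f := by simp
    rw [this, ← hk]
    simp
  rw [h3, map_sub, map_smul, smul_eq_mul] at h2
  exact sub_nonneg.1 h2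

/-- The morphisms from `X` to `Y` with the semi-inner product given by a positive functional. -/
@[nolint unusedArguments]
def PreSpace (_ : PosFunctional X) (Y : C) : Type v := X ⟶ Y

variable (φ : PosFunctional X) {Y Z : C}

instance : AddCommGroup (φ.PreSpace Y) := inferInstanceAs (AddCommGroup (X ⟶ Y))
instance : Module ℂ (φ.PreSpace Y) := inferInstanceAs (Module ℂ (X ⟶ Y))

/-- The semi-inner product `⟪f, g⟫ = φ (f* ∘ g)`. -/
abbrev innerCore (Y : C) : PreInnerProductSpace.Core ℂ (φ.PreSpace Y) where
  inner f g := φ.toFun (compL X Y X g (adj (C := C) (X := X) (Y := Y) f))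
  conj_inner_symm f g := by
    refine (φ.map_adj _).symm.trans (congrArg φ.toFun ?_)
    exact (adj_comp (C := C) _ _).trans (congrArg (· ≫ _) (adj_adj (C := C) _))
  re_inner_nonneg f := (RCLike.nonneg_iff.1 (φ.nonneg (Y := Y) f)).1
  add_left f g h := by
    have : adj (C := C) (X := X) (Y := Y) (f + g) = adj (C := C) (X := X) (Y := Y) f +
      adj (C := C) (X := X) (Y := Y) g := adj_add (C := C) f g
    rw [this, map_add, map_add]
  smul_left f g r := by
    have : adj (C := C) (X := X) (Y := Y) (r • f) = star r • adj (C := C) (X := X) (Y := Y) f :=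
      adj_smul (C := C) r f
    rw [this, map_smul, map_smul]
    rfl

instance : SeminormedAddCommGroup (φ.PreSpace Y) :=
  InnerProductSpace.Core.toSeminormedAddCommGroup (c := φ.innerCore Y)
instance : InnerProductSpace ℂ (φ.PreSpace Y) := InnerProductSpace.ofCore (φ.innerCore Y)

/-- A morphism as a vector. -/
def vec (f : X ⟶ Y) : φ.PreSpace Y := f

lemma inner_vec (f g : X ⟶ Y) : ⟪φ.vec f, φ.vec g⟫_ℂ = φ.toFun (g ≫ adj f) := rfl

lemma norm_vec_sq (f : X ⟶ Y) : ((‖φ.vec f‖ ^ 2 : ℝ) : ℂ) = φ.toFun (f ≫ adj f) := by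
  rw [← inner_vec, inner_self_eq_norm_sq_to_K]
  simp

lemma norm_vec_comp_le (f : X ⟶ Y) (h : Y ⟶ Z) : ‖φ.vec (f ≫ h)‖ ≤ ‖h‖ * ‖φ.vec f‖ := by
  have h1 : ((‖φ.vec (f ≫ h)‖ ^ 2 : ℝ) : ℂ) ≤ ((‖h‖ ^ 2 * ‖φ.vec f‖ ^ 2 : ℝ) : ℂ) := by
    rw [Complex.ofReal_mul, norm_vec_sq, norm_vec_sq]
    exact φ.comp_le f h
  rw [Complex.real_le_real, ← mul_pow] at h1
  exact (sq_le_sq₀ (norm_nonneg _) (by positivity)).1 h1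

/-- Postcomposition with a morphism. -/
def preMap (h : Y ⟶ Z) : φ.PreSpace Y →L[ℂ] φ.PreSpace Z :=
  LinearMap.mkContinuous (E := φ.PreSpace Y) (F := φ.PreSpace Z) ((compL X Y Z).flip h) ‖h‖
    fun f => φ.norm_vec_comp_le f h

lemma preMap_add (h k : Y ⟶ Z) : φ.preMap (h + k) = φ.preMap h + φ.preMap k :=
  ContinuousLinearMap.ext fun f => comp_add (C := C) (X := X) f h k

lemma preMap_smul (c : ℂ) (h : Y ⟶ Z) : φ.preMap (c • h) = c • φ.preMap h :=
  ContinuousLinearMap.ext fun f => comp_smul (C := C) (X := X) c f h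

lemma preMap_id (Y : C) : φ.preMap (𝟙 Y) = ContinuousLinearMap.id ℂ (φ.PreSpace Y) :=
  ContinuousLinearMap.ext fun f => Category.comp_id (X := X) (Y := Y) f

lemma preMap_comp {T : C} (h : Y ⟶ Z) (k : Z ⟶ T) :
    φ.preMap (h ≫ k) = (φ.preMap k).comp (φ.preMap h) :=
  ContinuousLinearMap.ext fun f => (Category.assoc (W := X) (X := Y) f h k).symm

/-- Both sides are the value of `φ` at `g` followed by `h` and then by the adjoint of `f`. -/
lemma inner_preMap_adj (h : Y ⟶ Z) (f : φ.PreSpace Z) (g : φ.PreSpace Y) :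
    ⟪φ.preMap (adj h) f, g⟫_ℂ = ⟪f, φ.preMap h g⟫_ℂ := by
  have key : ∀ (f : X ⟶ Z) (g : X ⟶ Y),
      φ.toFun (g ≫ adj (f ≫ adj h)) = φ.toFun ((g ≫ h) ≫ adj f) := fun f g => by simp
  exact key f g

/-- The Gelfand-Naimark-Segal representation. -/
def rep : HilbertRep.{u, v} C where
  space Y := UniformSpace.Completion (φ.PreSpace Y)
  map {Y Z} :=
    { toFun := fun h => (φ.preMap h).completion
      map_add' := fun h k => by rw [preMap_add, completion_add]
      map_smul' := fun c h => by rw [preMap_smul, completion_smul, RingHom.id_apply] }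
  map_id Y := (congrArg _ (φ.preMap_id Y)).trans completion_id
  map_comp h k := (congrArg _ (φ.preMap_comp h k)).trans (completion_comp _ _)
  map_adj h := completion_eq_adjoint (φ.inner_preMap_adj h)

lemma rep_map_vec (h : Y ⟶ Z) (f : X ⟶ Y) :
    φ.rep.map h (φ.vec f : UniformSpace.Completion (φ.PreSpace Y)) =
      (φ.vec (f ≫ h) : UniformSpace.Completion (φ.PreSpace Z)) :=
  ContinuousLinearMap.completion_apply_coe _ _

end PosFunctional

/-- The representations of a `C*`-category on Hilbert spaces determine the norm. -/
lemma exists_rep_norm_le {C : Type u} [UnitalCStarCategory.{u, v} C] {X Y : C} (a : X ⟶ Y) :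
    ∃ ρ : HilbertRep.{u, v} C, ‖a‖ ≤ ‖ρ.map a‖ := by
  -- The functional attains the norm of `a* ∘ a`, which is `‖a‖²`.
  obtain ⟨φ, h1, h2⟩ : ∃ φ : PosFunctional X, φ.toFun (𝟙 X) ≤ 1 ∧
      φ.toFun (a ≫ adj a) = ((‖a‖ ^ 2 : ℝ) : ℂ) := by
    let := endCStarAlgebra X
    let : PartialOrder (End X) := CStarAlgebra.spectralOrder _
    let : StarOrderedRing (End X) := CStarAlgebra.spectralOrderedRing _
    obtain ⟨g, hg⟩ := UnitalCStarCategory.pos a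
    have hpos : (0 : End X) ≤ show End X from a ≫ adj a := by
      rw [hg]
      exact star_mul_self_nonneg (show End X from g)
    obtain ⟨φ, h1, h2, h3, h4⟩ := exists_state _ hpos
    refine ⟨⟨φ, h1, fun g => h2 _ (star_mul_self_nonneg (show End X from g))⟩, h3, ?_⟩
    rw [← norm_comp_adj]
    exact h4
  refine ⟨φ.rep, ?_⟩
  -- The identity is the cyclic vector. Its squared norm is `φ 1`, and its image under `a` is the
  -- vector of `a`, whose squared norm is `φ (a* ∘ a) = ‖a‖²`.
  have h3 : ‖φ.vec (𝟙 X)‖ ≤ 1 := by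
    have := φ.norm_vec_sq (𝟙 X)
    rw [adj_id, Category.comp_id] at this
    rw [← this] at h1
    have h4 : ‖φ.vec (𝟙 X)‖ ^ 2 ≤ 1 := by exact_mod_cast h1
    exact (sq_le_one_iff₀ (norm_nonneg _)).1 h4
  have h4 : ‖φ.vec a‖ = ‖a‖ := by
    have := φ.norm_vec_sq a
    rw [h2] at this
    exact (sq_eq_sq₀ (norm_nonneg _) (norm_nonneg _)).1 (by exact_mod_cast this)
  have h5 := (φ.rep.map a).le_opNorm (φ.vec (𝟙 X) : UniformSpace.Completion (φ.PreSpace X))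
  rw [φ.rep_map_vec, Category.id_comp] at h5
  rw [← h4]
  refine (UniformSpace.Completion.norm_coe (φ.vec a)).symm.trans_le (h5.trans ?_)
  refine (mul_le_mul_of_nonneg_left ?_ (norm_nonneg _)).trans_eq (mul_one _)
  exact (UniformSpace.Completion.norm_coe (φ.vec (𝟙 X))).trans_le h3

/-- This is the source of the uniform bounds: any natural family of isometries is a bounded
transformation, whatever the index set. The norm may be zero, when `X` is a zero object. -/
lemma norm_le_one_of_comp_adj {C : Type u} [PreCStarCategory.{u, v} C] {X Y : C} {i : X ⟶ Y}
    (h : i ≫ adj i = 𝟙 X) : ‖i‖ ≤ 1 := by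
  have h1 : ‖i‖ ^ 2 ≤ 1 := by rw [← norm_comp_adj, h]; exact norm_id_le X
  exact (sq_le_one_iff₀ (norm_nonneg _)).1 h1

/-- The isomorphism given by a unitary morphism. -/
def unitaryIso {C : Type u} [PreCStarCategory.{u, v} C] {X Y : C} (i : X ⟶ Y)
    (h₁ : i ≫ adj i = 𝟙 X) (h₂ : adj i ≫ i = 𝟙 Y) : X ≅ Y where
  hom := i
  inv := adj i
  hom_inv_id := h₁
  inv_hom_id := h₂

end Representations

/-! ### Unitary equivalences and their inverses -/

namespace StarFunctor

variable {C : Type u₁} [UnitalCStarCategory.{u₁, v₁} C] {D : Type u₂}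
  [UnitalCStarCategory.{u₂, v₂} D] {E : Type u₃} [UnitalCStarCategory.{u₃, v₃} E]

/-- A unital linear `*`-functor which is fully faithful and surjective on objects up to unitary
isomorphism. -/
structure IsUnitaryEquivalence (F : StarFunctor C D) : Prop where
  faithful : ∀ {X Y : C} (f g : X ⟶ Y), F.map f = F.map g → f = g
  full : ∀ {X Y : C} (g : F.obj X ⟶ F.obj Y), ∃ f, F.map f = g
  surj : ∀ Y : D, ∃ (X : C) (i : F.obj X ⟶ Y), i ≫ adj i = 𝟙 _ ∧ adj i ≫ i = 𝟙 Y

lemma IsUnitaryEquivalence.comp {F : StarFunctor C D} {G : StarFunctor D E}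
    (hF : F.IsUnitaryEquivalence) (hG : G.IsUnitaryEquivalence) :
    (F.comp G).IsUnitaryEquivalence where
  faithful f g h := hF.faithful f g (hG.faithful _ _ h)
  full g := by
    obtain ⟨f, hf⟩ := hG.full g
    obtain ⟨f', rfl⟩ := hF.full f
    exact ⟨f', hf⟩
  surj Z := by
    obtain ⟨Y, j, hj, hj'⟩ := hG.surj Z
    obtain ⟨X, i, hi, hi'⟩ := hF.surj Y
    have h₁ : (G.map i ≫ j) ≫ adj (G.map i ≫ j) = 𝟙 (G.obj (F.obj X)) := by
      rw [adj_comp, Category.assoc, ← Category.assoc j, hj, Category.id_comp, ← G.map_adj,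
        ← G.map_comp, hi, G.map_id]
    have h₂ : adj (G.map i ≫ j) ≫ G.map i ≫ j = 𝟙 Z := by
      rw [adj_comp, Category.assoc, ← Category.assoc _ (G.map i), ← G.map_adj,
        ← G.map_comp, hi', G.map_id, Category.id_comp, hj']
    exact ⟨X, G.map i ≫ j, h₁, h₂⟩

/-- Choose a unitary `i Y` from an object in the image of `F` to each `Y`, and let `G f` be the
preimage of the conjugate of `f` by these unitaries. Unitarity of `i`, not just invertibility, makes
`G` a `*`-functor and bounds the two comparison isomorphisms. -/
lemma IsUnitaryEquivalence.exists_inverse {F : StarFunctor C D} (hF : F.IsUnitaryEquivalence) :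
    ∃ G : StarFunctor D C, Nonempty (id C ≅ F.comp G) ∧ Nonempty (G.comp F ≅ id D) := by
  choose o i hi hi' using hF.surj
  choose p hp using fun X Y => hF.full (X := X) (Y := Y)
  have ext : ∀ {X Y : C} {f g : X ⟶ Y}, F.map f = F.map g → f = g := hF.faithful _ _
  have hi'' : ∀ {Y : D} {Z : D} (f : Y ⟶ Z), adj (i Y) ≫ i Y ≫ f = f := fun f => by
    rw [← Category.assoc, hi', Category.id_comp]
  let G : StarFunctor D C :=
    { obj := o
      map := fun {Y Z} f => p _ _ (i Y ≫ f ≫ adj (i Z))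
      map_id := fun Y => ext (by simp [hp, hi])
      map_comp := fun f g => ext (by simp [hp, hi''])
      map_add := fun f g => ext (by simp [hp])
      map_smul := fun c f => ext (by simp [hp])
      map_adj := fun f => ext (by simp [hp]) }
  have hG : ∀ {Y Z : D} (f : Y ⟶ Z), F.map (G.map f) = i Y ≫ f ≫ adj (i Z) := fun f => hp _ _ _
  -- The unit is the preimage of the adjoint of the chosen unitary at `F X`; faithfulness lets
  -- unitarity and naturality be checked after applying `F`.
  let q : ∀ X : C, X ⟶ o (F.obj X) := fun X => p X (o (F.obj X)) (adj (i (F.obj X)))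
  have hq : ∀ X, F.map (q X) = adj (i (F.obj X)) := fun X => hp _ _ _
  have hq₁ : ∀ X, q X ≫ adj (q X) = 𝟙 X := fun X =>
    ext (by rw [F.map_comp, F.map_adj, hq, adj_adj, hi', F.map_id])
  have hq₂ : ∀ X, adj (q X) ≫ q X = 𝟙 (o (F.obj X)) := fun X =>
    ext (by rw [F.map_comp, F.map_adj, hq, adj_adj, hi, F.map_id])
  refine ⟨G, ⟨unitaryIso (mkNat (F := id C) (G := F.comp G) q 1 (fun X => ?_)
    fun {X Y} f => ext ?_) (nat_ext hq₁) (nat_ext hq₂)⟩,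
    ⟨unitaryIso (mkNat (F := G.comp F) (G := id D) i 1 (fun Y => ?_) fun {Y Z} f => ?_)
    (nat_ext hi) (nat_ext hi')⟩⟩
  · exact norm_le_one_of_comp_adj (hq₁ X)
  · change F.map (f ≫ q Y) = F.map (q X ≫ G.map (F.map f))
    rw [F.map_comp, F.map_comp, hq, hq, hG, hi'']
  · exact norm_le_one_of_comp_adj (hi Y)
  · change F.map (G.map f) ≫ i Z = i Y ≫ f
    rw [hG, Category.assoc, Category.assoc, hi', Category.comp_id]

end StarFunctor

/-! ### The universal property of the subobject completion -/

namespace SubobjectCompletion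

variable {C : Type u₁} [UnitalCStarCategory.{u₁, v₁} C] {D : Type u₂}
  [UnitalCStarCategory.{u₂, v₂} D]

/-- The canonical functor to the subobject completion. -/
def of (C : Type u₁) [UnitalCStarCategory.{u₁, v₁} C] : StarFunctor C (SubobjectCompletion C) where
  obj X := ⟨X, 𝟙 X, Category.id_comp _, adj_id X⟩
  map {X Y} f := mkHom (X := ⟨X, 𝟙 X, Category.id_comp _, adj_id X⟩)
    (Y := ⟨Y, 𝟙 Y, Category.id_comp _, adj_id Y⟩) f (Category.id_comp f) (Category.comp_id f)
  map_id _ := rfl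
  map_comp _ _ := rfl
  map_add _ _ := rfl
  map_smul _ _ := rfl
  map_adj _ := rfl

@[simp] lemma val_of_map {X Y : C} (f : X ⟶ Y) : val ((of C).map f) = f := rfl

/-- The inclusion of a subobject. -/
def incl (X : SubobjectCompletion C) : X ⟶ (of C).obj X.obj :=
  mkHom (Y := (of C).obj X.obj) X.proj X.idem (Category.comp_id _)

lemma incl_comp_adj (X : SubobjectCompletion C) : X.incl ≫ adj X.incl = 𝟙 X :=
  hom_ext ((congrArg (X.proj ≫ ·) X.selfAdj).trans X.idem)

/-- Taking underlying morphisms is not a unital functor, since the identity of `(X, p)` has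
underlying morphism `p`. This intertwining relation and its adjoint form replace functoriality when
transformations are extended from `C`. -/
lemma comp_incl {X Y : SubobjectCompletion C} (f : X ⟶ Y) :
    f ≫ Y.incl = X.incl ≫ (of C).map (val f) :=
  hom_ext ((val_proj f).trans (proj_val f).symm)

lemma of_comp_adj_incl {X Y : SubobjectCompletion C} (f : X ⟶ Y) :
    (of C).map (val f) ≫ adj Y.incl = adj X.incl ≫ f :=
  hom_ext ((congrArg (val f ≫ ·) Y.selfAdj).trans ((val_proj f).trans
    ((proj_val f).symm.trans (congrArg (· ≫ val f) X.selfAdj.symm))))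

/-- The value at `(X, p)` is a splitting of the projection `K p`, available because `D` is subobject
complete, and morphisms are compressed by the splitting isometries. -/
lemma exists_extension [IsFinitelyAdditive D] (K : StarFunctor C D) :
    ∃ (L : StarFunctor (SubobjectCompletion C) D) (i : ∀ X, L.obj X ⟶ K.obj X.obj),
      (∀ X, i X ≫ adj (i X) = 𝟙 _) ∧ (∀ X, adj (i X) ≫ i X = K.map X.proj) ∧
      ∀ {X Y} (f : X ⟶ Y), L.map f = i X ≫ K.map (val f) ≫ adj (i Y) := by
  choose o i hi hi' using fun X : SubobjectCompletion C =>
    IsFinitelyAdditive.exists_split (K.obj X.obj) (K.map X.proj)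
      (by rw [← K.map_comp, idem]) (by rw [← K.map_adj, selfAdj])
  -- The range projection of `i Y` is the image of the projection of `Y`, which the underlying
  -- morphism of `f` absorbs; multiplicativity follows.
  have key : ∀ {X Y : SubobjectCompletion C} (f : X ⟶ Y) {T : D} (g : K.obj Y.obj ⟶ T),
      K.map (val f) ≫ adj (i Y) ≫ i Y ≫ g = K.map (val f) ≫ g := fun {X Y} f T g => by
    rw [← Category.assoc (adj _), hi', ← Category.assoc, ← K.map_comp, val_proj]
  have key' : ∀ X, i X ≫ K.map X.proj = i X := fun X => by
    rw [← hi', ← Category.assoc, hi, Category.id_comp]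
  exact ⟨{  obj := o
            map := fun {X Y} f => i X ≫ K.map (val f) ≫ adj (i Y)
            map_id := fun X => by rw [val_id, ← Category.assoc, key', hi]
            map_comp := fun f g => by simp [key]
            map_add := fun f g => by simp
            map_smul := fun c f => by simp
            map_adj := fun f => by simp }, i, hi, hi', fun _ => rfl⟩

/-- Every `(X, p)` is a subobject of `(X, 1)`. Hence a transformation is recovered by compressing
its components at the objects `(X, 1)`, and any transformation on `C` extends by the same
compression. Surjectivity is `exists_extension`. -/
lemma isUnitaryEquivalence_of [IsFinitelyAdditive D] :
    (StarFunctor.whisker (of C) (StarFunctor.id D)).IsUnitaryEquivalence where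
  faithful {K L} σ τ h := StarFunctor.nat_ext fun X => by
    have key : ∀ σ : K ⟶ L, StarFunctor.app σ X =
        K.map X.incl ≫ StarFunctor.app σ ((of C).obj X.obj) ≫ L.map (adj X.incl) := fun σ => by
      rw [← StarFunctor.naturality, ← Category.assoc, ← K.map_comp, incl_comp_adj, K.map_id,
        Category.id_comp]
    have h' : StarFunctor.app σ ((of C).obj X.obj) = StarFunctor.app τ ((of C).obj X.obj) :=
      congrArg (fun σ => StarFunctor.app σ X.obj) h
    rw [key σ, key τ, h']
  full {K L} σ := by
    let s : ∀ X : C, K.obj ((of C).obj X) ⟶ L.obj ((of C).obj X) := fun X => StarFunctor.app σ X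
    have hs : ∀ {X Y : C} (f : X ⟶ Y), K.map ((of C).map f) ≫ s Y = s X ≫ L.map ((of C).map f) :=
      fun f => StarFunctor.naturality σ f
    have hi : ∀ X : SubobjectCompletion C, ‖X.incl‖ ≤ 1 := fun X =>
      norm_le_one_of_comp_adj X.incl_comp_adj
    refine ⟨StarFunctor.mkNat (fun X => K.map X.incl ≫ s X.obj ≫ L.map (adj X.incl)) ‖σ‖
      (fun X => ?_) (fun {X Y} f => ?_), StarFunctor.nat_ext fun X => ?_⟩
    · refine (norm_comp_le _ _).trans ((mul_le_mul ((K.norm_map_le _).trans (hi X))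
        ((norm_comp_le _ _).trans (mul_le_mul (StarFunctor.norm_app_le σ X.obj)
          ((L.norm_map_le _).trans ((norm_adj _).trans_le (hi X))) (norm_nonneg _)
          (norm_nonneg _))) (norm_nonneg _) zero_le_one).trans_eq (by ring))
    · rw [← Category.assoc, ← K.map_comp, comp_incl, K.map_comp, Category.assoc,
        ← Category.assoc _ (s Y.obj), hs, Category.assoc, ← L.map_comp, of_comp_adj_incl,
        L.map_comp, Category.assoc, Category.assoc]
    -- The inclusion of `(X, 1)` is an identity, so the compression changes nothing there.
    · change K.map (𝟙 ((of C).obj X)) ≫ s X ≫ L.map (adj (𝟙 ((of C).obj X))) = s X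
      rw [adj_id, K.map_id, L.map_id, Category.comp_id, Category.id_comp]
  surj K := by
    obtain ⟨L, i, hi, hi', hL⟩ := exists_extension K
    -- At `(X, 1)` the split projection is `K 1 = 1`, so the isometry is unitary.
    have hi₂ : ∀ X, adj (i ((of C).obj X)) ≫ i ((of C).obj X) = 𝟙 (K.obj X) := fun X =>
      (hi' _).trans (K.map_id X)
    refine ⟨L, StarFunctor.mkNat (fun X => i ((of C).obj X)) 1
      (fun X => norm_le_one_of_comp_adj (hi _)) (fun {X Y} f => ?_),
      StarFunctor.nat_ext fun X => hi _, StarFunctor.nat_ext hi₂⟩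
    change L.map ((of C).map f) ≫ i ((of C).obj Y) = i ((of C).obj X) ≫ K.map f
    rw [hL, Category.assoc, Category.assoc, hi₂, val_of_map]
    exact congrArg _ (Category.comp_id _)

end SubobjectCompletion

/-! ### Currying for the maximal tensor product -/

namespace MaxTensor

variable {U V W : Type u} [UnitalCStarCategory.{u, u} U] [UnitalCStarCategory.{u, u} V]
  [UnitalCStarCategory.{u, u} W]

section Uncurry

variable (H : StarFunctor U (StarFunctor V W))

/-- The action on objects of a functor in two variables. -/
@[reducible] def uncurryObj (X : MaxTensor U V) : W := (H.obj X.fst).obj X.snd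

/-- The action on algebraic tensors of a functor in two variables. -/
def uncurryAlg (X Y : MaxTensor U V) :
    AlgTensor X Y →ₗ[ℂ] (uncurryObj H X ⟶ uncurryObj H Y) :=
  TensorProduct.lift (LinearMap.mk₂ ℂ
    (fun (f : X.fst ⟶ Y.fst) (g : X.snd ⟶ Y.snd) =>
      StarFunctor.app (H.map f) X.snd ≫ (H.obj Y.fst).map g)
    (fun f f' g => by simp) (fun c f g => by simp) (fun f g g' => by simp)
    (fun c f g => by simp))

lemma uncurryAlg_tmul {X Y : MaxTensor U V} (f : X.fst ⟶ Y.fst) (g : X.snd ⟶ Y.snd) :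
    uncurryAlg H X Y (AlgTensor.tmul f g) =
      StarFunctor.app (H.map f) X.snd ≫ (H.obj Y.fst).map g := rfl

lemma uncurryAlg_id (X : MaxTensor U V) : uncurryAlg H X X (AlgTensor.id X) = 𝟙 _ := by
  rw [AlgTensor.id, uncurryAlg_tmul, H.map_id, CategoryTheory.Functor.map_id, Category.comp_id]
  rfl

/-- On elementary tensors this is the interchange law: naturality of the transformation `H f` moves
it past the image of the morphism in the second variable. -/
lemma uncurryAlg_comp {X Y Z : MaxTensor U V} (s : AlgTensor X Y) (t : AlgTensor Y Z) :
    uncurryAlg H X Z (AlgTensor.comp X Y Z s t) = uncurryAlg H X Y s ≫ uncurryAlg H Y Z t := by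
  induction t using AlgTensor.induction with
  | h0 => simp
  | ha t t' h h' => simp only [map_add, comp_add, h, h']
  | ht f g =>
    induction s using AlgTensor.induction with
    | h0 => simp
    | ha t t' h h' => simp only [map_add, LinearMap.add_apply, add_comp, h, h']
    | ht f' g' =>
      rw [AlgTensor.comp_tmul, uncurryAlg_tmul, uncurryAlg_tmul, uncurryAlg_tmul, H.map_comp,
        StarFunctor.app_comp, Functor.map_comp, Category.assoc, Category.assoc,
        ← Category.assoc ((H.obj Y.fst).map g'), StarFunctor.naturality, Category.assoc]

/-- Taking adjoints reverses the order of the two factors of an elementary tensor, and naturality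
restores it. -/
lemma uncurryAlg_adj {X Y : MaxTensor U V} (s : AlgTensor X Y) :
    uncurryAlg H Y X (AlgTensor.adj X Y s) = adj (uncurryAlg H X Y s) := by
  induction s using AlgTensor.induction with
  | h0 => simp
  | ha t t' h h' => simp only [map_add, adj_add, h, h']
  | ht f g =>
    rw [AlgTensor.adj_tmul, uncurryAlg_tmul, uncurryAlg_tmul, adj_comp, H.map_adj,
      ← StarFunctor.naturality, StarFunctor.map_adj, StarFunctor.app_adj]

/-- A representation of `W` that does not decrease the norm of the image of `s`, pulled back along
`H`, is a representation of the algebraic tensor product and is therefore dominated by the maximal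
norm. -/
lemma norm_uncurryAlg_le {X Y : MaxTensor U V} (s : AlgTensor X Y) :
    ‖uncurryAlg H X Y s‖ ≤ 1 * ‖s‖ := by
  obtain ⟨ρ, hρ⟩ := exists_rep_norm_le (uncurryAlg H X Y s)
  -- The Hilbert spaces of `ρ` live in the universe of the morphisms of `W`, as required of the
  -- representations in the supremum.
  let π : TensorRep U V :=
    { space := fun X => ρ.space (uncurryObj H X)
      map := fun {X Y} => ρ.map.comp (uncurryAlg H X Y)
      map_id := fun X => (congrArg ρ.map (uncurryAlg_id H X)).trans (ρ.map_id _)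
      map_comp := fun s t => (congrArg ρ.map (uncurryAlg_comp H s t)).trans (ρ.map_comp _ _)
      map_adj := fun s => (congrArg ρ.map (uncurryAlg_adj H s)).trans (ρ.map_adj _) }
  rw [one_mul]
  exact hρ.trans (AlgTensor.le_maxNorm s π)

/-- The action on morphisms of the maximal tensor product of a functor in two variables. -/
def uncurryHom (X Y : MaxTensor U V) : (X ⟶ Y) →L[ℂ] (uncurryObj H X ⟶ uncurryObj H Y) :=
  MaxHom.lift ((uncurryAlg H X Y).mkContinuous 1 (norm_uncurryAlg_le H))

lemma uncurryHom_of {X Y : MaxTensor U V} (s : AlgTensor X Y) :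
    uncurryHom H X Y (MaxHom.of X Y s) = uncurryAlg H X Y s := MaxHom.lift_of _ _

/-- The functor on the maximal tensor product given by a functor in two variables. -/
def uncurry : StarFunctor (MaxTensor U V) W where
  obj := uncurryObj H
  map {X Y} x := uncurryHom H X Y x
  map_id X := (uncurryHom_of H _).trans (uncurryAlg_id H X)
  map_comp {X Y Z} x y := by
    induction x using MaxHom.induction with
    | hp =>
      exact isClosed_eq ((uncurryHom H X Z).continuous.comp (continuous_comp_right y))
        ((continuous_comp_right _).comp (uncurryHom H X Y).continuous)
    | h s =>
      induction y using MaxHom.induction with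
      | hp =>
        exact isClosed_eq ((uncurryHom H X Z).continuous.comp (continuous_comp_left _))
          ((continuous_comp_left _).comp (uncurryHom H Y Z).continuous)
      | h t =>
        refine (congrArg (uncurryHom H X Z) (MaxHom.comp_of s t)).trans ?_
        rw [uncurryHom_of, uncurryHom_of, uncurryHom_of, uncurryAlg_comp]
  map_add {X Y} x y := (uncurryHom H X Y).map_add x y
  map_smul {X Y} c x := (uncurryHom H X Y).map_smul c x
  map_adj {X Y} x := by
    induction x using MaxHom.induction with
    | hp =>
      exact isClosed_eq ((uncurryHom H Y X).continuous.comp continuous_adj)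
        (continuous_adj.comp (uncurryHom H X Y).continuous)
    | h s =>
      refine (congrArg (uncurryHom H Y X) (MaxHom.adj_of s)).trans ?_
      rw [uncurryHom_of, uncurryHom_of, uncurryAlg_adj]

lemma uncurry_tmul {X Y : MaxTensor U V} (f : X.fst ⟶ Y.fst) (g : X.snd ⟶ Y.snd) :
    (uncurry H).map (tmul f g) = StarFunctor.app (H.map f) X.snd ≫ (H.obj Y.fst).map g :=
  uncurryHom_of H _

end Uncurry

section Curry

lemma tmul_add {X Y : MaxTensor U V} (f : X.fst ⟶ Y.fst) (g g' : X.snd ⟶ Y.snd) :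
    tmul f (g + g') = tmul f g + tmul f g' := (tmulL X Y f).map_add g g'
lemma tmul_smul {X Y : MaxTensor U V} (c : ℂ) (f : X.fst ⟶ Y.fst) (g : X.snd ⟶ Y.snd) :
    tmul f (c • g) = c • tmul f g := (tmulL X Y f).map_smul c g
lemma add_tmul {X Y : MaxTensor U V} (f f' : X.fst ⟶ Y.fst) (g : X.snd ⟶ Y.snd) :
    tmul (f + f') g = tmul f g + tmul f' g := (tmulL X Y).map_add₂ f f' g
lemma smul_tmul {X Y : MaxTensor U V} (c : ℂ) (f : X.fst ⟶ Y.fst) (g : X.snd ⟶ Y.snd) :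
    tmul (c • f) g = c • tmul f g := (tmulL X Y).map_smul₂ c f g

/-- The functor `V ⟶ U ⊗ V`, `B ↦ (A, B)`. -/
def sliceRight (A : U) : StarFunctor V (MaxTensor U V) where
  obj B := ⟨A, B⟩
  map {B B'} g := tmul (X := ⟨A, B⟩) (Y := ⟨A, B'⟩) (𝟙 A) g
  map_id B := tmul_id ⟨A, B⟩
  map_comp {B B' B''} g g' := by
    rw [tmul_comp (X := ⟨A, B⟩) (Y := ⟨A, B'⟩) (Z := ⟨A, B''⟩), Category.comp_id]
  map_add {B B'} g g' := tmul_add (X := ⟨A, B⟩) (Y := ⟨A, B'⟩) (𝟙 A) g g'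
  map_smul {B B'} c g := tmul_smul (X := ⟨A, B⟩) (Y := ⟨A, B'⟩) c (𝟙 A) g
  map_adj {B B'} g := by
    rw [adj_tmul (X := ⟨A, B⟩) (Y := ⟨A, B'⟩), adj_id]

/-- The functor `U ⟶ C*lin(V, U ⊗ V)` given by the maximal tensor product. -/
def slice (U V : Type u) [UnitalCStarCategory.{u, u} U] [UnitalCStarCategory.{u, u} V] :
    StarFunctor U (StarFunctor V (MaxTensor U V)) where
  obj := sliceRight
  map {A A'} f := StarFunctor.mkNat (F := sliceRight A) (G := sliceRight A')
    (fun B => tmul (X := ⟨A, B⟩) (Y := ⟨A', B⟩) f (𝟙 B)) ‖f‖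
    (fun B => (norm_tmul_le _ _).trans ((mul_le_mul_of_nonneg_left (norm_id_le B)
      (norm_nonneg _)).trans_eq (mul_one _)))
    (fun {B B'} g => by
      change tmul (X := ⟨A, B⟩) (Y := ⟨A, B'⟩) (𝟙 A) g ≫ tmul (Y := ⟨A', B'⟩) f (𝟙 B') =
        tmul (X := ⟨A, B⟩) (Y := ⟨A', B⟩) f (𝟙 B) ≫ tmul (Y := ⟨A', B'⟩) (𝟙 A') g
      rw [tmul_comp, tmul_comp, Category.id_comp, Category.id_comp, Category.comp_id,
        Category.comp_id])
  map_id A := StarFunctor.nat_ext fun B => tmul_id ⟨A, B⟩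
  map_comp {A A' A''} f f' := StarFunctor.nat_ext fun B =>
    (congrArg (tmul (X := ⟨A, B⟩) (Y := ⟨A'', B⟩) (f ≫ f')) (Category.id_comp (𝟙 B)).symm).trans
      (tmul_comp (X := ⟨A, B⟩) (Y := ⟨A', B⟩) (Z := ⟨A'', B⟩) f (𝟙 B) f' (𝟙 B)).symm
  map_add {A A'} f f' := StarFunctor.nat_ext fun B =>
    add_tmul (X := ⟨A, B⟩) (Y := ⟨A', B⟩) f f' _
  map_smul {A A'} c f := StarFunctor.nat_ext fun B =>
    smul_tmul (X := ⟨A, B⟩) (Y := ⟨A', B⟩) c f _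
  map_adj {A A'} f := StarFunctor.nat_ext fun B =>
    (congrArg (tmul (X := ⟨A', B⟩) (Y := ⟨A, B⟩) (adj f)) (adj_id B).symm).trans
      (adj_tmul (X := ⟨A, B⟩) (Y := ⟨A', B⟩) f (𝟙 B)).symm

/-- The functor in two variables given by a functor on the maximal tensor product. -/
def curryObj (K : StarFunctor (MaxTensor U V) W) : StarFunctor U (StarFunctor V W) :=
  (slice U V).comp (StarFunctor.whisker (StarFunctor.id V) K)

/-- The functor `C*lin(U ⊗ V, W) ⟶ C*lin(U, C*lin(V, W))`. -/
def curry (U V W : Type u) [UnitalCStarCategory.{u, u} U] [UnitalCStarCategory.{u, u} V]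
    [UnitalCStarCategory.{u, u} W] :
    StarFunctor (StarFunctor (MaxTensor U V) W) (StarFunctor U (StarFunctor V W)) where
  obj := curryObj
  map {K L} τ := StarFunctor.mkNat (F := curryObj K) (G := curryObj L)
    (fun A => StarFunctor.mkNat (F := (curryObj K).obj A) (G := (curryObj L).obj A)
      (fun B => StarFunctor.app τ ⟨A, B⟩) ‖τ‖ (fun _ => StarFunctor.norm_app_le τ _)
      (fun _ => StarFunctor.naturality τ _))
    ‖τ‖ (fun _ => StarFunctor.norm_nat_le _ (norm_nonneg _) fun _ => StarFunctor.norm_app_le τ _)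
    (fun _ => StarFunctor.nat_ext fun _ => StarFunctor.naturality τ _)
  map_id _ := rfl
  map_comp _ _ := rfl
  map_add _ _ := rfl
  map_smul _ _ := rfl
  map_adj _ := rfl

/-- Elementary tensors are products of morphisms that vary in one variable only, which reduces
questions about pairs to each variable separately. -/
lemma tmul_eq_comp {X Y : MaxTensor U V} (f : X.fst ⟶ Y.fst) (g : X.snd ⟶ Y.snd) :
    tmul f g = tmul (Y := ⟨Y.fst, X.snd⟩) f (𝟙 X.snd) ≫
      tmul (X := ⟨Y.fst, X.snd⟩) (𝟙 Y.fst) g := by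
  rw [tmul_comp, Category.id_comp, Category.comp_id]

/-- A family of morphisms which is natural for elementary tensors in each variable is natural. -/
lemma naturality_of_tmul {K L : StarFunctor (MaxTensor U V) W}
    (τ : ∀ X, K.obj X ⟶ L.obj X)
    (h₁ : ∀ {A A' : U} (f : A ⟶ A') (B : V),
      K.map (tmul (X := ⟨A, B⟩) (Y := ⟨A', B⟩) f (𝟙 B)) ≫ τ ⟨A', B⟩ =
        τ ⟨A, B⟩ ≫ L.map (tmul (X := ⟨A, B⟩) (Y := ⟨A', B⟩) f (𝟙 B)))
    (h₂ : ∀ (A : U) {B B' : V} (g : B ⟶ B'),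
      K.map (tmul (X := ⟨A, B⟩) (Y := ⟨A, B'⟩) (𝟙 A) g) ≫ τ ⟨A, B'⟩ =
        τ ⟨A, B⟩ ≫ L.map (tmul (X := ⟨A, B⟩) (Y := ⟨A, B'⟩) (𝟙 A) g))
    {X Y : MaxTensor U V} (x : X ⟶ Y) : K.map x ≫ τ Y = τ X ≫ L.map x := by
  -- A `*`-functor is contractive, hence continuous on morphisms, so naturality is a closed
  -- condition and may be tested on elementary tensors.
  have hc : ∀ K : StarFunctor (MaxTensor U V) W, Continuous fun x : X ⟶ Y => K.map x := fun K =>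
    ((K.mapL X Y).mkContinuous 1 fun x => (K.norm_map_le x).trans_eq (one_mul _).symm).continuous
  induction x using hom_induction with
  | hp =>
    exact isClosed_eq ((continuous_comp_right (τ Y)).comp (hc K))
      ((continuous_comp_left (τ X)).comp (hc L))
  | h0 => simp
  | ha x y hx hy => rw [K.map_add, L.map_add, add_comp, comp_add, hx, hy]
  | ht f g =>
    rw [tmul_eq_comp, K.map_comp, L.map_comp, Category.assoc, h₂, ← Category.assoc, h₁,
      Category.assoc]

/-- Currying leaves components unchanged, so it is faithful. It is full because separate naturality
implies joint naturality. The functor `uncurry H` is a preimage of `H` up to a unitary with identity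
components. -/
lemma isUnitaryEquivalence_curry : (curry U V W).IsUnitaryEquivalence where
  faithful {K L} σ τ h := StarFunctor.nat_ext fun X =>
    congrArg (fun σ => StarFunctor.app (StarFunctor.app σ X.fst) X.snd) h
  full {K L} σ := by
    let s : ∀ X : MaxTensor U V, K.obj X ⟶ L.obj X := fun X =>
      StarFunctor.app (StarFunctor.app σ X.fst) X.snd
    exact ⟨StarFunctor.mkNat s ‖σ‖
      (fun X => (StarFunctor.norm_app_le _ _).trans (StarFunctor.norm_app_le σ _))
      (fun x => naturality_of_tmul s
        (fun f B => congrArg (fun τ => StarFunctor.app τ B) (StarFunctor.naturality σ f))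
        (fun A _ _ g => StarFunctor.naturality (StarFunctor.app σ A) g) x), rfl⟩
  surj H := by
    -- Restricting `uncurry H` to one variable returns `H`, apart from a factor that is the image of
    -- an identity.
    have h₁ : ∀ {A A' : U} (f : A ⟶ A') (B : V), (uncurry H).map
        (tmul (X := ⟨A, B⟩) (Y := ⟨A', B⟩) f (𝟙 B)) = StarFunctor.app (H.map f) B := fun f B =>
      (uncurry_tmul H (X := ⟨_, B⟩) (Y := ⟨_, B⟩) f (𝟙 B)).trans
        ((congrArg _ ((H.obj _).map_id B)).trans (Category.comp_id _))
    have h₂ : ∀ (A : U) {B B' : V} (g : B ⟶ B'), (uncurry H).map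
        (tmul (X := ⟨A, B⟩) (Y := ⟨A, B'⟩) (𝟙 A) g) = (H.obj A).map g := fun A B B' g =>
      (uncurry_tmul H (X := ⟨A, B⟩) (Y := ⟨A, B'⟩) (𝟙 A) g).trans
        ((congrArg (fun τ => StarFunctor.app τ B ≫ (H.obj A).map g) (H.map_id A)).trans
          (Category.id_comp _))
    refine ⟨uncurry H, StarFunctor.mkNat (F := curryObj (uncurry H)) (G := H)
      (fun A => StarFunctor.mkNat (F := (curryObj (uncurry H)).obj A) (G := H.obj A)
        (fun B => 𝟙 ((H.obj A).obj B)) 1 (fun B => norm_id_le _)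
        (fun g => (Category.comp_id _).trans ((h₂ A g).trans (Category.id_comp _).symm))) 1
      (fun A => StarFunctor.norm_nat_le _ zero_le_one fun B => norm_id_le _)
      (fun f => StarFunctor.nat_ext fun B =>
        (Category.comp_id _).trans ((h₁ f B).trans (Category.id_comp _).symm)),
      StarFunctor.nat_ext fun A => StarFunctor.nat_ext fun B => ?_,
      StarFunctor.nat_ext fun A => StarFunctor.nat_ext fun B => ?_⟩
    · exact (Category.id_comp _).trans (adj_id _)
    · exact (Category.comp_id _).trans (adj_id _)

end Curry

end MaxTensor

/-! ### The comparison unitary for functors between subobject completions -/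

namespace SubobjectCompletion

variable {C : Type u₁} [UnitalCStarCategory.{u₁, v₁} C] {D : Type u₂}
  [UnitalCStarCategory.{u₂, v₂} D]

/-- The canonical isomorphism between the two composites of `F` and `map F` with the canonical
functors to the subobject completions. -/
def mapOf (F : StarFunctor C D) (X : C) :
    (map F).obj ((of C).obj X) ⟶ (of D).obj (F.obj X) :=
  incl ((map F).obj ((of C).obj X))

lemma mapOf_comp_adj (F : StarFunctor C D) (X : C) : mapOf F X ≫ adj (mapOf F X) = 𝟙 _ :=
  incl_comp_adj _

/-- The source carries the projection `F 1` and the target `1`. These agree because `F` is unital,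
so the isometry `incl` is unitary here. -/
lemma adj_mapOf_comp (F : StarFunctor C D) (X : C) : adj (mapOf F X) ≫ mapOf F X = 𝟙 _ :=
  hom_ext ((congrArg (fun f : F.obj X ⟶ F.obj X => adj f ≫ f) (F.map_id X)).trans
    ((Category.comp_id _).trans (adj_id _)))

lemma mapOf_naturality (F : StarFunctor C D) {X Y : C} (f : X ⟶ Y) :
    (map F).map ((of C).map f) ≫ mapOf F Y = mapOf F X ≫ (of D).map (F.map f) :=
  comp_incl ((map F).map ((of C).map f))

lemma norm_mapOf_le (F : StarFunctor C D) (X : C) : ‖mapOf F X‖ ≤ 1 :=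
  norm_le_one_of_comp_adj (mapOf_comp_adj F X)

end SubobjectCompletion

/-! ### The currying functor and its comparison cells -/

namespace CStarLin

open Bicategory Opposite Bicategory.Opposite

variable {U U' U'' V V' V'' W W' : CStarLin.{u}}

/-- The functor `C*lin(U ⊠ V, W) ⟶ C*lin(U, C*lin(V, W))`. -/
def curry (U V W : CStarLin.{u}) : ihom (tensor U V) W ⟶ ihom U (ihom V W) :=
  (StarFunctor.whisker (SubobjectCompletion.of (MaxTensor U.carrier V.carrier))
    (StarFunctor.id W.carrier)).comp (MaxTensor.curry U.carrier V.carrier W.carrier)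

lemma isUnitaryEquivalence_curry (U V W : CStarLin.{u}) :
    StarFunctor.IsUnitaryEquivalence (curry U V W) :=
  SubobjectCompletion.isUnitaryEquivalence_of.comp MaxTensor.isUnitaryEquivalence_curry

/-- The inverse functor comes with two unrelated isomorphisms; the counit is then corrected to
satisfy the triangle identity, while the `1`-morphism stays `F`. -/
lemma exists_equivalence {C D : CStarLin.{u}} (F : C ⟶ D)
    (hF : StarFunctor.IsUnitaryEquivalence F) : ∃ e : Bicategory.Equivalence C D, e.hom = F := by
  obtain ⟨G, ⟨η⟩, ⟨θ⟩⟩ := hF.exists_inverse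
  exact ⟨Bicategory.Equivalence.mkOfAdjointifyCounit (f := F) (g := G) η θ, rfl⟩

/-- The inclusion of the pairs of objects. -/
@[reducible] def ofPair (A : U.carrier) (B : V.carrier) : (tensor U V).carrier :=
  (SubobjectCompletion.of (MaxTensor U.carrier V.carrier)).obj ⟨A, B⟩

/-- The canonical isomorphism from `F ⊠ G` of a pair to the pair of images. -/
def tensorMapOf (F : U ⟶ U') (G : V ⟶ V') (A : U.carrier) (B : V.carrier) :
    (tensorMap F G).obj (ofPair A B) ⟶ ofPair (F.obj A) (G.obj B) :=
  SubobjectCompletion.mapOf (MaxTensor.map F G) ⟨A, B⟩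

/-- The images `f'` and `g'` are kept as variables so that an identity can stand for the image of an
identity. This is the form that occurs when one variable is held fixed. -/
lemma tensorMapOf_naturality (F : U ⟶ U') (G : V ⟶ V') {A A' : U.carrier} {B B' : V.carrier}
    (f : A ⟶ A') (g : B ⟶ B') {f' : F.obj A ⟶ F.obj A'} {g' : G.obj B ⟶ G.obj B'}
    (hf : F.map f = f') (hg : G.map g = g') :
    (tensorMap F G).map ((SubobjectCompletion.of _).map
        (MaxTensor.tmul (X := ⟨A, B⟩) (Y := ⟨A', B'⟩) f g)) ≫ tensorMapOf F G A' B' =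
      tensorMapOf F G A B ≫ (SubobjectCompletion.of _).map
        (MaxTensor.tmul (X := ⟨F.obj A, G.obj B⟩) (Y := ⟨F.obj A', G.obj B'⟩) f' g') := by
  subst hf hg
  exact (SubobjectCompletion.mapOf_naturality (MaxTensor.map F G) _).trans
    (congrArg (fun x => tensorMapOf F G A B ≫ (SubobjectCompletion.of _).map x)
      (MaxTensor.mapHom_tmul F G (X := ⟨A, B⟩) (Y := ⟨A', B'⟩) f g))

lemma map_comp_congr (K : V ⟶ W) (H : W ⟶ W') {X Y Y' Z : V.carrier} {a : X ⟶ Y} {b : Y ⟶ Z}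
    {c : X ⟶ Y'} {d : Y' ⟶ Z} (h : a ≫ b = c ≫ d) :
    H.map (K.map a) ≫ H.map (K.map b) = H.map (K.map c) ≫ H.map (K.map d) := by
  rw [← H.map_comp, ← H.map_comp, ← K.map_comp, ← K.map_comp, h]

/-- The isomorphism expressing the pseudonaturality of `curry`. -/
def curryNat (F : U' ⟶ U) (G : V' ⟶ V) (H : W ⟶ W') :
    ihomMap (tensorMap F G) H ≫ curry U' V' W' ⟶ curry U V W ≫ ihomMap F (ihomMap G H) :=
  StarFunctor.mkNat (F := (ihomMap (tensorMap F G) H).comp (curry U' V' W'))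
    (G := (curry U V W).comp (ihomMap F (ihomMap G H)))
    (fun K => StarFunctor.mkNat
      (F := ((ihomMap (tensorMap F G) H).comp (curry U' V' W')).obj K)
      (G := ((curry U V W).comp (ihomMap F (ihomMap G H))).obj K)
      (fun A => StarFunctor.mkNat
        (F := (((ihomMap (tensorMap F G) H).comp (curry U' V' W')).obj K).obj A)
        (G := (((curry U V W).comp (ihomMap F (ihomMap G H))).obj K).obj A)
        (fun B => H.map (K.map (tensorMapOf F G A B))) 1
        (fun B => (H.norm_map_le _).trans ((K.norm_map_le _).trans
          (SubobjectCompletion.norm_mapOf_le _ _)))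
        -- Naturality in the second variable: the square of `tensorMapOf` at `1 ⊗ g`, carried along
        -- by `K` and `H`.
        (fun {B B'} g => map_comp_congr K H
          (tensorMapOf_naturality F G (𝟙 A) g (F.map_id A) rfl)))
      1 (fun A => StarFunctor.norm_nat_le _ zero_le_one fun B =>
        (H.norm_map_le _).trans ((K.norm_map_le _).trans
          (SubobjectCompletion.norm_mapOf_le _ _)))
      -- Naturality in the first variable, from the square at `f ⊗ 1`.
      (fun {A A'} f => StarFunctor.nat_ext fun B => map_comp_congr K H
        (tensorMapOf_naturality F G f (𝟙 B) rfl (G.map_id B))))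
    1 (fun K => StarFunctor.norm_nat_le _ zero_le_one fun A =>
      StarFunctor.norm_nat_le _ zero_le_one fun B =>
        (H.norm_map_le _).trans ((K.norm_map_le _).trans
          (SubobjectCompletion.norm_mapOf_le _ _)))
    -- Naturality in the functor `K` is naturality of `τ` at the morphism `tensorMapOf`.
    (fun {K L} τ => StarFunctor.nat_ext fun A => StarFunctor.nat_ext fun B => by
      have := StarFunctor.naturality τ (tensorMapOf F G A B)
      have h2 := congrArg H.map this.symm
      rw [H.map_comp, H.map_comp] at h2
      exact h2)

lemma tensorMapOf_id (A : U.carrier) (B : V.carrier) :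
    tensorMapOf (𝟙 U) (𝟙 V) A B = StarFunctor.app (tensorId U V).hom (ofPair A B) :=
  SubobjectCompletion.hom_ext (Category.comp_id _).symm

/-- All underlying morphisms are images of identities, so both sides reduce to the same identity.
The composition axiom of the strong transformation rests on this equation. -/
lemma tensorMapOf_comp (F' : U'' ⟶ U') (F : U' ⟶ U) (G' : V'' ⟶ V') (G : V' ⟶ V)
    (A : U''.carrier) (B : V''.carrier) :
    tensorMapOf (F' ≫ F) (G' ≫ G) A B =
      StarFunctor.app (tensorComp F' F G' G).hom (ofPair A B) ≫
        (tensorMap F G).map (tensorMapOf F' G' A B) ≫ tensorMapOf F G (F'.obj A) (G'.obj B) := by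
  refine SubobjectCompletion.hom_ext ?_
  let M' := MaxTensor.map F' G'
  let M := MaxTensor.map F G
  let X : MaxTensor U''.carrier V''.carrier := ⟨A, B⟩
  have h : M.map (M'.map (𝟙 X)) ≫ M.map (𝟙 (M'.obj X)) = 𝟙 (M.obj (M'.obj X)) := by
    rw [M'.map_id, M.map_id, Category.comp_id]
  have h' : (MaxTensor.map (F' ≫ F) (G' ≫ G)).map (𝟙 X) = 𝟙 (M.obj (M'.obj X)) :=
    (MaxTensor.map (F' ≫ F) (G' ≫ G)).map_id X
  change (MaxTensor.map (F' ≫ F) (G' ≫ G)).map (𝟙 X) =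
    ((MaxTensor.map (F' ≫ F) (G' ≫ G)).map (𝟙 X) ≫ 𝟙 (M.obj (M'.obj X))) ≫
      M.map (M'.map (𝟙 X)) ≫ M.map (𝟙 (M'.obj X))
  rw [h]
  exact ((Category.comp_id _).trans (Category.comp_id _)).symm

/-- The tensor of `α` and `β` is written as a product of two one-variable factors, since the
iterated hom treats the variables one at a time; compare `app₃_homHom_map₂`. -/
lemma tensorMapOf_naturality₂ {F F' : U' ⟶ U} {G G' : V' ⟶ V} (α : F ⟶ F') (β : G ⟶ G')
    (A : U'.carrier) (B : V'.carrier) :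
    StarFunctor.app (tensorMap₂ α β) (ofPair A B) ≫ tensorMapOf F' G' A B =
      tensorMapOf F G A B ≫ (SubobjectCompletion.of _).map
        (MaxTensor.tmul (X := ⟨F.obj A, G.obj B⟩) (Y := ⟨F'.obj A, G.obj B⟩)
          (StarFunctor.app α A) (𝟙 (G.obj B))) ≫
        (SubobjectCompletion.of _).map
        (MaxTensor.tmul (X := ⟨F'.obj A, G.obj B⟩) (Y := ⟨F'.obj A, G'.obj B⟩)
          (𝟙 (F'.obj A)) (StarFunctor.app β B)) := by
  refine SubobjectCompletion.hom_ext ?_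
  let M := MaxTensor.map F G
  let M' := MaxTensor.map F' G'
  let X : MaxTensor U'.carrier V'.carrier := ⟨A, B⟩
  change (M.map (𝟙 X) ≫ MaxTensor.tmul (X := M.obj X) (Y := M'.obj X)
      (StarFunctor.app α A) (StarFunctor.app β B)) ≫ M'.map (𝟙 X) =
    M.map (𝟙 X) ≫ MaxTensor.tmul (X := M.obj X) (Y := ⟨F'.obj A, G.obj B⟩)
          (StarFunctor.app α A) (𝟙 (G.obj B)) ≫
        MaxTensor.tmul (X := ⟨F'.obj A, G.obj B⟩) (Y := M'.obj X)
          (𝟙 (F'.obj A)) (StarFunctor.app β B)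
  rw [M'.map_id, Category.comp_id]
  exact congrArg (M.map (𝟙 X) ≫ ·) (MaxTensor.tmul_eq_comp (X := M.obj X) (Y := M'.obj X) _ _)

/-- The components of a transformation between functors `C ⟶ C*lin(D, E)`. -/
def app₂ {C D E : CStarLin.{u}} {S T : C ⟶ ihom D E} (τ : S ⟶ T) (K : C.carrier)
    (A : D.carrier) : (show StarFunctor D.carrier E.carrier from S.obj K).obj A ⟶
      (show StarFunctor D.carrier E.carrier from T.obj K).obj A :=
  StarFunctor.app (StarFunctor.app τ K) A

/-- The components of a transformation between functors `C ⟶ C*lin(U, C*lin(V, W))`. -/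
def app₃ {C U V W : CStarLin.{u}} {S T : C ⟶ ihom U (ihom V W)} (τ : S ⟶ T) (K : C.carrier)
    (A : U.carrier) (B : V.carrier) :
    ((show StarFunctor U.carrier (StarFunctor V.carrier W.carrier) from S.obj K).obj A).obj B ⟶
      ((show StarFunctor U.carrier (StarFunctor V.carrier W.carrier) from T.obj K).obj A).obj B :=
  StarFunctor.app (StarFunctor.app (StarFunctor.app τ K) A) B

lemma app₃_ext {C U V W : CStarLin.{u}} {S T : C ⟶ ihom U (ihom V W)} {σ τ : S ⟶ T}
    (h : ∀ K A B, app₃ σ K A B = app₃ τ K A B) : σ = τ :=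
  StarFunctor.nat_ext fun K => StarFunctor.nat_ext fun A => StarFunctor.nat_ext fun B => h K A B

/-- Removes the identity factors left by the trivial cells in a composite pseudofunctor. -/
lemma comp_id_id_id {C : Type u₁} [Category.{v₁} C] {X Y : C} {a b : X ⟶ Y} (h : a = b) :
    (a ≫ 𝟙 Y ≫ 𝟙 Y) ≫ 𝟙 Y = b := by
  simp [h]

/-! ### Components of the structure cells of the two pseudofunctors -/

section

variable {X Y Z : CStarLin.{u}ᵒᵖ × CStarLin.{u}ᵒᵖ × CStarLin.{u}}

/-- The cells of `ihomFunctor` for identities have identity components, but composing pseudofunctors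
leaves images of identities under `K` and `K A`; functoriality removes these. -/
lemma app₃_homHom_mapId (K : (ihom X.1.unop (ihom X.2.1.unop X.2.2)).carrier)
    (A : X.1.unop.carrier) (B : X.2.1.unop.carrier) :
    app₃ (homHom.mapId X).hom K A B = 𝟙 ((K.obj A).obj B) := by
  have h : app₃ (homHom.mapId X).hom K A B =
      (StarFunctor.app (K.map (𝟙 A)) B ≫
        (((K.obj A).map (𝟙 B) ≫ 𝟙 ((K.obj A).obj B)) ≫ 𝟙 ((K.obj A).obj B))) ≫
          𝟙 ((K.obj A).obj B) := by
    exact rfl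
  rw [h, K.map_id, (K.obj A).map_id, Category.comp_id, Category.comp_id, Category.comp_id,
    Category.comp_id]
  exact StarFunctor.app_id _ _

/-- Among the nested cells only the one of `⊠` contributes, and it enters through `K`. -/
lemma app₂_homTensor_mapId (K : (ihom (tensor X.1.unop X.2.1.unop) X.2.2).carrier)
    (P : (tensor X.1.unop X.2.1.unop).carrier) :
    app₂ (homTensor.mapId X).hom K P =
      K.map (StarFunctor.app (tensorId X.1.unop X.2.1.unop).hom P) := by
  let Q := (tensorMap (𝟙 X.1.unop) (𝟙 X.2.1.unop)).obj P
  have h : app₂ (homTensor.mapId X).hom K P =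
      (K.map (X := Q) (Y := P)
        (StarFunctor.app (tensorMap₂ (𝟙 (𝟙 X.1.unop)) (𝟙 (𝟙 X.2.1.unop) ≫ 𝟙 _)) P ≫
        StarFunctor.app (tensorId X.1.unop X.2.1.unop).hom P) ≫ 𝟙 (K.obj P) ≫ 𝟙 (K.obj P)) ≫
          𝟙 (K.obj P) := by
    exact rfl
  refine h.trans (comp_id_id_id (congrArg (K.map (X := Q) (Y := P)) ?_))
  rw [Category.comp_id, tensorMap₂_id]
  exact Category.id_comp _

variable (f : X ⟶ Y) (g : Y ⟶ Z)

lemma app₃_homHom_mapComp (K : (ihom X.1.unop (ihom X.2.1.unop X.2.2)).carrier)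
    (A : Z.1.unop.carrier) (B : Z.2.1.unop.carrier) :
    app₃ (homHom.mapComp f g).hom K A B = 𝟙 (g.2.2.obj (f.2.2.obj
      ((K.obj (f.1.unop.obj (g.1.unop.obj A))).obj (f.2.1.unop.obj (g.2.1.unop.obj B))))) := by
  let A' := f.1.unop.obj (g.1.unop.obj A)
  let B' := f.2.1.unop.obj (g.2.1.unop.obj B)
  have h : app₃ (homHom.mapComp f g).hom K A B =
      (g.2.2.map (f.2.2.map (StarFunctor.app (K.map (𝟙 A')) B')) ≫
        (g.2.2.map (f.2.2.map ((K.obj A').map (𝟙 B'))) ≫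
          𝟙 (g.2.2.obj (f.2.2.obj ((K.obj A').obj B')))) ≫
            𝟙 (g.2.2.obj (f.2.2.obj ((K.obj A').obj B')))) ≫
              𝟙 (g.2.2.obj (f.2.2.obj ((K.obj A').obj B'))) := by
    exact rfl
  rw [h, K.map_id, (K.obj A').map_id, f.2.2.map_id, g.2.2.map_id, Category.comp_id,
    Category.comp_id, Category.comp_id, Category.comp_id]
  exact (congrArg g.2.2.map (f.2.2.map_id _)).trans (g.2.2.map_id _)

/-- As for identities, the composition cell of `⊠` is the only contribution; the remaining factors
cancel. -/
lemma app₂_homTensor_mapComp (K : (ihom (tensor X.1.unop X.2.1.unop) X.2.2).carrier)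
    (P : (tensor Z.1.unop Z.2.1.unop).carrier) :
    app₂ (homTensor.mapComp f g).hom K P = g.2.2.map (f.2.2.map (K.map
      (StarFunctor.app (tensorComp g.1.unop f.1.unop g.2.1.unop f.2.1.unop).hom P))) := by
  let Q := (tensorMap (g.1.unop ≫ f.1.unop) (g.2.1.unop ≫ f.2.1.unop)).obj P
  let R := (tensorMap f.1.unop f.2.1.unop).obj ((tensorMap g.1.unop g.2.1.unop).obj P)
  have h : app₂ (homTensor.mapComp f g).hom K P =
      (g.2.2.map (f.2.2.map (K.map (X := Q) (Y := R)
        (StarFunctor.app (tensorMap₂ (𝟙 (g.1.unop ≫ f.1.unop))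
          (𝟙 (g.2.1.unop ≫ f.2.1.unop) ≫ 𝟙 _)) P ≫
            StarFunctor.app (tensorComp g.1.unop f.1.unop g.2.1.unop f.2.1.unop).hom P))) ≫
        𝟙 (g.2.2.obj (f.2.2.obj (K.obj R))) ≫ 𝟙 (g.2.2.obj (f.2.2.obj (K.obj R)))) ≫
            𝟙 (g.2.2.obj (f.2.2.obj (K.obj R))) := by
    exact rfl
  refine h.trans (comp_id_id_id
    (congrArg (fun x => g.2.2.map (f.2.2.map (K.map (X := Q) (Y := R) x))) ?_))
  rw [Category.comp_id, tensorMap₂_id]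
  exact Category.id_comp _

variable {f} {f' : X ⟶ Y} (η : f ⟶ f')

lemma app₃_homHom_map₂ (K : (ihom X.1.unop (ihom X.2.1.unop X.2.2)).carrier)
    (A : Y.1.unop.carrier) (B : Y.2.1.unop.carrier) :
    app₃ (homHom.map₂ η) K A B = 
      f.2.2.map (StarFunctor.app (K.map (StarFunctor.app η.1.unop2 A)) (f.2.1.unop.obj B)) ≫
        f.2.2.map ((K.obj (f'.1.unop.obj A)).map (StarFunctor.app η.2.1.unop2 B)) ≫
          StarFunctor.app η.2.2 ((K.obj (f'.1.unop.obj A)).obj (f'.2.1.unop.obj B)) := by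
  exact rfl

lemma app₂_homTensor_map₂ (K : (ihom (tensor X.1.unop X.2.1.unop) X.2.2).carrier)
    (P : (tensor Y.1.unop Y.2.1.unop).carrier) :
    app₂ (homTensor.map₂ η) K P =
      f.2.2.map (K.map (StarFunctor.app (tensorMap₂ η.1.unop2 η.2.1.unop2) P)) ≫
        StarFunctor.app η.2.2 (K.obj ((tensorMap f'.1.unop f'.2.1.unop).obj P)) := by
  exact rfl

end

/-- The components are images of the unitary `tensorMapOf` under the `*`-functors `K` and `H`, so
they are unitary. -/
lemma curryNat_comp_adj (F : U' ⟶ U) (G : V' ⟶ V) (H : W ⟶ W') :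
    curryNat F G H ≫ adj (C := StarFunctor _ _) (curryNat F G H) = 𝟙 _ :=
  app₃_ext fun K A B => by
    have h : H.map (K.map (tensorMapOf F G A B)) ≫ adj (H.map (K.map (tensorMapOf F G A B))) =
        𝟙 (H.obj (K.obj ((tensorMap F G).obj (ofPair A B)))) := by
      rw [← H.map_adj, ← K.map_adj, ← H.map_comp, ← K.map_comp]
      refine (congrArg (fun x => H.map (K.map x)) (SubobjectCompletion.mapOf_comp_adj _ _)).trans ?_
      exact (congrArg H.map (K.map_id _)).trans (H.map_id _)
    exact h

lemma adj_curryNat_comp (F : U' ⟶ U) (G : V' ⟶ V) (H : W ⟶ W') :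
    adj (C := StarFunctor _ _) (curryNat F G H) ≫ curryNat F G H = 𝟙 _ :=
  app₃_ext fun K A B => by
    have h : adj (H.map (K.map (tensorMapOf F G A B))) ≫ H.map (K.map (tensorMapOf F G A B)) =
        𝟙 (H.obj (K.obj (ofPair (F.obj A) (G.obj B)))) := by
      rw [← H.map_adj, ← K.map_adj, ← H.map_comp, ← K.map_comp]
      refine (congrArg (fun x => H.map (K.map x)) (SubobjectCompletion.adj_mapOf_comp _ _)).trans ?_
      exact (congrArg H.map (K.map_id _)).trans (H.map_id _)
    exact h

/-- The isomorphism expressing the pseudonaturality of `curry`. -/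
def curryNatIso (F : U' ⟶ U) (G : V' ⟶ V) (H : W ⟶ W') :
    ihomMap (tensorMap F G) H ≫ curry U' V' W' ≅ curry U V W ≫ ihomMap F (ihomMap G H) where
  hom := curryNat F G H
  inv := adj (C := StarFunctor _ _) (curryNat F G H)
  hom_inv_id := curryNat_comp_adj F G H
  inv_hom_id := adj_curryNat_comp F G H

/-! ### Coherence and assembly of the pseudonatural transformation -/

section

universe w₁ w₂ w₃

variable {B : Type w₁} [Bicategory.{w₂, w₃} B] {F G : B ⥤ᵖ CStarLin.{u}}

/-- A strong transformation of pseudofunctors to `CStarLin` whose coherence conditions are checked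
on components. -/
def mkStrongTrans (app : ∀ a, F.obj a ⟶ G.obj a)
    (nat : ∀ {a b : B} (f : a ⟶ b), F.map f ≫ app b ≅ app a ≫ G.map f)
    (naturality : ∀ {a b : B} {f g : a ⟶ b} (η : f ⟶ g) (K : (F.obj a).carrier),
      (app b).map (StarFunctor.app (F.map₂ η) K) ≫ StarFunctor.app (nat g).hom K =
        StarFunctor.app (nat f).hom K ≫ StarFunctor.app (G.map₂ η) ((app a).obj K))
    (id : ∀ (a : B) (K : (F.obj a).carrier),
      StarFunctor.app (nat (𝟙 a)).hom K ≫ StarFunctor.app (G.mapId a).hom ((app a).obj K) =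
        (app a).map (StarFunctor.app (F.mapId a).hom K))
    (comp : ∀ {a b c : B} (f : a ⟶ b) (g : b ⟶ c) (K : (F.obj a).carrier),
      StarFunctor.app (nat (f ≫ g)).hom K ≫
          StarFunctor.app (G.mapComp f g).hom ((app a).obj K) =
        (app c).map (StarFunctor.app (F.mapComp f g).hom K) ≫
          StarFunctor.app (nat g).hom ((F.map f).obj K) ≫
            (G.map g).map (StarFunctor.app (nat f).hom K)) :
    Pseudofunctor.StrongTrans F G where
  app := app
  naturality := nat
  naturality_naturality η := StarFunctor.nat_ext fun K => naturality η K
  -- The associators and unitors of `CStarLin` have identity components, so they drop out of the two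
  -- remaining axioms.
  naturality_id a := StarFunctor.nat_ext fun K => (id a K).trans
    ((congrArg (_ ≫ ·) (Category.comp_id _)).trans (Category.comp_id _)).symm
  naturality_comp f g := StarFunctor.nat_ext fun K => (comp f g K).trans <|
    congrArg (_ ≫ ·) <| Eq.symm <| (Category.id_comp _).trans <| congrArg (_ ≫ ·) <|
      (Category.id_comp _).trans (Category.comp_id _)

end

variable {X Y Z : CStarLin.{u}ᵒᵖ × CStarLin.{u}ᵒᵖ × CStarLin.{u}}

/-- The functor `curry` for a triple. -/
def curryApp (X : CStarLin.{u}ᵒᵖ × CStarLin.{u}ᵒᵖ × CStarLin.{u}) :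
    homTensor.obj X ⟶ homHom.obj X := curry X.1.unop X.2.1.unop X.2.2

/-- The pseudonaturality of `curry` for a morphism of triples. -/
def curryNatApp (f : X ⟶ Y) :
    homTensor.map f ≫ curryApp Y ≅ curryApp X ≫ homHom.map f :=
  curryNatIso f.1.unop f.2.1.unop f.2.2

lemma nat_ext₂ {U V W : CStarLin.{u}} {S T : (ihom U (ihom V W)).carrier} {σ τ : S ⟶ T}
    (h : ∀ A B, StarFunctor.app (StarFunctor.app σ A) B = StarFunctor.app (StarFunctor.app τ A) B) :
    σ = τ :=
  StarFunctor.nat_ext fun A => StarFunctor.nat_ext fun B => h A B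

lemma map_comp_congr₃ (K : V ⟶ W) (H : W ⟶ W') {X Y Z P Q : V.carrier} {a : X ⟶ Y} {b : Y ⟶ Z}
    {c : X ⟶ P} {d : P ⟶ Q} {e : Q ⟶ Z} (h : a ≫ b = c ≫ d ≫ e) :
    H.map (K.map a) ≫ H.map (K.map b) =
      H.map (K.map c) ≫ H.map (K.map d) ≫ H.map (K.map e) := by
  rw [← H.map_comp, ← H.map_comp, ← H.map_comp, ← K.map_comp, ← K.map_comp, ← K.map_comp, h]

lemma map_map_map_comp {C C₁ C₂ C₃ : CStarLin.{u}} (K : C ⟶ C₁) (H : C₁ ⟶ C₂) (L : C₂ ⟶ C₃)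
    {X Y Z T : C.carrier} {x : X ⟶ T} {a : X ⟶ Y} {b : Y ⟶ Z} {c : Z ⟶ T} (h : x = a ≫ b ≫ c) :
    L.map (H.map (K.map x)) =
      L.map (H.map (K.map a)) ≫ L.map (H.map (K.map b)) ≫ L.map (H.map (K.map c)) := by
  rw [h, K.map_comp, K.map_comp, H.map_comp, H.map_comp, L.map_comp, L.map_comp]

/-- Naturality of `γ` moves it past the comparison unitary; what remains is the image of
`tensorMapOf_naturality₂` under `K` and `H`. -/
lemma curryNat_naturality {F F' : U' ⟶ U} {G G' : V' ⟶ V} {H H' : W ⟶ W'} (α : F ⟶ F')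
    (β : G ⟶ G') (γ : H ⟶ H') (K : (ihom (tensor U V) W).carrier) (A : U'.carrier)
    (B : V'.carrier) :
    (H.map (K.map (StarFunctor.app (tensorMap₂ α β) (ofPair A B))) ≫
      StarFunctor.app γ (K.obj ((tensorMap F' G').obj (ofPair A B)))) ≫
        H'.map (K.map (tensorMapOf F' G' A B)) =
      H.map (K.map (tensorMapOf F G A B)) ≫
        H.map (K.map ((SubobjectCompletion.of _).map
          (MaxTensor.tmul (X := ⟨F.obj A, G.obj B⟩) (Y := ⟨F'.obj A, G.obj B⟩)
            (StarFunctor.app α A) (𝟙 (G.obj B))))) ≫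
        H.map (K.map ((SubobjectCompletion.of _).map
          (MaxTensor.tmul (X := ⟨F'.obj A, G.obj B⟩) (Y := ⟨F'.obj A, G'.obj B⟩)
            (𝟙 (F'.obj A)) (StarFunctor.app β B)))) ≫
        StarFunctor.app γ (K.obj (ofPair (F'.obj A) (G'.obj B))) := by
  have h := map_comp_congr₃ K H (tensorMapOf_naturality₂ α β A B)
  rw [Category.assoc, ← StarFunctor.naturality, ← Category.assoc, h, Category.assoc,
    Category.assoc]

lemma curryNatApp_naturality {f g : X ⟶ Y} (η : f ⟶ g)
    (K : (ihom (tensor X.1.unop X.2.1.unop) X.2.2).carrier) (A : Y.1.unop.carrier)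
    (B : Y.2.1.unop.carrier) :
    app₂ (homTensor.map₂ η) K (ofPair A B) ≫
        g.2.2.map (K.map (tensorMapOf g.1.unop g.2.1.unop A B)) =
      f.2.2.map (K.map (tensorMapOf f.1.unop f.2.1.unop A B)) ≫
        app₃ (homHom.map₂ η) ((curry _ _ _).obj K) A B :=
  (congrArg (· ≫ g.2.2.map (K.map (tensorMapOf g.1.unop g.2.1.unop A B)))
    (app₂_homTensor_map₂ η K (ofPair A B))).trans <|
  (curryNat_naturality η.1.unop2 η.2.1.unop2 η.2.2 K A B).trans
  (congrArg (f.2.2.map (K.map (tensorMapOf f.1.unop f.2.1.unop A B)) ≫ ·)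
    (app₃_homHom_map₂ η ((curry _ _ _).obj K) A B)).symm

/-- The unit cell of the iterated hom is trivial on components, so the axiom says that `tensorMapOf`
for identity functors is the unit cell of `⊠`, which is `tensorMapOf_id`. -/
lemma curryNatApp_id (K : (ihom (tensor X.1.unop X.2.1.unop) X.2.2).carrier)
    (A : X.1.unop.carrier) (B : X.2.1.unop.carrier) :
    K.map (tensorMapOf (𝟙 X.1.unop) (𝟙 X.2.1.unop) A B) ≫
        app₃ (homHom.mapId X).hom ((curry _ _ _).obj K) A B =
      app₂ (homTensor.mapId X).hom K (ofPair A B) :=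
  (congrArg (K.map (tensorMapOf (𝟙 X.1.unop) (𝟙 X.2.1.unop) A B) ≫ ·)
    (app₃_homHom_mapId ((curry _ _ _).obj K) A B)).trans <|
  (Category.comp_id _).trans <|
  (congrArg K.map (tensorMapOf_id A B)).trans (app₂_homTensor_mapId K (ofPair A B)).symm

/-- The composition cell of the iterated hom is trivial on components, which leaves the image of
`tensorMapOf_comp` under the three functors. -/
lemma curryNatApp_comp (f : X ⟶ Y) (g : Y ⟶ Z)
    (K : (ihom (tensor X.1.unop X.2.1.unop) X.2.2).carrier)
    (A : Z.1.unop.carrier) (B : Z.2.1.unop.carrier) :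
    g.2.2.map (f.2.2.map (K.map (tensorMapOf (g.1.unop ≫ f.1.unop)
          (g.2.1.unop ≫ f.2.1.unop) A B))) ≫
        app₃ (homHom.mapComp f g).hom ((curry _ _ _).obj K) A B =
      app₂ (homTensor.mapComp f g).hom K (ofPair A B) ≫
        g.2.2.map (f.2.2.map (K.map ((tensorMap f.1.unop f.2.1.unop).map
          (tensorMapOf g.1.unop g.2.1.unop A B)))) ≫
        g.2.2.map (f.2.2.map (K.map (tensorMapOf f.1.unop f.2.1.unop
          (g.1.unop.obj A) (g.2.1.unop.obj B)))) := by
  have h := map_map_map_comp K f.2.2 g.2.2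
    (tensorMapOf_comp g.1.unop f.1.unop g.2.1.unop f.2.1.unop A B)
  refine (congrArg (_ ≫ ·) (app₃_homHom_mapComp f g ((curry _ _ _).obj K) A B)).trans ?_
  refine (Category.comp_id _).trans (h.trans ?_)
  exact (congrArg (· ≫ _) (app₂_homTensor_mapComp f g K (ofPair A B))).symm

/-- The pseudonatural transformation `C*lin(U ⊠ V, W) ⟶ C*lin(U, C*lin(V, W))`. -/
def curryTrans : Pseudofunctor.StrongTrans homTensor.{u} homHom.{u} :=
  mkStrongTrans curryApp curryNatApp
    (fun {_ Y _ _} η K => nat_ext₂ (U := Y.1.unop) (V := Y.2.1.unop) (W := Y.2.2)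
      (curryNatApp_naturality η K))
    (fun X K => nat_ext₂ (U := X.1.unop) (V := X.2.1.unop) (W := X.2.2) (curryNatApp_id K))
    (fun {_ _ Z} f g K => nat_ext₂ (U := Z.1.unop) (V := Z.2.1.unop) (W := Z.2.2)
      (curryNatApp_comp f g K))

end CStarLin

end CStarCat

end

theorem mainTheorem12 :
    ∃ Φ : CategoryTheory.Pseudofunctor.StrongTrans
        CStarCat.CStarLin.homTensor.{u} CStarCat.CStarLin.homHom.{u},
      ∀ U V W : CStarCat.CStarLin.{u},
        ∃ e : CategoryTheory.Bicategory.Equivalence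
            (CStarCat.CStarLin.ihom (CStarCat.CStarLin.tensor U V) W)
            (CStarCat.CStarLin.ihom U (CStarCat.CStarLin.ihom V W)),
          e.hom = Φ.app (Opposite.op U, Opposite.op V, W) :=
  -- The component at `(op U, op V, W)` is `curry U V W` by definition, so its unitary equivalence
  -- supplies the equivalence directly.
  ⟨CStarCat.CStarLin.curryTrans, fun U V W =>
    CStarCat.CStarLin.exists_equivalence _ (CStarCat.CStarLin.isUnitaryEquivalence_curry U V W)⟩
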